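/- Consider a finite Markov decision process with state space $\mathcal S$, action sets $\mathcal A_s$, set of state-action pairs $\mathcal X=\{(s,a):s\in\mathcal S,\ a\in\mathcal A_s\}$, $n=|\mathcal X|$, and transition matrix $P(s,a,s')$. Let $\pi$ be a policy, $P_\pi((s,a),(s',a'))=P(s,a,s')\pi(s',a')$, $\gamma\in(0,1)$, $k\ge 0$ an integer, and $M_{\pi,k}=P_\pi^k(I-\gamma P_\pi)^{-1}$. Let $\nu$ be a probability measure on $\mathcal X$ with full support and $\nu_{\mathrm{inv}}$ an invariant probability measure of $P_\pi$ with full support. Put $\langle f,g\rangle_\nu=\sum_x\nu(x)f(x)g(x)$ and $\|A\|_{2,\infty}=\sup_{f\ne0}\|Af\|_\infty/\|f\|_{\ell^2(\nu)}$. A $\nu$-SVD of a matrix $A\in\mathbb R^{\mathcal X\times\mathcal X}$ is a decomposition $A(x,y)=\sum_{i=1}^n\sigma_i\psi_i(x)\phi_i(y)\nu(y)$ with $\sigma_1\ge\dots\ge\sigma_n\ge0$ and with $(\psi_i)$, $(\phi_i)$ orthonormal for $\langle\cdot,\cdot\rangle_\nu$; $[A]_r$ is the sum of its first $r$ terms and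 $\xi(A)=\max_x\sum_i\sigma_i\psi_i(x)^2$. Let $d(\nu,\nu_{\mathrm{inv}})=\max_x\frac{\nu(x)}{\nu_{\mathrm{inv}}(x)}\cdot\max_x\frac{\nu_{\mathrm{inv}}(x)}{\nu(x)}$. From every pair $x\in\mathcal X$ one observes $Z_x$ transitions, all observations being independent and those from $x$ having law $P(x,\cdot)$; $Z=(Z_x)$ is deterministic. Let $\widehat P(x,s')$ be the fraction of the observed transitions from $x$ that lead to $s'$, and let $\widehat M_{\pi,k}$ be obtained from $\widehat P$ as $M_{\pi,k}$ is from $P$. Claim. For all constants $K_\xi,K_\sigma,K_\nu,K_d\in\mathbb R$ and $g>0$ there are constants $c,C>0$, depending on these only, such that the following holds for every such process, $\pi$, $\gamma$, $k$, $\nu$, $\nu_{\mathrm{inv}}$ and every integer $1\le r<n$. Let $\sigma_i$ be the singular values of $M_{\pi,k}$ in its $\nu$-SVD, and assume $$\xi(M_{\pi,k})\le K_\xi,\quad \frac{\sigma_1}{\sigma_r}\le K_\sigma,\quad \max_{x,x'\in\mathcal X}\frac{\nu(x)}{\nu(x')}\le K_\nu,\quad d(\nu,\nu_{\mathrm{inv}})\le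 K_d,\quad \sigma_r-\sigma_{r+1}\ge g .$$ Then for all $\delta\in(0,1)$ and $\varepsilon\in(0,1]$, if $$\min_{x\in\mathcal X}Z_x\ \ge\ c\,\max\bigl(k,(1-\gamma)^{-1}\bigr)^4\,\frac{\log(nr/\delta)}{\varepsilon^2},$$ then with probability at least $1-\delta$ one has $\|[\widehat M_{\pi,k}]_r-[M_{\pi,k}]_r\|_{2,\infty}\le C\varepsilon$, whichever $\nu$-SVD of $\widehat M_{\pi,k}$ is used. In particular, for bounded $k$ and $\gamma$ bounded away from $1$, $\Theta(\log(nr/\delta)/\varepsilon^2)$ observations per state-action pair suffice for an error $O(\varepsilon)$. -/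

import Mathlib

open MeasureTheory ProbabilityTheory
open scoped Matrix

universe u v w

namespace ShiftedSuccessor

noncomputable section

/-! ### Measure-induced norms and singular value decomposition -/

section Weighted

variable {X : Type*} [Fintype X]

/-- The norm of `ℓ²(ν)`: the square root of `∑ x, ν x * |f x| ^ 2`. -/
def l2Norm (ν : X → ℝ) (f : X → ℝ) : ℝ := Real.sqrt (∑ x, ν x * |f x| ^ 2)

/-- The norm of `ℓ^∞`. -/
def supNorm (f : X → ℝ) : ℝ := ⨆ x, |f x|

/-- The operator norm from `ℓ²(ν)` to `ℓ^∞`. -/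
def twoInftyNorm (ν : X → ℝ) (M : Matrix X X ℝ) : ℝ :=
  ⨆ f : {f : X → ℝ // f ≠ 0}, supNorm (M *ᵥ f.1) / l2Norm ν f.1

/-- `ν` is a probability measure on the finite set `X`, with support `X`. -/
structure IsFullProb (ν : X → ℝ) : Prop where
  pos : ∀ x, 0 < ν x
  sum_eq_one : ∑ x, ν x = 1

/-- A `ν`-SVD of `M`: non-increasing non-negative singular values and two bases of `ℝ^X` that are
orthonormal for `⟨f, g⟩_ν = ∑ x, ν x * f x * g x` such that `M = ∑ i, σ i • ψ i (φ i)†`,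
where `(φ i)†` is the row vector `y ↦ ν y * φ i y`. -/
structure NuSVD (ν : X → ℝ) (M : Matrix X X ℝ) where
  /-- the singular values, indexed from `0` -/
  σ : Fin (Fintype.card X) → ℝ
  /-- the left singular vectors -/
  ψ : Fin (Fintype.card X) → X → ℝ
  /-- the right singular vectors -/
  φ : Fin (Fintype.card X) → X → ℝ
  σ_nonneg : ∀ i, 0 ≤ σ i
  σ_antitone : Antitone σ
  ψ_orthonormal : ∀ i j, ∑ x, ν x * ψ i x * ψ j x = if i = j then 1 else 0
  φ_orthonormal : ∀ i j, ∑ x, ν x * φ i x * φ j x = if i = j then 1 else 0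
  eq_sum : ∀ x y, M x y = ∑ i, σ i * ψ i x * (ν y * φ i y)

namespace NuSVD

variable {ν : X → ℝ} {M : Matrix X X ℝ}

/-- The `j`-th singular value, `1 ≤ j ≤ n`, in the usual numbering `σ_1 ≥ σ_2 ≥ … ≥ σ_n`. -/
def singularValue (D : NuSVD ν M) (j : ℕ) : ℝ :=
  if h : 1 ≤ j ∧ j ≤ Fintype.card X then D.σ ⟨j - 1, by omega⟩ else 0

/-- The truncation `[M]_r` to rank `r`. -/
def trunc (D : NuSVD ν M) (r : ℕ) : Matrix X X ℝ :=
  Matrix.of fun x y =>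
    ∑ i ∈ Finset.univ.filter (fun i : Fin (Fintype.card X) => (i : ℕ) < r),
      D.σ i * D.ψ i x * (ν y * D.φ i y)

/-- The spectral recoverability `ξ(M) = max_x ∑ i, σ_i ψ_i(x)²`. -/
def recoverability (D : NuSVD ν M) : ℝ := ⨆ x, ∑ i, D.σ i * D.ψ i x ^ 2

end NuSVD

/-- The discrepancy `d(ν, ρ) = ‖dν/dρ‖_∞ ‖dρ/dν‖_∞` of two measures with full support. -/
def discrepancy (ν ρ : X → ℝ) : ℝ := (⨆ x, ν x / ρ x) * (⨆ x, ρ x / ν x)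

end Weighted

/-! ### Existence of the singular value decomposition -/

section Existence

theorem exists_svd_linear {E : Type*} [NormedAddCommGroup E] [InnerProductSpace ℝ E]
    [FiniteDimensional ℝ E] {n : ℕ} (hn : Module.finrank ℝ E = n) (T : E →ₗ[ℝ] E) :
    ∃ (σ : Fin n → ℝ) (a b : OrthonormalBasis (Fin n) ℝ E),
      (∀ i, 0 ≤ σ i) ∧ Antitone σ ∧ ∀ i, T (b i) = σ i • a i := by
  have hS : (LinearMap.adjoint T ∘ₗ T).IsSymmetric := T.isPositive_adjoint_comp_self.isSymmetric
  set b := hS.eigenvectorBasis hn with hb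
  set l := hS.eigenvalues hn with hl
  have hl0 : ∀ i, 0 ≤ l i := T.isPositive_adjoint_comp_self.nonneg_eigenvalues hn
  have hin : ∀ i j, inner ℝ (T (b i)) (T (b j)) = if i = j then l i else 0 := by
    intro i j
    have h1 : LinearMap.adjoint T (T (b j)) = l j • b j := by
      exact hS.apply_eigenvectorBasis hn j
    rw [← LinearMap.adjoint_inner_right, h1, inner_smul_right,
      orthonormal_iff_ite.1 b.orthonormal i j]
    split_ifs with h
    · subst h; simp
    · simp
  set s : Set (Fin n) := {i | l i ≠ 0}
  let w : Fin n → E := fun i => (Real.sqrt (l i))⁻¹ • T (b i)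
  have hw : Orthonormal ℝ (s.domRestrict w) := by
    rw [orthonormal_iff_ite]
    rintro ⟨i, hi⟩ ⟨j, hj⟩
    change inner ℝ ((Real.sqrt (l i))⁻¹ • T (b i)) ((Real.sqrt (l j))⁻¹ • T (b j)) = _
    rw [inner_smul_left, inner_smul_right, hin]
    simp only [Subtype.mk.injEq]
    split_ifs with h
    · subst h
      have hpos : 0 < l i := lt_of_le_of_ne (hl0 i) (Ne.symm hi)
      have h2 := Real.mul_self_sqrt (hl0 i)
      have h3 : Real.sqrt (l i) ≠ 0 := (Real.sqrt_pos.2 hpos).ne'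
      simp only [conj_trivial]
      field_simp
      nlinarith
    · simp
  obtain ⟨a, ha⟩ := hw.exists_orthonormalBasis_extension_of_card_eq (by simpa using hn)
  refine ⟨fun i => Real.sqrt (l i), a, b, fun i => Real.sqrt_nonneg _, ?_, ?_⟩
  · intro i j hij
    exact Real.sqrt_le_sqrt (hS.eigenvalues_antitone hn hij)
  · intro i
    by_cases hi : l i = 0
    · have : inner ℝ (T (b i)) (T (b i)) = (0 : ℝ) := by rw [hin]; simp [hi]
      rw [inner_self_eq_zero] at this
      simp [this, hi]
    · have hpos : 0 < l i := lt_of_le_of_ne (hl0 i) (Ne.symm hi)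
      have h3 : Real.sqrt (l i) ≠ 0 := (Real.sqrt_pos.2 hpos).ne'
      rw [ha i hi]
      simp [w, smul_smul, h3]

/-- Every square matrix has a `ν`-SVD when `ν` has full support. -/
theorem nonempty_nuSVD {X : Type*} [Fintype X] (ν : X → ℝ) (hν : ∀ x, 0 < ν x)
    (M : Matrix X X ℝ) : Nonempty (NuSVD ν M) := by
  classical
  let B : Matrix X X ℝ := Matrix.of fun x y => Real.sqrt (ν x) * M x y / Real.sqrt (ν y)
  have hs : ∀ x, Real.sqrt (ν x) ≠ 0 := fun x => (Real.sqrt_pos.2 (hν x)).ne'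
  have hss : ∀ x, Real.sqrt (ν x) * Real.sqrt (ν x) = ν x := fun x =>
    Real.mul_self_sqrt (hν x).le
  obtain ⟨σ, a, b, h0, hanti, hT⟩ := exists_svd_linear
    (E := EuclideanSpace ℝ X) (n := Fintype.card X) (by simp) (Matrix.toEuclideanLin B)
  have horth : ∀ c : OrthonormalBasis (Fin (Fintype.card X)) ℝ (EuclideanSpace ℝ X), ∀ i j,
      ∑ x, ν x * (c i x / Real.sqrt (ν x)) * (c j x / Real.sqrt (ν x))
        = if i = j then 1 else 0 := by
    intro c i j
    rw [← orthonormal_iff_ite.1 c.orthonormal i j, PiLp.inner_apply]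
    refine Finset.sum_congr rfl fun x _ => ?_
    rw [RCLike.inner_apply, conj_trivial]
    have := hs x
    field_simp
    rw [pow_two, hss]
    ring
  refine ⟨⟨σ, fun i x => a i x / Real.sqrt (ν x), fun i x => b i x / Real.sqrt (ν x), h0, hanti,
    horth a, horth b, ?_⟩⟩
  intro x y
  have h1 : B x y = ∑ i, σ i * a i x * b i y := by
    have h2 : (Matrix.toEuclideanLin B (EuclideanSpace.single y 1)) x = B x y := by
      simp [Matrix.toLpLin_apply]
    rw [← h2]
    conv_lhs => rw [← b.sum_repr' (EuclideanSpace.single y 1)]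
    simp [hT, Finset.sum_apply]
    refine Finset.sum_congr rfl fun i _ => ?_
    have h6 : inner ℝ (b i) (EuclideanSpace.single y 1) = b i y := by
      simp [EuclideanSpace.inner_single_right]
    rw [h6]
    ring
  have h3 : M x y = B x y * Real.sqrt (ν y) / Real.sqrt (ν x) := by
    have := hs x
    have := hs y
    simp only [B, Matrix.of_apply]
    field_simp
  rw [h3, h1, Finset.sum_mul, Finset.sum_div]
  refine Finset.sum_congr rfl fun i _ => ?_
  have h4 := hs x
  have h5 := hs y
  have h6 : σ i * (a i x / Real.sqrt (ν x)) * (ν y * (b i y / Real.sqrt (ν y)))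
      = σ i * a i x * b i y * (ν y / Real.sqrt (ν y)) / Real.sqrt (ν x) := by ring
  have h7 : ν y / Real.sqrt (ν y) = Real.sqrt (ν y) := Real.div_sqrt
  rw [h6, h7]

end Existence

/-! ### Markov decision processes and the shifted successor measure -/

section MDP

variable {St : Type*} {Act : St → Type*}

/-- `P` is the transition matrix of a Markov decision process with states `St` and actions `Act s`
in state `s`; the state-action pairs are the elements of `Σ s, Act s`. -/
structure IsTransition [Fintype St] (P : (Σ s, Act s) → St → ℝ) : Prop where
  nonneg : ∀ x s', 0 ≤ P x s'
  sum_eq_one : ∀ x, ∑ s', P x s' = 1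

/-- `π s a` is the probability of selecting the action `a` in the state `s`. -/
structure IsPolicy [∀ s, Fintype (Act s)] (π : ∀ s, Act s → ℝ) : Prop where
  nonneg : ∀ s a, 0 ≤ π s a
  sum_eq_one : ∀ s, ∑ a, π s a = 1

/-- The transition matrix `P_π((s,a),(s',a')) = P(s,a,s') π(s',a')` on state-action pairs. -/
def policyMatrix (P : (Σ s, Act s) → St → ℝ) (π : ∀ s, Act s → ℝ) :
    Matrix (Σ s, Act s) (Σ s, Act s) ℝ :=
  Matrix.of fun x y => P x y.1 * π y.1 y.2

/-- The `k`-shifted successor measure `P_π ^ k (I - γ P_π)⁻¹`. -/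
def successor [Fintype St] [DecidableEq St] [∀ s, Fintype (Act s)] [∀ s, DecidableEq (Act s)]
    (P : (Σ s, Act s) → St → ℝ) (π : ∀ s, Act s → ℝ) (γ : ℝ) (k : ℕ) :
    Matrix (Σ s, Act s) (Σ s, Act s) ℝ :=
  policyMatrix P π ^ k * (1 - γ • policyMatrix P π)⁻¹

/-- `ρ` is an invariant probability measure with full support of the Markov chain `Q`. -/
structure IsInvariant {X : Type*} [Fintype X] (Q : Matrix X X ℝ) (ρ : X → ℝ) : Prop
    extends IsFullProb ρ where
  invariant : ρ ᵥ* Q = ρ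

/-- The family `T` consists of independent observations, `Z x` of them from each state-action
pair `x`, the next state `T ⟨x, j⟩` having law `P x`. -/
structure IsTransitionSample [Fintype St] [MeasurableSpace St]
    {Ω : Type*} [MeasurableSpace Ω] (μ : Measure Ω) (P : (Σ s, Act s) → St → ℝ)
    (Z : (Σ s, Act s) → ℕ) (T : (Σ x : (Σ s, Act s), Fin (Z x)) → Ω → St) : Prop where
  measurable : ∀ i, Measurable (T i)
  law : ∀ i s', μ {ω | T i ω = s'} = ENNReal.ofReal (P i.1 s')
  indep : iIndepFun T μ

/-- The empirical estimator `P̂(s,a,s') = Y_{s,a,s'} / Z_{s,a}`, where `Y_{s,a,s'}` counts the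
observed transitions from `(s,a)` to `s'`. -/
def empirical [DecidableEq St] {Ω : Type*} {Z : (Σ s, Act s) → ℕ}
    (T : (Σ x : (Σ s, Act s), Fin (Z x)) → Ω → St) (ω : Ω) (x : Σ s, Act s) (s' : St) : ℝ :=
  ((Finset.univ.filter fun j : Fin (Z x) => T ⟨x, j⟩ ω = s').card : ℝ) / (Z x : ℝ)

end MDP

end

end ShiftedSuccessor

/-! Write Q for `P_π`, Q' for its empirical version, E = Q' - Q, S_m = Q^m (1 - γQ)⁻¹, M = S_k, and
use primes for the objects built from Q'.

Few quantities are really free. By Cauchy–Schwarz, |(Mf)(x)| ≤ ξ(M)‖f‖ in ℓ²(ν)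
(`NuSVD.abs_mulVec_le`). Taking f = 1 gives (1 - γ)⁻¹ ≤ ξ(M). Averaging over ν gives ∑ σ_i ≤ ξ(M),
so the gap forces r ≤ ξ(M)/g. Both ν and the invariant measure are comparable to the uniform one.
One constant Λ therefore dominates everything except n and k.

Let Π and Π' be the orthogonal projections on the r leading right singular vectors of M and M'. Then
[M']_r - [M]_r = (M' - M)Π' + M(Π' - Π). The second term is small by Wedin's bound
(`NuSVD.offSq_le`) and the bound on M from ℓ²(ν) to sup norm. For the first, a telescoping identity
(`shifted_sub`) reduces matters to χ, the largest entry of the vectors E S'_m φ'_j. The operator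
norm of E alone would lose a factor √n here, and φ'_j depends on the very row of E it is tested
against.

This is resolved by leaving one row out. Let Qx be Q' with row x reset to that of Q. Its singular
vectors are independent of row x of E, so Bernstein's inequality bounds that row against them by η
times their sup norm. Since Q' - Qx has a single nonzero row, Wedin's bound shows that the singular
subspaces of Q' and Qx differ by O((k+1)(χ + ηB)/√n), B being the largest entry of the ψ'_j. The
factor 1/√n exactly compensates the passage from ℓ²(ν) to entries. This bounds χ by a small multiple
of itself plus O(ηB) (`abs_row_mulVec_le`), while σ'_j ψ'_j = Mφ'_j + (M' - M)φ'_j bounds B through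
ξ(M) and χ. Both inequalities close when (k+1)η is small (`abs_trunc_sub_mulVec_le`).

The probabilistic input is gathered in `IsClose`. The Euclidean operator norm of E is bounded by
trace moments of its Hermitian dilation, through an exchangeable pairs inequality
(`Ex_trace_pow_le`, `pr_not_e2_le`). Almost invariance of the invariant measure under Q' keeps
column sums of powers and resolvents bounded (`tame_of_small`). The leave-one-out rows use
conditioning (`pr_abs_row_loo_le`). All probabilities are computed in a finite product space and
transferred at the end. -/

namespace ShiftedSuccessor

/-! ### The weighted inner product -/

section Inner

variable {X : Type*} [Fintype X] {ν : X → ℝ}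

/-- The inner product of `ℓ²(ν)`. -/
def ip (ν f g : X → ℝ) : ℝ := ∑ x, ν x * f x * g x

theorem ip_comm (f g : X → ℝ) : ip ν f g = ip ν g f :=
  Finset.sum_congr rfl fun _ _ => by ring

theorem ip_add_right (f g h : X → ℝ) : ip ν f (g + h) = ip ν f g + ip ν f h := by
  simp only [ip, ← Finset.sum_add_distrib, Pi.add_apply, mul_add]

theorem ip_sub_right (f g h : X → ℝ) : ip ν f (g - h) = ip ν f g - ip ν f h := by
  simp only [ip, ← Finset.sum_sub_distrib, Pi.sub_apply, mul_sub]

theorem ip_smul_right (a : ℝ) (f g : X → ℝ) : ip ν f (a • g) = a * ip ν f g := by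
  simp only [ip, Finset.mul_sum, Pi.smul_apply, smul_eq_mul]
  exact Finset.sum_congr rfl fun _ _ => by ring

theorem ip_sum_right {ι : Type*} (s : Finset ι) (f : X → ℝ) (g : ι → X → ℝ) :
    ip ν f (∑ i ∈ s, g i) = ∑ i ∈ s, ip ν f (g i) := by
  simp only [ip, Finset.sum_apply, Finset.mul_sum]
  exact Finset.sum_comm

theorem ip_self_nonneg (hν : ∀ x, 0 ≤ ν x) (f : X → ℝ) : 0 ≤ ip ν f f :=
  Finset.sum_nonneg fun x _ => by
    rw [mul_assoc]; exact mul_nonneg (hν x) (mul_self_nonneg _)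

theorem l2Norm_nonneg (f : X → ℝ) : 0 ≤ l2Norm ν f := Real.sqrt_nonneg _

theorem l2Norm_sq (hν : ∀ x, 0 ≤ ν x) (f : X → ℝ) : l2Norm ν f ^ 2 = ip ν f f := by
  have h : ∑ x, ν x * |f x| ^ 2 = ip ν f f :=
    Finset.sum_congr rfl fun x _ => by rw [sq_abs]; ring
  rw [l2Norm, h, Real.sq_sqrt (ip_self_nonneg hν f)]

theorem l2Norm_eq_norm (hν : ∀ x, 0 ≤ ν x) (f : X → ℝ) :
    l2Norm ν f = ‖(WithLp.toLp 2 (fun x => Real.sqrt (ν x) * f x) : EuclideanSpace ℝ X)‖ := by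
  rw [EuclideanSpace.norm_eq, l2Norm]
  congr 1
  refine Finset.sum_congr rfl fun x _ => ?_
  rw [Real.norm_eq_abs, sq_abs, sq_abs, mul_pow, Real.sq_sqrt (hν x)]

theorem l2Norm_add_le (hν : ∀ x, 0 ≤ ν x) (f g : X → ℝ) :
    l2Norm ν (f + g) ≤ l2Norm ν f + l2Norm ν g := by
  rw [l2Norm_eq_norm hν, l2Norm_eq_norm hν, l2Norm_eq_norm hν]
  refine le_trans (le_of_eq ?_) (norm_add_le _ _)
  congr 1
  ext x
  simp [mul_add]

theorem l2Norm_smul (hν : ∀ x, 0 ≤ ν x) (a : ℝ) (f : X → ℝ) :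
    l2Norm ν (a • f) = |a| * l2Norm ν f := by
  rw [l2Norm_eq_norm hν, l2Norm_eq_norm hν, ← Real.norm_eq_abs, ← norm_smul]
  congr 1
  ext x
  simp only [PiLp.smul_apply, Pi.smul_apply, smul_eq_mul]
  ring

theorem l2Norm_zero : l2Norm ν (0 : X → ℝ) = 0 := by simp [l2Norm]

theorem l2Norm_neg (f : X → ℝ) : l2Norm ν (-f) = l2Norm ν f := by simp [l2Norm]

theorem l2Norm_sub_le (hν : ∀ x, 0 ≤ ν x) (f g : X → ℝ) :
    l2Norm ν (f - g) ≤ l2Norm ν f + l2Norm ν g := by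
  rw [sub_eq_add_neg, ← l2Norm_neg g]
  exact l2Norm_add_le hν _ _

theorem abs_ip_le (hν : ∀ x, 0 ≤ ν x) (f g : X → ℝ) :
    |ip ν f g| ≤ l2Norm ν f * l2Norm ν g := by
  refine abs_le_of_sq_le_sq ?_ (mul_nonneg (l2Norm_nonneg _) (l2Norm_nonneg _))
  rw [mul_pow, l2Norm_sq hν, l2Norm_sq hν]
  have h := Finset.sum_mul_sq_le_sq_mul_sq Finset.univ
    (fun x => Real.sqrt (ν x) * f x) (fun x => Real.sqrt (ν x) * g x)
  have e : ∀ a b : X → ℝ, ∑ x, (Real.sqrt (ν x) * a x) * (Real.sqrt (ν x) * b x) = ip ν a b :=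
    fun a b => Finset.sum_congr rfl fun x _ => by
      linear_combination (a x * b x) * Real.mul_self_sqrt (hν x)
  simp only [sq (Real.sqrt _ * _)] at h
  rwa [e, e, e] at h

/-- The unweighted Euclidean norm. -/
noncomputable def e2 (f : X → ℝ) : ℝ := l2Norm (fun _ => 1) f

theorem e2_nonneg (f : X → ℝ) : 0 ≤ e2 f := Real.sqrt_nonneg _

theorem e2_sq (f : X → ℝ) : e2 f ^ 2 = ∑ x, f x ^ 2 := by
  rw [e2, l2Norm_sq (fun _ => zero_le_one)]
  exact Finset.sum_congr rfl fun x _ => by ring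

theorem abs_le_e2 (f : X → ℝ) (x : X) : |f x| ≤ e2 f := by
  refine abs_le_of_sq_le_sq ?_ (e2_nonneg f)
  rw [e2_sq]
  exact Finset.single_le_sum (f := fun x => f x ^ 2) (fun _ _ => sq_nonneg _) (Finset.mem_univ x)

theorem e2_le_of_sq_le {f : X → ℝ} {c : ℝ} (hc : 0 ≤ c) (h : ∑ x, f x ^ 2 ≤ c ^ 2) :
    e2 f ≤ c := by
  refine le_of_sq_le_sq ?_ hc
  rwa [e2_sq]

theorem e2_smul (a : ℝ) (f : X → ℝ) : e2 (a • f) = |a| * e2 f :=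
  l2Norm_smul (fun _ => zero_le_one) a f

theorem e2_single [DecidableEq X] (x : X) : e2 (Pi.single x (1 : ℝ)) = 1 := by
  have h : e2 (Pi.single x (1 : ℝ)) ^ 2 = 1 := by
    rw [e2_sq, Finset.sum_eq_single x] <;> simp +contextual
  nlinarith [e2_nonneg (Pi.single x (1 : ℝ))]

/-- With n the number of points, the hypothesis says that ν is at most K times uniform. The sharp
factor is √K; since 1 ≤ K, the cruder K avoids a square root. The next lemma is the converse
comparison. -/
theorem l2Norm_mul_le_e2 {n K : ℝ} (hn : 0 < n) (hK : 1 ≤ K) (hν : ∀ x, 0 ≤ ν x)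
    (h : ∀ x, n * ν x ≤ K) (f : X → ℝ) : Real.sqrt n * l2Norm ν f ≤ K * e2 f := by
  refine le_of_sq_le_sq ?_ (mul_nonneg (by linarith) (e2_nonneg f))
  rw [mul_pow, mul_pow, Real.sq_sqrt hn.le, l2Norm_sq hν, e2_sq, ip, Finset.mul_sum,
    Finset.mul_sum]
  refine Finset.sum_le_sum fun x _ => ?_
  nlinarith [sq_nonneg (f x), h x, mul_le_mul_of_nonneg_right (h x) (sq_nonneg (f x)),
    mul_nonneg (mul_nonneg (by linarith : (0:ℝ) ≤ K) (by linarith : (0:ℝ) ≤ K - 1)) (sq_nonneg (f x))]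

theorem e2_le_l2Norm {n K : ℝ} (hn : 0 < n) (hK : 1 ≤ K) (hν : ∀ x, 0 ≤ ν x)
    (h : ∀ x, 1 ≤ K * (n * ν x)) (f : X → ℝ) : e2 f ≤ K * Real.sqrt n * l2Norm ν f := by
  refine le_of_sq_le_sq ?_
    (mul_nonneg (mul_nonneg (by linarith) (Real.sqrt_nonneg _)) (l2Norm_nonneg f))
  rw [mul_pow, mul_pow, Real.sq_sqrt hn.le, l2Norm_sq hν, e2_sq, ip, Finset.mul_sum]
  refine Finset.sum_le_sum fun x _ => ?_
  have h1 : 1 ≤ K * (K * (n * ν x)) := by nlinarith [h x]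
  nlinarith [sq_nonneg (f x), mul_le_mul_of_nonneg_right h1 (sq_nonneg (f x))]

end Inner

/-! ### Non-negative matrices with bounded row and column sums -/

section RowCol

variable {X : Type*} [Fintype X]

/-- A non-negative matrix whose row sums and column sums are at most `c`. -/
structure RowColBdd (c : ℝ) (A : Matrix X X ℝ) : Prop where
  nonneg : ∀ x y, 0 ≤ A x y
  row : ∀ x, ∑ y, A x y ≤ c
  col : ∀ y, ∑ x, A x y ≤ c

namespace RowColBdd

variable {c : ℝ} {A : Matrix X X ℝ}

theorem abs_mulVec_le (h : RowColBdd c A) {f : X → ℝ} {b : ℝ} (hb : 0 ≤ b) (hf : ∀ y, |f y| ≤ b)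
    (x : X) : |(A *ᵥ f) x| ≤ c * b := by
  calc |∑ y, A x y * f y| ≤ ∑ y, |A x y * f y| := Finset.abs_sum_le_sum_abs _ _
    _ ≤ ∑ y, A x y * b := Finset.sum_le_sum fun y _ => by
        rw [abs_mul, abs_of_nonneg (h.nonneg x y)]
        exact mul_le_mul_of_nonneg_left (hf y) (h.nonneg x y)
    _ ≤ c * b := by rw [← Finset.sum_mul]; exact mul_le_mul_of_nonneg_right (h.row x) hb

theorem abs_sum_mul_le (h : RowColBdd c A) {f : X → ℝ} {b : ℝ} (hb : 0 ≤ b)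
    (hf : ∀ x, |f x| ≤ b) (y : X) : |∑ x, f x * A x y| ≤ c * b := by
  calc |∑ x, f x * A x y| ≤ ∑ x, |f x * A x y| := Finset.abs_sum_le_sum_abs _ _
    _ ≤ ∑ x, A x y * b := Finset.sum_le_sum fun x _ => by
        rw [abs_mul, abs_of_nonneg (h.nonneg x y), mul_comm]
        exact mul_le_mul_of_nonneg_left (hf x) (h.nonneg x y)
    _ ≤ c * b := by rw [← Finset.sum_mul]; exact mul_le_mul_of_nonneg_right (h.col y) hb

/-- Schur's test: Cauchy–Schwarz within each row uses the row sums, and exchanging the summations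
uses the column sums. This is why both are tracked throughout. -/
theorem e2_mulVec_le (h : RowColBdd c A) (hc : 0 ≤ c) (f : X → ℝ) : e2 (A *ᵥ f) ≤ c * e2 f := by
  refine e2_le_of_sq_le (mul_nonneg hc (e2_nonneg f)) ?_
  rw [mul_pow, e2_sq]
  calc ∑ x, (∑ y, A x y * f y) ^ 2 ≤ ∑ x, c * ∑ y, A x y * f y ^ 2 := by
        refine Finset.sum_le_sum fun x _ => ?_
        have h1 := Finset.sum_sq_le_sum_mul_sum_of_sq_le_mul Finset.univ (r := fun y => A x y * f y)
          (f := fun y => A x y) (g := fun y => A x y * f y ^ 2) (fun y _ => h.nonneg x y)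
          (fun y _ => mul_nonneg (h.nonneg x y) (sq_nonneg _))
          (fun y _ => by rw [mul_pow]; exact le_of_eq (by ring))
        exact h1.trans (mul_le_mul_of_nonneg_right (h.row x)
          (Finset.sum_nonneg fun y _ => mul_nonneg (h.nonneg x y) (sq_nonneg _)))
    _ = c * ∑ y, (∑ x, A x y) * f y ^ 2 := by
        rw [← Finset.mul_sum, Finset.sum_comm]
        simp only [Finset.sum_mul]
    _ ≤ c * ∑ y, c * f y ^ 2 := by
        refine mul_le_mul_of_nonneg_left (Finset.sum_le_sum fun y _ => ?_) hc
        exact mul_le_mul_of_nonneg_right (h.col y) (sq_nonneg _)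
    _ = c ^ 2 * ∑ y, f y ^ 2 := by rw [← Finset.mul_sum]; ring

end RowColBdd

end RowCol


/-! ### Orthonormal bases of `ℓ²(ν)` -/

section ONB

variable {X : Type*} [Fintype X] {ν : X → ℝ} {ι : Type*} [Fintype ι]

/-- An orthonormal basis of `ℓ²(ν)`. -/
structure IsONB (ν : X → ℝ) (φ : ι → X → ℝ) : Prop where
  orth : ∀ i j, ip ν (φ i) (φ j) = open Classical in if i = j then 1 else 0
  expand : ∀ f : X → ℝ, f = ∑ i, ip ν (φ i) f • φ i

/-- Orthonormality says that one square matrix is a left inverse of another. It is then also a right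
inverse, which is completeness. -/
theorem IsONB.of_orth {φ : Fin (Fintype.card X) → X → ℝ}
    (h : ∀ i j, ∑ x, ν x * φ i x * φ j x = if i = j then 1 else 0) : IsONB ν φ := by
  classical
  refine ⟨fun i j => by rw [ip, h]; simp, fun f => ?_⟩
  let A : Matrix (Fin (Fintype.card X)) X ℝ := Matrix.of fun i x => ν x * φ i x
  let B : Matrix X (Fin (Fintype.card X)) ℝ := Matrix.of fun x j => φ j x
  have hAB : A * B = 1 := by
    ext i j
    simp only [A, B, Matrix.mul_apply, Matrix.of_apply, h, Matrix.one_apply]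
  have hBA : B * A = 1 := (Matrix.mul_eq_one_comm_of_card_eq _ _ _ (by simp)).1 hAB
  have h1 : B *ᵥ (A *ᵥ f) = f := by rw [Matrix.mulVec_mulVec, hBA, Matrix.one_mulVec]
  conv_lhs => rw [← h1]
  ext x
  simp only [A, B, Matrix.mulVec, dotProduct, Matrix.of_apply, Finset.sum_apply, Pi.smul_apply,
    smul_eq_mul, ip]
  exact Finset.sum_congr rfl fun i _ => mul_comm _ _

namespace IsONB

variable {φ φ' : ι → X → ℝ}

theorem ip_self (h : IsONB ν φ) (i : ι) : ip ν (φ i) (φ i) = 1 := by rw [h.orth, if_pos rfl]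

theorem l2Norm_eq_one (h : IsONB ν φ) (hν : ∀ x, 0 ≤ ν x) (i : ι) : l2Norm ν (φ i) = 1 := by
  have h1 := l2Norm_sq hν (φ i)
  rw [h.ip_self] at h1
  nlinarith [l2Norm_nonneg (ν := ν) (φ i)]

theorem sum_ip_mul_ip (h : IsONB ν φ) (f g : X → ℝ) :
    ∑ i, ip ν (φ i) f * ip ν (φ i) g = ip ν f g := by
  conv_rhs => rw [h.expand g, ip_sum_right]
  refine Finset.sum_congr rfl fun i _ => ?_
  rw [ip_smul_right, ip_comm f, mul_comm]

theorem sum_ip_sq (h : IsONB ν φ) (f : X → ℝ) : ∑ i, ip ν (φ i) f ^ 2 = ip ν f f := by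
  rw [← h.sum_ip_mul_ip]; simp only [sq]

theorem ip_sum_smul (h : IsONB ν φ) (s : Finset ι) (a : ι → ℝ) (i : ι) :
    ip ν (φ i) (∑ j ∈ s, a j • φ j) = open Classical in if i ∈ s then a i else 0 := by
  simp only [ip_sum_right, ip_smul_right, h.orth, mul_ite, mul_one, mul_zero]
  classical
  convert Finset.sum_ite_eq s i a

theorem l2Norm_sum_smul_sq (h : IsONB ν φ) (hν : ∀ x, 0 ≤ ν x) (s : Finset ι) (a : ι → ℝ) :
    l2Norm ν (∑ j ∈ s, a j • φ j) ^ 2 = ∑ j ∈ s, a j ^ 2 := by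
  classical
  rw [l2Norm_sq hν, ← h.sum_ip_sq]
  simp only [h.ip_sum_smul, ite_pow]
  simp

theorem abs_ip_le (h : IsONB ν φ) (hν : ∀ x, 0 ≤ ν x) (i : ι) (f : X → ℝ) :
    |ip ν (φ i) f| ≤ l2Norm ν f := by
  simpa [h.l2Norm_eq_one hν] using ShiftedSuccessor.abs_ip_le hν (φ i) f

end IsONB

/-- The operator norm of the coefficient block `b` is at most its Frobenius norm. -/
theorem l2Norm_sum_cross_le {φ : ι → X → ℝ} (h : IsONB ν φ) (hν : ∀ x, 0 ≤ ν x) (s t : Finset ι)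
    (b : ι → ι → ℝ) {c : ι → ℝ} {C S : ℝ} (hC : 0 ≤ C) (hc : ∑ j ∈ t, c j ^ 2 ≤ C ^ 2)
    (hS : ∑ i ∈ s, ∑ j ∈ t, b i j ^ 2 ≤ S) :
    l2Norm ν (∑ i ∈ s, (∑ j ∈ t, b i j * c j) • φ i) ≤ Real.sqrt S * C := by
  have hS0 : 0 ≤ S :=
    (Finset.sum_nonneg fun _ _ => Finset.sum_nonneg fun _ _ => sq_nonneg _).trans hS
  refine le_of_sq_le_sq ?_ (mul_nonneg (Real.sqrt_nonneg _) hC)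
  rw [h.l2Norm_sum_smul_sq hν, mul_pow, Real.sq_sqrt hS0]
  calc ∑ i ∈ s, (∑ j ∈ t, b i j * c j) ^ 2
      ≤ ∑ i ∈ s, (∑ j ∈ t, b i j ^ 2) * C ^ 2 := Finset.sum_le_sum fun i _ =>
        (Finset.sum_mul_sq_le_sq_mul_sq t _ _).trans
          (mul_le_mul_of_nonneg_left hc (Finset.sum_nonneg fun _ _ => sq_nonneg _))
    _ ≤ S * C ^ 2 := by
        rw [← Finset.sum_mul]; exact mul_le_mul_of_nonneg_right hS (sq_nonneg _)

/-- The squared Frobenius norm of the part of the orthonormal family `φ`, restricted to `s`,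
that is orthogonal to the restriction of `φ'` to `s`. -/
noncomputable def offSq [DecidableEq ι] (ν : X → ℝ) (s : Finset ι) (φ φ' : ι → X → ℝ) : ℝ :=
  ∑ j ∈ s, ∑ i ∈ sᶜ, ip ν (φ' i) (φ j) ^ 2

variable [DecidableEq ι] {φ φ' : ι → X → ℝ}

/-- Both sides equal the cardinality of `s` minus the squared Frobenius norm of the block of mutual
inner products over `s`, which is symmetric in the two families. -/
theorem offSq_comm (h : IsONB ν φ) (h' : IsONB ν φ') (s : Finset ι) :
    offSq ν s φ φ' = offSq ν s φ' φ := by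
  have key : ∀ {a b : ι → X → ℝ}, IsONB ν a → IsONB ν b →
      offSq ν s a b = s.card - ∑ j ∈ s, ∑ i ∈ s, ip ν (b i) (a j) ^ 2 := by
    intro a b ha hb
    have : ∀ j, ∑ i ∈ sᶜ, ip ν (b i) (a j) ^ 2 = 1 - ∑ i ∈ s, ip ν (b i) (a j) ^ 2 := by
      intro j
      rw [← ha.ip_self j, ← hb.sum_ip_sq, ← Finset.sum_add_sum_compl s]
      ring
    simp only [offSq, this, Finset.sum_sub_distrib]
    simp
  rw [key h h', key h' h, Finset.sum_comm]
  simp only [ip_comm (φ' _)]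

/-- A member of the family is close to its projection on the other family. -/
theorem exists_approx (h' : IsONB ν φ') (hν : ∀ x, 0 ≤ ν x) (s : Finset ι)
    {j : ι} (hj : j ∈ s) :
    ∃ w : X → ℝ, φ j = ∑ i ∈ s, ip ν (φ' i) (φ j) • φ' i + w ∧
      l2Norm ν w ≤ Real.sqrt (offSq ν s φ φ') := by
  refine ⟨∑ i ∈ sᶜ, ip ν (φ' i) (φ j) • φ' i, ?_, ?_⟩
  · rw [Finset.sum_add_sum_compl]; exact h'.expand _
  · refine Real.le_sqrt_of_sq_le ?_
    rw [h'.l2Norm_sum_smul_sq hν]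
    exact Finset.single_le_sum (f := fun j => ∑ i ∈ sᶜ, ip ν (φ' i) (φ j) ^ 2)
      (fun _ _ => Finset.sum_nonneg fun _ _ => sq_nonneg _) hj

/-- The orthogonal projection on the span of a part of a family. -/
noncomputable def proj (ν : X → ℝ) (s : Finset ι) (φ : ι → X → ℝ) (f : X → ℝ) : X → ℝ :=
  ∑ i ∈ s, ip ν (φ i) f • φ i

/-- In the basis `φ` the blocks over `s × s` of the two projections cancel up to parts that pair an
index in `s` with one outside. Each of the two remaining blocks has squared Frobenius norm `offSq`,
hence the factor 2. -/
theorem l2Norm_proj_sub_proj_le (h : IsONB ν φ) (h' : IsONB ν φ') (hν : ∀ x, 0 ≤ ν x)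
    (s : Finset ι) (f : X → ℝ) :
    l2Norm ν (proj ν s φ' f - proj ν s φ f) ≤ 2 * Real.sqrt (offSq ν s φ φ') * l2Norm ν f := by
  have hcf : ∀ t : Finset ι, ∑ j ∈ t, ip ν (φ' j) f ^ 2 ≤ l2Norm ν f ^ 2 := by
    intro t
    rw [l2Norm_sq hν, ← h'.sum_ip_sq]
    exact Finset.sum_le_sum_of_subset_of_nonneg (Finset.subset_univ _) fun _ _ _ => sq_nonneg _
  have e : proj ν s φ' f - proj ν s φ f
      = ∑ i ∈ sᶜ, (∑ j ∈ s, ip ν (φ i) (φ' j) * ip ν (φ' j) f) • φ i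
        - ∑ i ∈ s, (∑ j ∈ sᶜ, ip ν (φ i) (φ' j) * ip ν (φ' j) f) • φ i := by
    have e1 : proj ν s φ' f = ∑ i ∈ s, (∑ j ∈ s, ip ν (φ i) (φ' j) * ip ν (φ' j) f) • φ i
        + ∑ i ∈ sᶜ, (∑ j ∈ s, ip ν (φ i) (φ' j) * ip ν (φ' j) f) • φ i := by
      rw [Finset.sum_add_sum_compl]
      conv_lhs => rw [h.expand (proj ν s φ' f)]
      refine Finset.sum_congr rfl fun i _ => ?_
      congr 1
      simp only [proj, ip_sum_right, ip_smul_right]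
      exact Finset.sum_congr rfl fun j _ => mul_comm _ _
    have e2 : proj ν s φ f = ∑ i ∈ s, (∑ j ∈ s, ip ν (φ i) (φ' j) * ip ν (φ' j) f) • φ i
        + ∑ i ∈ s, (∑ j ∈ sᶜ, ip ν (φ i) (φ' j) * ip ν (φ' j) f) • φ i := by
      rw [proj, ← Finset.sum_add_distrib]
      refine Finset.sum_congr rfl fun i _ => ?_
      rw [← add_smul, Finset.sum_add_sum_compl, ← h'.sum_ip_mul_ip]
      simp only [ip_comm (φ' _) (φ i)]
    rw [e1, e2]; abel
  rw [e]
  refine (l2Norm_sub_le hν _ _).trans ?_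
  have h1 := l2Norm_sum_cross_le h hν sᶜ s (fun i j => ip ν (φ i) (φ' j)) (l2Norm_nonneg f)
    (hcf s) (S := offSq ν s φ φ')
    (by rw [offSq_comm h h', offSq, Finset.sum_comm])
  have h2 := l2Norm_sum_cross_le h hν s sᶜ (fun i j => ip ν (φ i) (φ' j)) (l2Norm_nonneg f)
    (hcf sᶜ) (S := offSq ν s φ φ') (by rw [offSq]; simp only [ip_comm (φ' _)]; exact le_rfl)
  linarith

end ONB

/-! ### Perturbation of singular values and singular subspaces -/

namespace NuSVD

variable {X : Type*} [Fintype X] {ν : X → ℝ} {M M' : Matrix X X ℝ}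

theorem onb_left (D : NuSVD ν M) : IsONB ν D.ψ := .of_orth D.ψ_orthonormal

theorem onb_right (D : NuSVD ν M) : IsONB ν D.φ := .of_orth D.φ_orthonormal

theorem mulVec_eq_sum (D : NuSVD ν M) (f : X → ℝ) :
    M *ᵥ f = ∑ i, (D.σ i * ip ν (D.φ i) f) • D.ψ i := by
  ext x
  simp only [Matrix.mulVec, dotProduct, D.eq_sum, ip, Finset.sum_apply, Pi.smul_apply,
    smul_eq_mul, Finset.sum_mul, Finset.mul_sum]
  rw [Finset.sum_comm]
  exact Finset.sum_congr rfl fun i _ => Finset.sum_congr rfl fun y _ => by ring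

/-- Viewing truncation as a projection followed by `M` makes it depend only on the leading right
singular subspace, and not on the basis chosen in it. -/
theorem trunc_mulVec (D : NuSVD ν M) (r : ℕ) (f : X → ℝ) :
    D.trunc r *ᵥ f = M *ᵥ proj ν (Finset.univ.filter fun i : Fin (Fintype.card X) => (i : ℕ) < r) D.φ f := by
  rw [D.mulVec_eq_sum]
  simp only [proj, D.onb_right.ip_sum_smul]
  ext x
  simp only [Matrix.mulVec, dotProduct, trunc, Matrix.of_apply, Finset.sum_apply, Pi.smul_apply,
    smul_eq_mul, Finset.mem_filter, Finset.mem_univ, true_and, mul_ite, ite_mul, mul_zero,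
    zero_mul, ← Finset.sum_filter, Finset.sum_mul, ip, Finset.mul_sum]
  rw [Finset.sum_comm]
  exact Finset.sum_congr rfl fun i _ => Finset.sum_congr rfl fun y _ => by ring

theorem ip_left_mulVec (D : NuSVD ν M) (i) (f : X → ℝ) :
    ip ν (D.ψ i) (M *ᵥ f) = D.σ i * ip ν (D.φ i) f := by
  rw [D.mulVec_eq_sum, D.onb_left.ip_sum_smul]
  simp

theorem mulVec_right (D : NuSVD ν M) (i) : M *ᵥ D.φ i = D.σ i • D.ψ i := by
  rw [D.onb_left.expand (M *ᵥ D.φ i)]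
  simp only [ip_left_mulVec, D.onb_right.orth]
  simp

theorem l2Norm_mulVec_sq (D : NuSVD ν M) (hν : ∀ x, 0 ≤ ν x) (f : X → ℝ) :
    l2Norm ν (M *ᵥ f) ^ 2 = ∑ i, (D.σ i * ip ν (D.φ i) f) ^ 2 := by
  rw [D.mulVec_eq_sum, D.onb_left.l2Norm_sum_smul_sq hν]

/-- The average over ν of ∑ σ_i ψ_i(x)² is ∑ σ_i, because each ψ_i has norm 1, and an average is at
most the maximum. -/
theorem sum_σ_le (D : NuSVD ν M) (hν : IsFullProb ν) {K : ℝ} (hK : D.recoverability ≤ K) :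
    ∑ i, D.σ i ≤ K := by
  have h1 : ∀ x, ∑ i, D.σ i * D.ψ i x ^ 2 ≤ K := fun x =>
    (le_ciSup (f := fun x => ∑ i, D.σ i * D.ψ i x ^ 2) (Set.finite_range _).bddAbove x).trans hK
  calc ∑ i, D.σ i = ∑ i, D.σ i * ip ν (D.ψ i) (D.ψ i) := by simp [D.onb_left.ip_self]
    _ = ∑ x, ν x * ∑ i, D.σ i * D.ψ i x ^ 2 := by
        simp only [ip, Finset.mul_sum]
        rw [Finset.sum_comm]
        exact Finset.sum_congr rfl fun i _ => Finset.sum_congr rfl fun y _ => by ring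
    _ ≤ ∑ x, ν x * K := Finset.sum_le_sum fun x _ =>
        mul_le_mul_of_nonneg_left (h1 x) (hν.pos x).le
    _ = K := by rw [← Finset.sum_mul, hν.sum_eq_one, one_mul]

/-- Cauchy–Schwarz over the singular index leaves ∑ σ_i² ψ_i(x)², which is at most σ_1 ξ, and σ_1 ≤
∑ σ_i ≤ ξ. -/
theorem abs_mulVec_le (D : NuSVD ν M) (hν : IsFullProb ν) {K : ℝ} (hK : D.recoverability ≤ K)
    (f : X → ℝ) (x : X) : |(M *ᵥ f) x| ≤ K * l2Norm ν f := by
  have hν0 := fun x => (hν.pos x).le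
  have h1 : ∑ i, D.σ i * D.ψ i x ^ 2 ≤ K :=
    (le_ciSup (f := fun x => ∑ i, D.σ i * D.ψ i x ^ 2) (Set.finite_range _).bddAbove x).trans hK
  have hs := D.sum_σ_le hν hK
  have hK0 : 0 ≤ K := (Finset.sum_nonneg fun i _ => D.σ_nonneg i).trans hs
  have hσK : ∀ i, D.σ i ≤ K := fun i =>
    (Finset.single_le_sum (fun i _ => D.σ_nonneg i) (Finset.mem_univ i)).trans hs
  refine abs_le_of_sq_le_sq ?_ (mul_nonneg hK0 (l2Norm_nonneg f))
  rw [D.mulVec_eq_sum, mul_pow, l2Norm_sq hν0, ← D.onb_right.sum_ip_sq]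
  simp only [Finset.sum_apply, Pi.smul_apply, smul_eq_mul]
  calc (∑ i, D.σ i * ip ν (D.φ i) f * D.ψ i x) ^ 2
      = (∑ i, (D.σ i * D.ψ i x) * ip ν (D.φ i) f) ^ 2 := by
        congr 1; exact Finset.sum_congr rfl fun i _ => by ring
    _ ≤ (∑ i, (D.σ i * D.ψ i x) ^ 2) * ∑ i, ip ν (D.φ i) f ^ 2 :=
        Finset.sum_mul_sq_le_sq_mul_sq _ _ _
    _ ≤ K ^ 2 * ∑ i, ip ν (D.φ i) f ^ 2 := by
        refine mul_le_mul_of_nonneg_right ?_ (Finset.sum_nonneg fun _ _ => sq_nonneg _)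
        calc ∑ i, (D.σ i * D.ψ i x) ^ 2 ≤ ∑ i, K * (D.σ i * D.ψ i x ^ 2) :=
              Finset.sum_le_sum fun i _ => by
                have := mul_le_mul_of_nonneg_right (hσK i)
                  (mul_nonneg (D.σ_nonneg i) (sq_nonneg (D.ψ i x)))
                nlinarith
          _ ≤ K ^ 2 := by rw [← Finset.mul_sum, sq]; exact mul_le_mul_of_nonneg_left h1 hK0

/-- Weyl's inequality for singular values. -/
theorem σ_le_add (D : NuSVD ν M) (D' : NuSVD ν M') (hν : ∀ x, 0 ≤ ν x) {d : ℝ}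
    (hd : ∀ f, l2Norm ν ((M' - M) *ᵥ f) ≤ d * l2Norm ν f) (r : Fin (Fintype.card X)) :
    D'.σ r ≤ D.σ r + d := by
  classical
  -- The dimension count of the min-max principle. The n - 1 linear conditions, indexed by i ≠ r,
  -- ask that f be orthogonal to φ_i for i < r and have no component on φ'_i for i > r; they have a
  -- common nonzero solution.
  let R := {i : Fin (Fintype.card X) // i ≠ r}
  let F : (Fin (Fintype.card X) → ℝ) →ₗ[ℝ] (R → ℝ) := Matrix.toLin' (Matrix.of fun i j =>
    if i.1 < r then ip ν (D.φ i.1) (D'.φ j) else if i.1 = j then 1 else 0)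
  have hcard : Module.finrank ℝ (R → ℝ) < Module.finrank ℝ (Fin (Fintype.card X) → ℝ) := by
    rw [Module.finrank_pi, Module.finrank_pi]
    exact Fintype.card_subtype_lt (x := r) (by simp)
  obtain ⟨a, ha, ha0⟩ := (Submodule.ne_bot_iff _).1 (LinearMap.ker_ne_bot_of_finrank_lt hcard)
  rw [LinearMap.mem_ker] at ha
  have hF : ∀ i : R, ∑ j, (if i.1 < r then ip ν (D.φ i.1) (D'.φ j) else if i.1 = j then 1 else 0)
      * a j = 0 := by
    intro i
    have h1 := congrFun ha i
    rwa [Matrix.toLin'_apply] at h1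
  have hgt : ∀ i, ¬ i ≤ r → a i = 0 := by
    intro i hi
    have h1 := hF ⟨i, fun h => hi h.le⟩
    have h2 : ¬ i < r := fun h => hi h.le
    simpa [h2] using h1
  set f : X → ℝ := ∑ j, a j • D'.φ j with hf
  have ha' : ∀ i, ip ν (D'.φ i) f = a i := by
    intro i; rw [hf, D'.onb_right.ip_sum_smul]; simp
  have hz : ∀ i, i < r → ip ν (D.φ i) f = 0 := by
    intro i hi
    have h1 := hF ⟨i, hi.ne⟩
    simp only [hi, if_true] at h1
    rw [← h1, hf, ip_sum_right]
    simp only [ip_smul_right, mul_comm]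
  have hf2 : l2Norm ν f ^ 2 = ∑ i, a i ^ 2 := D'.onb_right.l2Norm_sum_smul_sq hν _ _
  have hfpos : 0 < l2Norm ν f := by
    have : 0 < l2Norm ν f ^ 2 := by
      rw [hf2]
      obtain ⟨j, hj⟩ := Function.ne_iff.1 ha0
      exact Finset.sum_pos' (fun _ _ => sq_nonneg _)
        ⟨j, Finset.mem_univ _, sq_pos_of_ne_zero hj⟩
    exact lt_of_le_of_ne (l2Norm_nonneg f) fun h => by simp [← h] at this
  have h1 : D'.σ r * l2Norm ν f ≤ l2Norm ν (M' *ᵥ f) := by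
    refine le_of_sq_le_sq ?_ (l2Norm_nonneg _)
    rw [mul_pow, hf2, D'.l2Norm_mulVec_sq hν, Finset.mul_sum]
    refine Finset.sum_le_sum fun i _ => ?_
    rw [ha', mul_pow]
    by_cases hi : i ≤ r
    · exact mul_le_mul_of_nonneg_right (pow_le_pow_left₀ (D'.σ_nonneg r) (D'.σ_antitone hi) 2)
        (sq_nonneg _)
    · simp [hgt i hi]
  have h2 : l2Norm ν (M *ᵥ f) ≤ D.σ r * l2Norm ν f := by
    refine le_of_sq_le_sq ?_ (mul_nonneg (D.σ_nonneg r) (l2Norm_nonneg _))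
    rw [mul_pow, l2Norm_sq hν f, ← D.onb_right.sum_ip_sq, D.l2Norm_mulVec_sq hν, Finset.mul_sum]
    refine Finset.sum_le_sum fun i _ => ?_
    rw [mul_pow]
    by_cases hi : i < r
    · simp [hz i hi]
    · exact mul_le_mul_of_nonneg_right
        (pow_le_pow_left₀ (D.σ_nonneg i) (D.σ_antitone (not_lt.1 hi)) 2) (sq_nonneg _)
  have h3 : l2Norm ν (M' *ᵥ f) ≤ l2Norm ν (M *ᵥ f) + d * l2Norm ν f := by
    have : M' *ᵥ f = M *ᵥ f + (M' - M) *ᵥ f := by rw [Matrix.sub_mulVec]; abel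
    rw [this]
    exact (l2Norm_add_le hν _ _).trans (by linarith [hd f])
  have h4 : D'.σ r * l2Norm ν f ≤ (D.σ r + d) * l2Norm ν f := by linarith
  exact le_of_mul_le_mul_right h4 hfpos

/-- Wedin's bound on the angle between leading right singular subspaces. -/
theorem offSq_le (D : NuSVD ν M) (D' : NuSVD ν M') (hν : ∀ x, 0 ≤ ν x)
    (s : Finset (Fin (Fintype.card X))) {G p q : ℝ} (hG : 0 < G)
    (hgap : ∀ j ∈ s, ∀ i ∈ sᶜ, D'.σ i + G ≤ D.σ j)
    (hp : ∀ j ∈ s, l2Norm ν ((M' - M) *ᵥ D.φ j) ≤ p)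
    (hq : ∀ j ∈ s, ∀ h, |ip ν (D.ψ j) ((M' - M) *ᵥ h)| ≤ q * l2Norm ν h) :
    offSq ν s D.φ D'.φ ≤ s.card * (p ^ 2 + q ^ 2) / G ^ 2 := by
  have main : ∀ j ∈ s, ∑ i ∈ sᶜ, ip ν (D'.φ i) (D.φ j) ^ 2 ≤ (p ^ 2 + q ^ 2) / G ^ 2 := by
    intro j hj
    rw [le_div_iff₀ (by positivity), Finset.sum_mul]
    have h1 : ∑ i, ip ν (D'.ψ i) ((M' - M) *ᵥ D.φ j) ^ 2 ≤ p ^ 2 := by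
      rw [D'.onb_left.sum_ip_sq, ← l2Norm_sq hν]
      exact pow_le_pow_left₀ (l2Norm_nonneg _) (hp j hj) 2
    have h2 : ∑ i, ip ν (D.ψ j) ((M' - M) *ᵥ D'.φ i) ^ 2 ≤ q ^ 2 := by
      -- Duality: testing the functional h ↦ ⟨ψ_j, (M' - M)h⟩ on the vector with coefficients equal
      -- to its own values on the φ'_i bounds the sum of their squares.
      set b : Fin (Fintype.card X) → ℝ := fun i => ip ν (D.ψ j) ((M' - M) *ᵥ D'.φ i) with hb
      set h : X → ℝ := ∑ i, b i • D'.φ i with hh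
      have e1 : ip ν (D.ψ j) ((M' - M) *ᵥ h) = ∑ i, b i ^ 2 := by
        rw [hh, Matrix.mulVec_sum, ip_sum_right]
        refine Finset.sum_congr rfl fun i _ => ?_
        rw [Matrix.mulVec_smul, ip_smul_right, sq]
      have e2 : l2Norm ν h ^ 2 = ∑ i, b i ^ 2 := D'.onb_right.l2Norm_sum_smul_sq hν _ _
      have e3 := (le_abs_self _).trans (hq j hj h)
      rw [e1, ← e2] at e3
      rw [← e2]
      have h0 := l2Norm_nonneg (ν := ν) h
      rcases h0.eq_or_lt with h0 | h0
      · rw [← h0]; nlinarith [sq_nonneg q]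
      · have : l2Norm ν h ≤ q := by
          rw [sq] at e3
          exact le_of_mul_le_mul_right e3 h0
        exact pow_le_pow_left₀ h0.le this 2
    refine le_trans (Finset.sum_le_sum (g := fun i => ip ν (D'.ψ i) ((M' - M) *ᵥ D.φ j) ^ 2
      + ip ν (D.ψ j) ((M' - M) *ᵥ D'.φ i) ^ 2) fun i hi => ?_) ?_
    · have ea : ip ν (D'.ψ i) ((M' - M) *ᵥ D.φ j)
          = D'.σ i * ip ν (D'.φ i) (D.φ j) - D.σ j * ip ν (D'.ψ i) (D.ψ j) := by
        rw [Matrix.sub_mulVec, ip_sub_right, D'.ip_left_mulVec, D.mulVec_right, ip_smul_right]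
      have eb : ip ν (D.ψ j) ((M' - M) *ᵥ D'.φ i)
          = D'.σ i * ip ν (D'.ψ i) (D.ψ j) - D.σ j * ip ν (D'.φ i) (D.φ j) := by
        rw [Matrix.sub_mulVec, ip_sub_right, D.ip_left_mulVec, D'.mulVec_right, ip_smul_right,
          ip_comm (D.ψ j), ip_comm (D.φ j)]
      rw [ea, eb]
      generalize ip ν (D'.φ i) (D.φ j) = a
      generalize ip ν (D'.ψ i) (D.ψ j) = b
      have hg := hgap j hj i hi
      have h3 : G ^ 2 ≤ (D.σ j - D'.σ i) ^ 2 := pow_le_pow_left₀ hG.le (by linarith) 2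
      have h4 : 0 ≤ D.σ j * D'.σ i := mul_nonneg (D.σ_nonneg _) (D'.σ_nonneg _)
      -- The two residual relations form a 2 × 2 system in `a` and `b`. This identity shows that the
      -- system is bounded below by the gap, the cross term being non-negative.
      have h5 : (D'.σ i * a - D.σ j * b) ^ 2 + (D'.σ i * b - D.σ j * a) ^ 2
          = (D.σ j - D'.σ i) ^ 2 * (a ^ 2 + b ^ 2) + 2 * (D.σ j * D'.σ i) * (a - b) ^ 2 := by ring
      rw [h5]
      have h6 := mul_le_mul_of_nonneg_right h3 (add_nonneg (sq_nonneg a) (sq_nonneg b))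
      nlinarith [mul_nonneg h4 (sq_nonneg (a - b)), mul_nonneg (sq_nonneg G) (sq_nonneg b)]
    · rw [Finset.sum_add_distrib]
      refine add_le_add (le_trans ?_ h1) (le_trans ?_ h2) <;>
      exact Finset.sum_le_sum_of_subset_of_nonneg (Finset.subset_univ _) fun _ _ _ => sq_nonneg _
  rw [offSq, mul_div_assoc, ← nsmul_eq_mul]
  exact Finset.sum_le_card_nsmul _ _ _ main

end NuSVD


/-! ### Shifted successor measures of stochastic matrices -/

section Stochastic

variable {X : Type*} [Fintype X]

/-- A stochastic matrix. -/
structure IsStochastic (Q : Matrix X X ℝ) : Prop where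
  nonneg : ∀ x y, 0 ≤ Q x y
  row : ∀ x, ∑ y, Q x y = 1

variable [DecidableEq X]

/-- The matrix `Q ^ m (1 - γ Q)⁻¹`. -/
noncomputable def shifted (γ : ℝ) (Q : Matrix X X ℝ) (m : ℕ) : Matrix X X ℝ :=
  Q ^ m * (1 - γ • Q)⁻¹

theorem shifted_succ (γ : ℝ) (Q : Matrix X X ℝ) (m : ℕ) :
    shifted γ Q (m + 1) = Q * shifted γ Q m := by
  rw [shifted, shifted, pow_succ', Matrix.mul_assoc]

theorem shifted_zero (γ : ℝ) (Q : Matrix X X ℝ) : shifted γ Q 0 = (1 - γ • Q)⁻¹ := by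
  rw [shifted, pow_zero, Matrix.one_mul]

namespace IsStochastic

variable {Q : Matrix X X ℝ} {γ : ℝ}

/-- Minimum principle: at a minimiser z of f one has (Qf)(z) ≥ f(z), so the hypothesis at z gives (1
- γ) f(z) ≥ 0. Invertibility of 1 - γQ and positivity of its inverse follow without a Neumann
series. -/
theorem nonneg_of_nonneg (hQ : IsStochastic Q) (h0 : 0 ≤ γ) (h1 : γ < 1) {f : X → ℝ}
    (hf : ∀ x, 0 ≤ ((1 - γ • Q) *ᵥ f) x) (x : X) : 0 ≤ f x := by
  have : Nonempty X := ⟨x⟩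
  obtain ⟨z, hz⟩ := Finite.exists_min f
  refine le_trans ?_ (hz x)
  have h2 := hf z
  rw [Matrix.sub_mulVec, Matrix.one_mulVec, Matrix.smul_mulVec] at h2
  have h3 : f z ≤ (Q *ᵥ f) z := by
    calc f z = ∑ y, Q z y * f z := by rw [← Finset.sum_mul, hQ.row, one_mul]
      _ ≤ (Q *ᵥ f) z := Finset.sum_le_sum fun y _ => mul_le_mul_of_nonneg_left (hz y) (hQ.nonneg z y)
  simp only [Pi.sub_apply, Pi.smul_apply, smul_eq_mul] at h2
  have h4 := mul_le_mul_of_nonneg_left h3 h0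
  nlinarith

theorem isUnit_det (hQ : IsStochastic Q) (h0 : 0 ≤ γ) (h1 : γ < 1) :
    IsUnit (1 - γ • Q).det := by
  rw [← Matrix.isUnit_iff_isUnit_det, ← Matrix.mulVec_injective_iff_isUnit]
  intro f g hfg
  have h2 : ∀ a b : X → ℝ, (1 - γ • Q) *ᵥ a = (1 - γ • Q) *ᵥ b → ∀ x, 0 ≤ (a - b) x :=
    fun a b hab => hQ.nonneg_of_nonneg h0 h1 fun x => by rw [Matrix.mulVec_sub, hab]; simp
  ext x
  have h3 := h2 f g hfg x
  have h4 := h2 g f hfg.symm x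
  simp only [Pi.sub_apply] at h3 h4
  linarith

theorem resolvent_nonneg (hQ : IsStochastic Q) (h0 : 0 ≤ γ) (h1 : γ < 1) (x y : X) :
    0 ≤ (1 - γ • Q)⁻¹ x y := by
  have h2 := hQ.nonneg_of_nonneg h0 h1 (f := (1 - γ • Q)⁻¹ *ᵥ Pi.single y 1) (fun z => by
    rw [Matrix.mulVec_mulVec, Matrix.mul_nonsing_inv _ (hQ.isUnit_det h0 h1), Matrix.one_mulVec]
    by_cases h : z = y
    · subst h; simp
    · simp [h]) x
  simpa using h2

theorem pow (hQ : IsStochastic Q) (m : ℕ) : IsStochastic (Q ^ m) := by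
  induction m with
  | zero =>
    refine ⟨fun x y => ?_, fun x => ?_⟩
    · rw [pow_zero, Matrix.one_apply]; split_ifs <;> norm_num
    · simp [Matrix.one_apply]
  | succ m ih =>
    rw [pow_succ]
    refine ⟨fun x y => Finset.sum_nonneg fun z _ => mul_nonneg (ih.nonneg x z) (hQ.nonneg z y),
      fun x => ?_⟩
    simp only [Matrix.mul_apply]
    rw [Finset.sum_comm]
    simp only [← Finset.mul_sum, hQ.row, mul_one, ih.row]

theorem mulVec_one (hQ : IsStochastic Q) : Q *ᵥ 1 = 1 := by
  ext x; simp [Matrix.mulVec, dotProduct, hQ.row]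

theorem shifted_mulVec_one (hQ : IsStochastic Q) (h0 : 0 ≤ γ) (h1 : γ < 1) (m : ℕ) :
    shifted γ Q m *ᵥ 1 = (1 - γ)⁻¹ • (1 : X → ℝ) := by
  have h2 : (1 - γ • Q) *ᵥ ((1 - γ)⁻¹ • (1 : X → ℝ)) = 1 := by
    rw [Matrix.mulVec_smul, Matrix.sub_mulVec, Matrix.one_mulVec, Matrix.smul_mulVec,
      hQ.mulVec_one]
    ext x
    have : (1 - γ) ≠ 0 := by linarith
    simp [this]
  have h3 : (1 - γ • Q)⁻¹ *ᵥ (1 : X → ℝ) = (1 - γ)⁻¹ • (1 : X → ℝ) := by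
    conv_lhs => rw [← h2]
    rw [Matrix.mulVec_mulVec, Matrix.nonsing_inv_mul _ (hQ.isUnit_det h0 h1), Matrix.one_mulVec]
  rw [shifted, ← Matrix.mulVec_mulVec, h3, Matrix.mulVec_smul, (hQ.pow m).mulVec_one]

theorem shifted_nonneg (hQ : IsStochastic Q) (h0 : 0 ≤ γ) (h1 : γ < 1) (m : ℕ) (x y : X) :
    0 ≤ shifted γ Q m x y :=
  Finset.sum_nonneg fun z _ => mul_nonneg ((hQ.pow m).nonneg x z) (hQ.resolvent_nonneg h0 h1 z y)

theorem vecMul_pow_le (hQ : IsStochastic Q) {ρ : X → ℝ} {β : ℝ} (hβ : 0 ≤ β)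
    (h : ∀ y, (ρ ᵥ* Q) y ≤ β * ρ y) (m : ℕ) (y : X) : (ρ ᵥ* Q ^ m) y ≤ β ^ m * ρ y := by
  induction m generalizing y with
  | zero => simp
  | succ m ih =>
    rw [pow_succ, ← Matrix.vecMul_vecMul]
    calc ∑ z, (ρ ᵥ* Q ^ m) z * Q z y ≤ ∑ z, (β ^ m * ρ z) * Q z y :=
          Finset.sum_le_sum fun z _ => mul_le_mul_of_nonneg_right (ih z) (hQ.nonneg z y)
      _ = β ^ m * (ρ ᵥ* Q) y := by
          simp only [mul_assoc, ← Finset.mul_sum]; rfl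
      _ ≤ β ^ m * (β * ρ y) := mul_le_mul_of_nonneg_left (h y) (pow_nonneg hβ m)
      _ = β ^ (m + 1) * ρ y := by ring

/-- The hypothesis on ρ gives ρ(1 - γQ) ≥ (1 - γβ)ρ, and multiplying on the right by the
non-negative resolvent preserves the inequality. A measure that is only almost invariant suffices,
as is needed for empirical matrices. -/
theorem vecMul_shifted_le (hQ : IsStochastic Q) (h0 : 0 ≤ γ) (h1 : γ < 1) {ρ : X → ℝ} {β : ℝ}
    (hβ : 0 ≤ β) (hγβ : γ * β < 1) (h : ∀ y, (ρ ᵥ* Q) y ≤ β * ρ y) (m : ℕ) (y : X) :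
    (ρ ᵥ* shifted γ Q m) y ≤ β ^ m / (1 - γ * β) * ρ y := by
  have hR : ∀ y, (ρ ᵥ* (1 - γ • Q)⁻¹) y ≤ (1 - γ * β)⁻¹ * ρ y := by
    intro y
    rw [inv_mul_eq_div, le_div_iff₀ (by linarith)]
    have h2 : ∀ z, (1 - γ * β) * ρ z ≤ (ρ ᵥ* (1 - γ • Q)) z := by
      intro z
      rw [Matrix.vecMul_sub, Matrix.vecMul_one, Matrix.vecMul_smul]
      simp only [Pi.sub_apply, Pi.smul_apply, smul_eq_mul]
      nlinarith [mul_le_mul_of_nonneg_left (h z) h0]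
    calc (ρ ᵥ* (1 - γ • Q)⁻¹) y * (1 - γ * β)
        = ∑ z, ((1 - γ * β) * ρ z) * (1 - γ • Q)⁻¹ z y := by
          rw [Matrix.vecMul, dotProduct, Finset.sum_mul]
          exact Finset.sum_congr rfl fun z _ => by ring
      _ ≤ ∑ z, (ρ ᵥ* (1 - γ • Q)) z * (1 - γ • Q)⁻¹ z y := Finset.sum_le_sum fun z _ =>
          mul_le_mul_of_nonneg_right (h2 z) (hQ.resolvent_nonneg h0 h1 z y)
      _ = ((ρ ᵥ* (1 - γ • Q)) ᵥ* (1 - γ • Q)⁻¹) y := rfl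
      _ = ρ y := by
          rw [Matrix.vecMul_vecMul, Matrix.mul_nonsing_inv _ (hQ.isUnit_det h0 h1),
            Matrix.vecMul_one]
  rw [shifted, ← Matrix.vecMul_vecMul]
  calc ∑ z, (ρ ᵥ* Q ^ m) z * (1 - γ • Q)⁻¹ z y ≤ ∑ z, (β ^ m * ρ z) * (1 - γ • Q)⁻¹ z y :=
        Finset.sum_le_sum fun z _ => mul_le_mul_of_nonneg_right (hQ.vecMul_pow_le hβ h m z)
          (hQ.resolvent_nonneg h0 h1 z y)
    _ = β ^ m * (ρ ᵥ* (1 - γ • Q)⁻¹) y := by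
        simp only [mul_assoc, ← Finset.mul_sum]; rfl
    _ ≤ β ^ m * ((1 - γ * β)⁻¹ * ρ y) := mul_le_mul_of_nonneg_left (hR y) (pow_nonneg hβ m)
    _ = β ^ m / (1 - γ * β) * ρ y := by rw [div_eq_mul_inv]; ring

end IsStochastic

/-- A matrix for which the powers and shifted successor measures of order at most `k` have row
and column sums at most `c`. -/
structure Tame (γ : ℝ) (k : ℕ) (c : ℝ) (Q : Matrix X X ℝ) : Prop where
  det : IsUnit (1 - γ • Q).det
  pow : ∀ m ≤ k, RowColBdd c (Q ^ m)
  res : ∀ m ≤ k, RowColBdd c (shifted γ Q m)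

/-- A weight ρ comparable to the uniform one turns a bound on the mass that `A` transports into a
bound on plain column sums. The two comparisons cost K each. -/
theorem col_sum_le {n K b : ℝ} (hn : 0 < n) (hK : 1 ≤ K) {ρ : X → ℝ}
    (hlo : ∀ x, 1 ≤ K * (n * ρ x)) (hhi : ∀ x, n * ρ x ≤ K) {A : Matrix X X ℝ}
    (hA : ∀ x y, 0 ≤ A x y) (hb : 0 ≤ b) (h : ∀ y, (ρ ᵥ* A) y ≤ b * ρ y) (y : X) :
    ∑ x, A x y ≤ K ^ 2 * b := by
  calc ∑ x, A x y ≤ ∑ x, K * n * (ρ x * A x y) := Finset.sum_le_sum fun x _ => by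
        have := mul_le_mul_of_nonneg_right (hlo x) (hA x y)
        linarith
    _ = K * n * (ρ ᵥ* A) y := by rw [← Finset.mul_sum]; rfl
    _ ≤ K * n * (b * ρ y) := mul_le_mul_of_nonneg_left (h y) (by positivity)
    _ = K * b * (n * ρ y) := by ring
    _ ≤ K * b * K := mul_le_mul_of_nonneg_left (hhi y) (by positivity)
    _ = K ^ 2 * b := by ring

/-- Row sums are explicit for stochastic matrices. Column sums come from ρ: β^m ≤ 3 and 1 - γβ ≥ (1
- γ)/2 give K² · 3 · 2/(1 - γ), the source of the 6. -/
theorem IsStochastic.tame {Q : Matrix X X ℝ} (hQ : IsStochastic Q) {γ : ℝ} (h0 : 0 ≤ γ)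
    (h1 : γ < 1) {n K β c : ℝ} {k : ℕ} (hn : 0 < n) (hK : 1 ≤ K) {ρ : X → ℝ}
    (hlo : ∀ x, 1 ≤ K * (n * ρ x)) (hhi : ∀ x, n * ρ x ≤ K) (hβ : 1 ≤ β) (hβk : β ^ k ≤ 3)
    (hγβ : (1 - γ) / 2 ≤ 1 - γ * β) (h : ∀ y, (ρ ᵥ* Q) y ≤ β * ρ y)
    (hc : 6 * K ^ 2 * (1 - γ)⁻¹ ≤ c) : Tame γ k c Q := by
  have hg : 0 < 1 - γ := by linarith
  have hg1 : 1 ≤ (1 - γ)⁻¹ := (one_le_inv₀ hg).2 (by linarith)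
  have hβ0 : 0 ≤ β := by linarith
  have hKK : 1 ≤ K ^ 2 := one_le_pow₀ hK
  have hβm : ∀ m ≤ k, β ^ m ≤ 3 := fun m hm => (pow_le_pow_right₀ hβ hm).trans hβk
  refine ⟨hQ.isUnit_det h0 h1, fun m hm => ⟨(hQ.pow m).nonneg, fun x => ?_, fun y => ?_⟩,
    fun m hm => ⟨hQ.shifted_nonneg h0 h1 m, fun x => ?_, fun y => ?_⟩⟩
  · rw [(hQ.pow m).row]; nlinarith
  · refine (col_sum_le hn hK hlo hhi (hQ.pow m).nonneg (pow_nonneg hβ0 m)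
      (hQ.vecMul_pow_le hβ0 h m) y).trans ?_
    nlinarith [hβm m hm]
  · have h2 := congrFun (hQ.shifted_mulVec_one h0 h1 m) x
    simp only [Matrix.mulVec, dotProduct, Pi.one_apply, mul_one, Pi.smul_apply, smul_eq_mul] at h2
    rw [h2]; nlinarith
  · refine (col_sum_le hn hK hlo hhi (hQ.shifted_nonneg h0 h1 m)
      (div_nonneg (pow_nonneg hβ0 m) (by linarith))
      (hQ.vecMul_shifted_le h0 h1 hβ0 (by linarith) h m) y).trans ?_
    have h3 : β ^ m / (1 - γ * β) ≤ 6 * (1 - γ)⁻¹ := by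
      rw [div_le_iff₀ (by linarith)]
      calc β ^ m ≤ 3 := hβm m hm
        _ = 6 * (1 - γ)⁻¹ * ((1 - γ) / 2) := by field_simp; norm_num
        _ ≤ _ := mul_le_mul_of_nonneg_left hγβ (by positivity)
    nlinarith [mul_le_mul_of_nonneg_left h3 (sq_nonneg K)]

/-! ### Telescoping identity for the perturbation of shifted successor measures -/

section Telescoping

variable {Q Q' : Matrix X X ℝ} {γ c : ℝ} {k : ℕ}

/-- The case m = 0 is the resolvent identity. The inductive step splits Q'S'_m - QS_m as Q(S'_m -
S_m) + (Q' - Q)S'_m. Every left factor belongs to Q and every right factor to Q', so that Q' - Q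
always acts on S'_s f. -/
theorem shifted_sub (hQ : IsUnit (1 - γ • Q).det) (hQ' : IsUnit (1 - γ • Q').det) (m : ℕ) :
    shifted γ Q' m - shifted γ Q m
      = ∑ t ∈ Finset.range m, Q ^ t * ((Q' - Q) * shifted γ Q' (m - 1 - t))
        + γ • (shifted γ Q m * ((Q' - Q) * shifted γ Q' 0)) := by
  induction m with
  | zero =>
    simp only [shifted_zero, Finset.range_zero, Finset.sum_empty, zero_add]
    have h : γ • (Q' - Q) = (1 - γ • Q) - (1 - γ • Q') := by rw [smul_sub]; abel
    rw [← Matrix.mul_smul, ← Matrix.smul_mul, h, Matrix.sub_mul, Matrix.mul_sub,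
      Matrix.mul_nonsing_inv _ hQ', ← Matrix.mul_assoc, Matrix.nonsing_inv_mul _ hQ,
      Matrix.one_mul, Matrix.mul_one]
  | succ m ih =>
    have h : shifted γ Q' (m + 1) - shifted γ Q (m + 1)
        = Q * (shifted γ Q' m - shifted γ Q m) + (Q' - Q) * shifted γ Q' m := by
      rw [shifted_succ, shifted_succ]; noncomm_ring
    rw [h, ih, Finset.sum_range_succ', Matrix.mul_add, Matrix.mul_smul, shifted_succ γ Q,
      Finset.mul_sum, Matrix.mul_assoc Q]
    have h2 : ∀ t, Q * (Q ^ t * ((Q' - Q) * shifted γ Q' (m - 1 - t)))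
        = Q ^ (t + 1) * ((Q' - Q) * shifted γ Q' (m + 1 - 1 - (t + 1))) := by
      intro t
      rw [pow_succ', Matrix.mul_assoc]
      have h3 : m - 1 - t = m + 1 - 1 - (t + 1) := by omega
      rw [h3]
    simp only [h2, pow_zero, Matrix.one_mul, Nat.add_sub_cancel, Nat.sub_zero]
    abel

/-- Each of the at most k telescoping terms, and the resolvent term, contributes at most b. The
functional p is kept general because the bound is needed for the Euclidean norm, for the pairing
with a singular vector and for evaluation at a point. -/
theorem shifted_sub_le (hγ0 : 0 ≤ γ) (hγ1 : γ ≤ 1) (hQ : Tame γ k c Q)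
    (hQ' : IsUnit (1 - γ • Q').det) (f : X → ℝ) (p : (X → ℝ) → ℝ) (hp0 : p 0 = 0)
    (hp : ∀ a b, p (a + b) ≤ p a + p b) {b : ℝ} (hb : 0 ≤ b)
    (h : ∀ A, RowColBdd c A → ∀ s ≤ k, p (A *ᵥ ((Q' - Q) *ᵥ (shifted γ Q' s *ᵥ f))) ≤ b)
    {m : ℕ} (hm : m ≤ k) : p ((shifted γ Q' m - shifted γ Q m) *ᵥ f) ≤ (k + 1) * b := by
  rw [shifted_sub hQ.det hQ' m, Matrix.add_mulVec, Matrix.sum_mulVec]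
  have h1 : p (∑ t ∈ Finset.range m, (Q ^ t * ((Q' - Q) * shifted γ Q' (m - 1 - t))) *ᵥ f)
      ≤ m * b := by
    refine (Finset.le_sum_of_subadditive p hp0.le hp _ _).trans ?_
    calc _ ≤ ∑ t ∈ Finset.range m, b := Finset.sum_le_sum fun t ht => by
          rw [← Matrix.mulVec_mulVec, ← Matrix.mulVec_mulVec]
          have := Finset.mem_range.1 ht
          exact h _ (hQ.pow t (by omega)) _ (by omega)
      _ = m * b := by simp
  have h2 : p ((γ • (shifted γ Q m * ((Q' - Q) * shifted γ Q' 0))) *ᵥ f) ≤ b := by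
    rw [← Matrix.smul_mul, ← Matrix.mulVec_mulVec, ← Matrix.mulVec_mulVec]
    have hR := hQ.res m hm
    refine h _ ⟨fun x y => mul_nonneg hγ0 (hR.nonneg x y), fun x => ?_, fun y => ?_⟩ 0 (Nat.zero_le _)
    · refine le_trans (Finset.sum_le_sum fun y _ => ?_) (hR.row x)
      exact mul_le_of_le_one_left (hR.nonneg x y) hγ1
    · refine le_trans (Finset.sum_le_sum fun x _ => ?_) (hR.col y)
      exact mul_le_of_le_one_left (hR.nonneg x y) hγ1
  have h3 : (m : ℝ) ≤ k := by exact_mod_cast hm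
  nlinarith [hp (∑ t ∈ Finset.range m, (Q ^ t * ((Q' - Q) * shifted γ Q' (m - 1 - t))) *ᵥ f)
    ((γ • (shifted γ Q m * ((Q' - Q) * shifted γ Q' 0))) *ᵥ f)]

end Telescoping

end Stochastic


/-! ### Entrywise perturbation of truncated singular value decompositions -/

section Deterministic

variable {X : Type*} [Fintype X] [DecidableEq X] {ν : X → ℝ} {Λ η γ : ℝ} {k : ℕ}

theorem l2Norm_mulVec_le_of_e2 {n : ℝ} (hn : 0 < n) (hΛ : 1 ≤ Λ) (hν : ∀ x, 0 ≤ ν x)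
    (hlo : ∀ x, 1 ≤ Λ * (n * ν x)) (hhi : ∀ x, n * ν x ≤ Λ) {A : Matrix X X ℝ} {d : ℝ}
    (hd : 0 ≤ d) {f : X → ℝ} (h : e2 (A *ᵥ f) ≤ d * e2 f) :
    l2Norm ν (A *ᵥ f) ≤ Λ ^ 2 * d * l2Norm ν f := by
  have h1 := l2Norm_mul_le_e2 hn hΛ hν hhi (A *ᵥ f)
  have h2 := e2_le_l2Norm hn hΛ hν hlo f
  refine le_of_mul_le_mul_left ?_ (Real.sqrt_pos.2 hn)
  calc Real.sqrt n * l2Norm ν (A *ᵥ f) ≤ Λ * e2 (A *ᵥ f) := h1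
    _ ≤ Λ * (d * (Λ * Real.sqrt n * l2Norm ν f)) := by gcongr; exact h.trans (by gcongr)
    _ = Real.sqrt n * (Λ ^ 2 * d * l2Norm ν f) := by ring

theorem e2_add_le (f g : X → ℝ) : e2 (f + g) ≤ e2 f + e2 g :=
  l2Norm_add_le (fun _ => zero_le_one) f g

theorem e2_zero : e2 (0 : X → ℝ) = 0 := l2Norm_zero

theorem e2_shifted_sub_le (hΛ : 1 ≤ Λ) (hη : 0 ≤ η) (hγ0 : 0 ≤ γ) (hγ1 : γ ≤ 1)
    {Q Q' : Matrix X X ℝ} (hQ : Tame γ k Λ Q) (hQ' : Tame γ k Λ Q')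
    (hE : ∀ f, e2 ((Q' - Q) *ᵥ f) ≤ η * e2 f) (f : X → ℝ) :
    e2 ((shifted γ Q' k - shifted γ Q k) *ᵥ f) ≤ (k + 1) * η * Λ ^ 2 * e2 f := by
  have hΛ0 : 0 ≤ Λ := by linarith
  refine (shifted_sub_le hγ0 hγ1 hQ hQ'.det f e2 e2_zero e2_add_le
    (b := Λ * (η * (Λ * e2 f))) (by have := e2_nonneg f; positivity)
    (fun A hA s hs => ?_) le_rfl).trans (le_of_eq (by ring))
  refine (hA.e2_mulVec_le hΛ0 _).trans (mul_le_mul_of_nonneg_left ?_ hΛ0)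
  exact (hE _).trans (mul_le_mul_of_nonneg_left ((hQ'.res s hs).e2_mulVec_le hΛ0 f) hη)

/-- Leaving out row x perturbs Q' only in that row, so the perturbation sends a vector to a multiple
of the unit vector at x. Its size is one entry, with no factor √n. -/
theorem updateRow_sub_mulVec (Q Q' : Matrix X X ℝ) (x : X) (f : X → ℝ) :
    (Q' - Q'.updateRow x (Q x)) *ᵥ f = Pi.single x (((Q' - Q) *ᵥ f) x) := by
  ext y
  by_cases h : y = x
  · subst h; simp [Matrix.mulVec, dotProduct]
  · simp [h, Matrix.mulVec, dotProduct]

theorem e2_updateRow_sub_le {Q Q' : Matrix X X ℝ} (hE : ∀ f, e2 ((Q' - Q) *ᵥ f) ≤ η * e2 f)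
    (hη : 0 ≤ η) (x : X) (f : X → ℝ) :
    e2 ((Q'.updateRow x (Q x) - Q) *ᵥ f) ≤ η * e2 f := by
  refine e2_le_of_sq_le (mul_nonneg hη (e2_nonneg f)) (le_trans (Finset.sum_le_sum fun y _ => ?_)
    ((e2_sq _).symm.le.trans (pow_le_pow_left₀ (e2_nonneg _) (hE f) 2)))
  by_cases h : y = x
  · subst h
    have : ((Q'.updateRow y (Q y) - Q) *ᵥ f) y = 0 := by
      simp [Matrix.mulVec, dotProduct]
    rw [this]; simpa using sq_nonneg _
  · have : ((Q'.updateRow x (Q x) - Q) *ᵥ f) y = ((Q' - Q) *ᵥ f) y := by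
      simp [h, Matrix.mulVec, dotProduct]
    rw [this]

theorem e2_single_le (x : X) (t : ℝ) : e2 (Pi.single x t : X → ℝ) = |t| := by
  have h : (Pi.single x t : X → ℝ) = t • Pi.single x (1 : ℝ) := by
    ext y; by_cases h : y = x
    · subst h; simp
    · simp [h]
  rw [h, e2_smul, e2_single, mul_one]

/-- Weyl's inequality on both sides of the gap loses 2d in total, which is at most G/2. Mixing two
perturbations of `M` lets the perturbed and the leave-one-out matrix be compared with each other. -/
theorem σ_gap {M M' M'' : Matrix X X ℝ} (D : NuSVD ν M) (D' : NuSVD ν M') (D'' : NuSVD ν M'')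
    (hν : ∀ x, 0 ≤ ν x) {r : ℕ} (hr1 : 1 ≤ r) (hrn : r < Fintype.card X) {G d : ℝ}
    (hgap : D.σ ⟨r, hrn⟩ + G ≤ D.σ ⟨r - 1, by omega⟩)
    (hd : ∀ f, l2Norm ν ((M - M') *ᵥ f) ≤ d * l2Norm ν f)
    (hd' : ∀ f, l2Norm ν ((M'' - M) *ᵥ f) ≤ d * l2Norm ν f) (hdG : 4 * d ≤ G)
    {i j : Fin (Fintype.card X)} (hj : (j : ℕ) < r) (hi : r ≤ (i : ℕ)) :
    D''.σ i + G / 2 ≤ D'.σ j := by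
  have h1 := D'.σ_le_add D hν hd ⟨r - 1, by omega⟩
  have h2 := D.σ_le_add D'' hν hd' ⟨r, hrn⟩
  have h3 : D'.σ ⟨r - 1, by omega⟩ ≤ D'.σ j := D'.σ_antitone (by rw [Fin.le_def]; simp; omega)
  have h4 : D''.σ i ≤ D''.σ ⟨r, hrn⟩ := D''.σ_antitone (by rw [Fin.le_def]; exact hi)
  linarith

/-- The index set of the `r` leading singular values. -/
def lead (X : Type*) [Fintype X] (r : ℕ) : Finset (Fin (Fintype.card X)) :=
  Finset.univ.filter fun i : Fin (Fintype.card X) => (i : ℕ) < r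

theorem mem_lead {r : ℕ} {i : Fin (Fintype.card X)} : i ∈ lead X r ↔ (i : ℕ) < r := by simp [lead]

theorem card_lead_le (r : ℕ) : (lead X r).card ≤ r := by
  have h := Finset.card_le_card_of_injOn (s := lead X r) (t := Finset.range r)
    (fun i : Fin (Fintype.card X) => (i : ℕ))
    (fun i hi => by simpa using mem_lead.1 hi) (fun i _ j _ h => Fin.ext h)
  simpa using h

/-- The change of the singular subspace under the replacement of one row. -/
theorem sqrt_offSq_updateRow_le {n : ℝ} (hn : 0 < n) (hΛ : 1 ≤ Λ) (hη : 0 ≤ η) (hγ0 : 0 ≤ γ)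
    (hγ1 : γ ≤ 1) (hν : ∀ x, 0 ≤ ν x) (hlo : ∀ x, 1 ≤ Λ * (n * ν x)) (hhi : ∀ x, n * ν x ≤ Λ)
    {Q Q' : Matrix X X ℝ} (hQ' : Tame γ k Λ Q') {x : X} {Qx : Matrix X X ℝ}
    (hQxdef : Qx = Q'.updateRow x (Q x)) (hQx : Tame γ k Λ Qx)
    (hE : ∀ f, e2 ((Q' - Q) *ᵥ f) ≤ η * e2 f)
    (D' : NuSVD ν (shifted γ Q' k)) (Dx : NuSVD ν (shifted γ Qx k))
    {r : ℕ} (hrΛ : (r : ℝ) ≤ Λ)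
    (hgap : ∀ j ∈ lead X r, ∀ i ∈ (lead X r)ᶜ, Dx.σ i + Λ⁻¹ / 2 ≤ D'.σ j)
    {χ B : ℝ} (hχ0 : 0 ≤ χ) (hB0 : 0 ≤ B)
    (hχ : ∀ m ≤ k, ∀ j ∈ lead X r, |((Q' - Q) *ᵥ (shifted γ Q' m *ᵥ D'.φ j)) x| ≤ χ)
    (hB : ∀ j ∈ lead X r, ∀ y, |D'.ψ j y| ≤ B) :
    Real.sqrt n * Real.sqrt (offSq ν (lead X r) D'.φ Dx.φ)
      ≤ 2 * Λ ^ 6 * ((k + 1) * χ + (k + 1) * η * B) := by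
  have hΛ0 : 0 < Λ := by linarith
  have hs : 0 < Real.sqrt n := Real.sqrt_pos.2 hn
  have hss : Real.sqrt n * Real.sqrt n = n := Real.mul_self_sqrt hn.le
  have hsub : ∀ f : X → ℝ, (shifted γ Qx k - shifted γ Q' k) *ᵥ f
      = -((shifted γ Q' k - shifted γ Qx k) *ᵥ f) := by
    intro f; rw [← Matrix.neg_mulVec, neg_sub]
  -- After telescoping, the only nonzero entry of the middle factor is one of the entries bounded by
  -- χ. The factor 1/√n is the price of a unit point mass in ℓ²(ν).
  have hp : ∀ j ∈ lead X r, l2Norm ν ((shifted γ Qx k - shifted γ Q' k) *ᵥ D'.φ j)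
      ≤ (k + 1) * Λ ^ 2 * χ / Real.sqrt n := by
    intro j hj
    rw [hsub, l2Norm_neg, le_div_iff₀ hs, mul_comm]
    refine (l2Norm_mul_le_e2 hn hΛ hν hhi _).trans ?_
    have h1 : e2 ((shifted γ Q' k - shifted γ Qx k) *ᵥ D'.φ j) ≤ (k + 1) * (Λ * χ) := by
      refine shifted_sub_le hγ0 hγ1 hQx hQ'.det _ e2 e2_zero e2_add_le (by positivity)
        (fun A hA s hs => ?_) le_rfl
      refine (hA.e2_mulVec_le hΛ0.le _).trans (mul_le_mul_of_nonneg_left ?_ hΛ0.le)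
      rw [hQxdef, updateRow_sub_mulVec, e2_single_le]
      exact hχ s hs j hj
    calc Λ * _ ≤ Λ * ((k + 1) * (Λ * χ)) := mul_le_mul_of_nonneg_left h1 hΛ0.le
      _ = (k + 1) * Λ ^ 2 * χ := by ring
  -- The pairing factors through the entry x. The vector side costs √n by passing from ℓ²(ν) to
  -- Euclidean norm, and the side of ψ'_j gains 1/n, as the weights ν are of order 1/n and column
  -- sums are bounded. The net factor is 1/√n.
  have hq : ∀ j ∈ lead X r, ∀ h, |ip ν (D'.ψ j) ((shifted γ Qx k - shifted γ Q' k) *ᵥ h)|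
      ≤ (k + 1) * η * Λ ^ 4 * B / Real.sqrt n * l2Norm ν h := by
    intro j hj h
    have hneg : ∀ a b : X → ℝ, |ip ν a (-b)| = |ip ν a b| := by
      intro a b; rw [← neg_one_smul ℝ b, ip_smul_right]; simp
    rw [hsub, hneg]
    have h0 := l2Norm_nonneg (ν := ν) h
    refine (shifted_sub_le hγ0 hγ1 hQx hQ'.det h (fun f => |ip ν (D'.ψ j) f|)
      (by simp [ip]) (fun a b => by rw [ip_add_right]; exact abs_add_le _ _)
      (b := (η * (Λ * (Λ * Real.sqrt n * l2Norm ν h))) * (Λ * (B * (Λ / n)))) (by positivity)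
      (fun A hA s hs => ?_) le_rfl).trans (le_of_eq ?_)
    · rw [hQxdef, updateRow_sub_mulVec]
      set t := ((Q' - Q) *ᵥ (shifted γ Q' s *ᵥ h)) x with ht
      have e : ip ν (D'.ψ j) (A *ᵥ Pi.single x t) = t * ∑ y, (ν y * D'.ψ j y) * A y x := by
        rw [ip, Finset.mul_sum]
        refine Finset.sum_congr rfl fun y _ => ?_
        rw [Matrix.mulVec_single]
        simp
        ring
      rw [e, abs_mul]
      refine mul_le_mul ?_ ?_ (abs_nonneg _) (by positivity)
      · refine (abs_le_e2 _ x).trans ((hE _).trans (mul_le_mul_of_nonneg_left ?_ hη))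
        refine ((hQ'.res s hs).e2_mulVec_le hΛ0.le h).trans (mul_le_mul_of_nonneg_left ?_ hΛ0.le)
        exact e2_le_l2Norm hn hΛ hν hlo h
      · refine hA.abs_sum_mul_le (by positivity) (fun y => ?_) x
        rw [abs_mul, abs_of_nonneg (hν y), mul_comm]
        refine mul_le_mul (hB j hj y) ?_ (hν y) hB0
        rw [le_div_iff₀ hn, mul_comm]; exact hhi y
    · have hn' : n = Real.sqrt n ^ 2 := by rw [sq, hss]
      field_simp
      rw [← hn']
      ring
  have hoff := D'.offSq_le Dx hν (lead X r) (G := Λ⁻¹ / 2) (by positivity) hgap hp hq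
  set p := (k + 1) * Λ ^ 2 * χ / Real.sqrt n with hpdef
  set q := (k + 1) * η * Λ ^ 4 * B / Real.sqrt n with hqdef
  have hp0 : 0 ≤ p := by positivity
  have hq0 : 0 ≤ q := by positivity
  have hcard : ((lead X r).card : ℝ) ≤ Λ := le_trans (by exact_mod_cast card_lead_le r) hrΛ
  have h2 : offSq ν (lead X r) D'.φ Dx.φ ≤ (2 * Λ ^ 2 * (p + q)) ^ 2 := by
    refine hoff.trans ?_
    have e : ((lead X r).card : ℝ) * (p ^ 2 + q ^ 2) / (Λ⁻¹ / 2) ^ 2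
        = ((lead X r).card : ℝ) * (4 * Λ ^ 2 * (p ^ 2 + q ^ 2)) := by
      field_simp; norm_num
    rw [e]
    calc _ ≤ Λ * (4 * Λ ^ 2 * (p ^ 2 + q ^ 2)) := by gcongr
      _ ≤ Λ ^ 2 * (4 * Λ ^ 2 * (p + q) ^ 2) := by
          have h3 : Λ ≤ Λ ^ 2 := by nlinarith
          have h4 : p ^ 2 + q ^ 2 ≤ (p + q) ^ 2 := by nlinarith [mul_nonneg hp0 hq0]
          gcongr
      _ = _ := by ring
  have h3 : Real.sqrt (offSq ν (lead X r) D'.φ Dx.φ) ≤ 2 * Λ ^ 2 * (p + q) :=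
    (Real.sqrt_le_sqrt h2).trans (Real.sqrt_sq (by positivity)).le
  calc Real.sqrt n * Real.sqrt (offSq ν (lead X r) D'.φ Dx.φ)
      ≤ Real.sqrt n * (2 * Λ ^ 2 * (p + q)) := mul_le_mul_of_nonneg_left h3 hs.le
    _ = 2 * Λ ^ 2 * ((k + 1) * Λ ^ 2 * χ + (k + 1) * η * Λ ^ 4 * B) := by
        rw [hpdef, hqdef]; field_simp
    _ ≤ 2 * Λ ^ 2 * ((k + 1) * Λ ^ 4 * χ + (k + 1) * η * Λ ^ 4 * B) := by
        have : Λ ^ 2 ≤ Λ ^ 4 := pow_le_pow_right₀ hΛ (by norm_num)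
        gcongr
    _ = _ := by ring

/-- The leave-one-out bound for a row of the perturbation. -/
theorem abs_row_mulVec_le {n : ℝ} (hn : 0 < n) (hΛ : 1 ≤ Λ) (hη : 0 ≤ η) (hγ0 : 0 ≤ γ)
    (hγ1 : γ ≤ 1) (hν : ∀ x, 0 ≤ ν x) (hlo : ∀ x, 1 ≤ Λ * (n * ν x))
    {Q Q' : Matrix X X ℝ} (hQ' : Tame γ k Λ Q') {x : X} {Qx : Matrix X X ℝ}
    (hQxdef : Qx = Q'.updateRow x (Q x)) (hQx : Tame γ k Λ Qx)
    (hE : ∀ f, e2 ((Q' - Q) *ᵥ f) ≤ η * e2 f)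
    (D' : NuSVD ν (shifted γ Q' k)) (Dx : NuSVD ν (shifted γ Qx k))
    {r : ℕ} (hrΛ : (r : ℝ) ≤ Λ)
    (hloo : ∀ m ≤ k, ∀ j ∈ lead X r, ∀ b : ℝ,
      (∀ y, |(shifted γ Qx m *ᵥ Dx.φ j) y| ≤ b) →
      |((Q' - Q) *ᵥ (shifted γ Qx m *ᵥ Dx.φ j)) x| ≤ η * b)
    {χ W Bφ : ℝ} (hχ0 : 0 ≤ χ) (hW0 : 0 ≤ W) (hBφ0 : 0 ≤ Bφ)
    (hχ : ∀ m ≤ k, ∀ j ∈ lead X r, |((Q' - Q) *ᵥ (shifted γ Q' m *ᵥ D'.φ j)) x| ≤ χ)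
    (hBφ : ∀ j ∈ lead X r, ∀ y, |D'.φ j y| ≤ Bφ)
    (hW : Real.sqrt n * Real.sqrt (offSq ν (lead X r) D'.φ Dx.φ) ≤ W)
    {m : ℕ} (hm : m ≤ k) {j : Fin (Fintype.card X)} (hj : j ∈ lead X r) :
    |((Q' - Q) *ᵥ (shifted γ Q' m *ᵥ D'.φ j)) x|
      ≤ (k + 1) * η * Λ * χ + 2 * η * Λ ^ 3 * W + η * Λ ^ 3 * Bφ := by
  have hΛ0 : 0 < Λ := by linarith
  have hcard : ((lead X r).card : ℝ) ≤ Λ := le_trans (by exact_mod_cast card_lead_le r) hrΛ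
  have happrox : ∀ w : X → ℝ, l2Norm ν w ≤ Real.sqrt (offSq ν (lead X r) D'.φ Dx.φ) →
      e2 w ≤ Λ * W := by
    intro w hw
    calc e2 w ≤ Λ * Real.sqrt n * l2Norm ν w := e2_le_l2Norm hn hΛ hν hlo w
      _ ≤ Λ * Real.sqrt n * Real.sqrt (offSq ν (lead X r) D'.φ Dx.φ) := by gcongr
      _ ≤ Λ * W := by rw [mul_assoc]; gcongr
  -- The leave-one-out singular vectors inherit sup bounds from those of Q': each is a combination
  -- of at most Λ of the φ' with coefficients at most 1, plus a small remainder.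
  have hBx : ∀ i ∈ lead X r, ∀ y, |Dx.φ i y| ≤ Λ * Bφ + Λ * W := by
    intro i hi y
    obtain ⟨w, hw, hw2⟩ := exists_approx (ν := ν) (φ := Dx.φ) (φ' := D'.φ) D'.onb_right hν
      (lead X r) hi
    rw [offSq_comm Dx.onb_right D'.onb_right] at hw2
    have h1 := happrox w hw2
    rw [hw, Pi.add_apply, Finset.sum_apply]
    refine (abs_add_le _ _).trans (add_le_add ?_ ((abs_le_e2 w y).trans h1))
    calc _ ≤ ∑ l ∈ lead X r, |(ip ν (D'.φ l) (Dx.φ i) • D'.φ l) y| := Finset.abs_sum_le_sum_abs _ _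
      _ ≤ ∑ l ∈ lead X r, Bφ := Finset.sum_le_sum fun l hl => by
          rw [Pi.smul_apply, smul_eq_mul, abs_mul]
          have h2 := D'.onb_right.abs_ip_le hν l (Dx.φ i)
          rw [Dx.onb_right.l2Norm_eq_one hν] at h2
          exact (mul_le_mul h2 (hBφ l hl y) (abs_nonneg _) zero_le_one).trans (one_mul _).le
      _ ≤ Λ * Bφ := by
          rw [Finset.sum_const, nsmul_eq_mul]; gcongr
  obtain ⟨w, hw, hw2⟩ := exists_approx (ν := ν) (φ := D'.φ) (φ' := Dx.φ) Dx.onb_right hν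
    (lead X r) hj
  -- Two replacements: first the operator S'_m by its leave-one-out version (`t1`), then the vector
  -- φ'_j by its projection on the leave-one-out subspace, with remainder `w` (`t2`) and main part
  -- (`t3`). Only in the last one is the independence bound `hloo` used.
  have hsplit : shifted γ Q' m *ᵥ D'.φ j
      = (shifted γ Q' m - shifted γ Qx m) *ᵥ D'.φ j + shifted γ Qx m *ᵥ D'.φ j := by
    rw [Matrix.sub_mulVec]; abel
  have t1 : |((Q' - Q) *ᵥ ((shifted γ Q' m - shifted γ Qx m) *ᵥ D'.φ j)) x|
      ≤ (k + 1) * η * Λ * χ := by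
    refine (abs_le_e2 _ x).trans ((hE _).trans ?_)
    have h1 : e2 ((shifted γ Q' m - shifted γ Qx m) *ᵥ D'.φ j) ≤ (k + 1) * (Λ * χ) := by
      refine shifted_sub_le hγ0 hγ1 hQx hQ'.det _ e2 e2_zero e2_add_le (by positivity)
        (fun A hA s hs => ?_) hm
      refine (hA.e2_mulVec_le hΛ0.le _).trans (mul_le_mul_of_nonneg_left ?_ hΛ0.le)
      rw [hQxdef, updateRow_sub_mulVec, e2_single_le]
      exact hχ s hs j hj
    calc η * _ ≤ η * ((k + 1) * (Λ * χ)) := mul_le_mul_of_nonneg_left h1 hη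
      _ = _ := by ring
  have t2 : |((Q' - Q) *ᵥ (shifted γ Qx m *ᵥ w)) x| ≤ η * Λ ^ 2 * W := by
    refine (abs_le_e2 _ x).trans ((hE _).trans ?_)
    calc η * e2 (shifted γ Qx m *ᵥ w) ≤ η * (Λ * (Λ * W)) := by
          refine mul_le_mul_of_nonneg_left (((hQx.res m hm).e2_mulVec_le hΛ0.le w).trans ?_) hη
          exact mul_le_mul_of_nonneg_left (happrox w hw2) hΛ0.le
      _ = _ := by ring
  have t3 : |((Q' - Q) *ᵥ (shifted γ Qx m *ᵥ
      ∑ i ∈ lead X r, ip ν (Dx.φ i) (D'.φ j) • Dx.φ i)) x| ≤ Λ * (η * (Λ * (Λ * Bφ + Λ * W))) := by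
    rw [Matrix.mulVec_sum, Matrix.mulVec_sum, Finset.sum_apply]
    calc _ ≤ ∑ i ∈ lead X r, |((Q' - Q) *ᵥ (shifted γ Qx m *ᵥ
          (ip ν (Dx.φ i) (D'.φ j) • Dx.φ i))) x| := Finset.abs_sum_le_sum_abs _ _
      _ ≤ ∑ i ∈ lead X r, η * (Λ * (Λ * Bφ + Λ * W)) := Finset.sum_le_sum fun i hi => by
          rw [Matrix.mulVec_smul, Matrix.mulVec_smul, Pi.smul_apply, smul_eq_mul, abs_mul]
          have h2 := Dx.onb_right.abs_ip_le hν i (D'.φ j)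
          rw [D'.onb_right.l2Norm_eq_one hν] at h2
          have h3 := hloo m hm i hi _ fun y =>
            (hQx.res m hm).abs_mulVec_le (b := Λ * Bφ + Λ * W) (by positivity) (hBx i hi) y
          exact (mul_le_mul h2 h3 (abs_nonneg _) zero_le_one).trans (one_mul _).le
      _ ≤ Λ * (η * (Λ * (Λ * Bφ + Λ * W))) := by
          rw [Finset.sum_const, nsmul_eq_mul]; gcongr
  have t4 : |((Q' - Q) *ᵥ (shifted γ Qx m *ᵥ D'.φ j)) x|
      ≤ Λ * (η * (Λ * (Λ * Bφ + Λ * W))) + η * Λ ^ 2 * W := by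
    rw [hw, Matrix.mulVec_add, Matrix.mulVec_add, Pi.add_apply]
    exact (abs_add_le _ _).trans (add_le_add t3 t2)
  rw [hsplit, Matrix.mulVec_add, Pi.add_apply]
  refine (abs_add_le _ _).trans ((add_le_add t1 t4).trans ?_)
  have h5 : η * Λ ^ 2 * W ≤ η * Λ ^ 3 * W := by
    have : Λ ^ 2 ≤ Λ ^ 3 := pow_le_pow_right₀ hΛ (by norm_num)
    gcongr
  nlinarith

/-- The entry σ_j ν(y) φ_j(y) is the pairing of ψ_j with column y of `M`. The column sums are
bounded and ν is comparable to 1/n, so the weights cancel. -/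
theorem abs_right_le {n : ℝ} (hn : 0 < n) (hΛ : 1 ≤ Λ) (hν : ∀ x, 0 < ν x)
    (hlo : ∀ x, 1 ≤ Λ * (n * ν x)) (hhi : ∀ x, n * ν x ≤ Λ) {M : Matrix X X ℝ}
    (hM : RowColBdd Λ M) (D : NuSVD ν M) {j : Fin (Fintype.card X)} (hσ : Λ⁻¹ / 2 ≤ D.σ j)
    {B : ℝ} (hB0 : 0 ≤ B) (hB : ∀ y, |D.ψ j y| ≤ B) (y : X) : |D.φ j y| ≤ 2 * Λ ^ 4 * B := by
  have hΛ0 : 0 < Λ := by linarith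
  have h1 : D.σ j * (ν y * D.φ j y) = ∑ x, (ν x * D.ψ j x) * M x y := by
    have h2 := D.ip_left_mulVec j (Pi.single y 1)
    have h3 : ip ν (D.φ j) (Pi.single y 1) = ν y * D.φ j y := by
      rw [ip, Finset.sum_eq_single y] <;> simp +contextual
    rw [h3] at h2
    rw [← h2, ip]
    simp
  have h2 : |∑ x, (ν x * D.ψ j x) * M x y| ≤ Λ * (Λ / n * B) := by
    refine hM.abs_sum_mul_le (by positivity) (fun x => ?_) y
    rw [abs_mul, abs_of_nonneg (hν x).le]
    refine mul_le_mul ?_ (hB x) (abs_nonneg _) (by positivity)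
    rw [le_div_iff₀ hn, mul_comm]; exact hhi x
  rw [← h1, abs_mul, abs_mul, abs_of_nonneg (D.σ_nonneg j), abs_of_pos (hν y)] at h2
  have h3 : 1 / n ≤ Λ * ν y := by
    rw [div_le_iff₀ hn]; linarith [hlo y]
  have h4 : (Λ⁻¹ / 2) * (Λ⁻¹ * (1 / n) * |D.φ j y|) ≤ D.σ j * (ν y * |D.φ j y|) := by
    refine mul_le_mul hσ (mul_le_mul_of_nonneg_right ?_ (abs_nonneg _)) (by positivity)
      (D.σ_nonneg j)
    rw [inv_mul_le_iff₀ hΛ0]; exact h3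
  have h5 := h4.trans h2
  have h6 : Λ⁻¹ / 2 * (Λ⁻¹ * (1 / n) * |D.φ j y|) = |D.φ j y| / (2 * Λ ^ 2 * n) := by field_simp
  rw [h6, div_le_iff₀ (by positivity)] at h5
  refine h5.trans (le_of_eq ?_)
  field_simp

theorem abs_shifted_sub_mulVec_le (hΛ : 1 ≤ Λ) (hγ0 : 0 ≤ γ) (hγ1 : γ ≤ 1) {Q Q' : Matrix X X ℝ}
    (hQ : Tame γ k Λ Q) (hQ' : Tame γ k Λ Q') {χ : ℝ} (hχ0 : 0 ≤ χ) {f : X → ℝ}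
    (hχ : ∀ m ≤ k, ∀ x, |((Q' - Q) *ᵥ (shifted γ Q' m *ᵥ f)) x| ≤ χ) (x : X) :
    |((shifted γ Q' k - shifted γ Q k) *ᵥ f) x| ≤ (k + 1) * (Λ * χ) :=
  shifted_sub_le hγ0 hγ1 hQ hQ'.det f (fun f => |f x|) (by simp)
    (fun a b => abs_add_le (a x) (b x)) (mul_nonneg (by linarith) hχ0)
    (fun _ hA s hs => hA.abs_mulVec_le hχ0 (hχ s hs) x) le_rfl

/-- Write σ'_j ψ'_j = Mφ'_j + (M' - M)φ'_j. The first term is bounded by the recoverability of the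
unperturbed matrix, so none is required of the perturbed one. -/
theorem abs_left_le (hν : IsFullProb ν) {M M' : Matrix X X ℝ} (D : NuSVD ν M) (D' : NuSVD ν M')
    (hΛ : 1 ≤ Λ) (hξ : D.recoverability ≤ Λ) {j : Fin (Fintype.card X)} (hσ : Λ⁻¹ / 2 ≤ D'.σ j)
    {t : ℝ} {x : X} (ht : |((M' - M) *ᵥ D'.φ j) x| ≤ t) : |D'.ψ j x| ≤ 2 * Λ * (Λ + t) := by
  have hΛ0 : 0 < Λ := by linarith
  have h1 : |(M' *ᵥ D'.φ j) x| ≤ Λ + t := by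
    have e : M' *ᵥ D'.φ j = M *ᵥ D'.φ j + (M' - M) *ᵥ D'.φ j := by
      rw [Matrix.sub_mulVec]; abel
    have h2 := D.abs_mulVec_le hν hξ (D'.φ j) x
    rw [D'.onb_right.l2Norm_eq_one fun x => (hν.pos x).le, mul_one] at h2
    rw [e]
    exact (abs_add_le _ _).trans (add_le_add h2 ht)
  rw [D'.mulVec_right, Pi.smul_apply, smul_eq_mul, abs_mul, abs_of_nonneg (D'.σ_nonneg j)] at h1
  have h2 : Λ⁻¹ / 2 * |D'.ψ j x| ≤ Λ + t :=
    (mul_le_mul_of_nonneg_right hσ (abs_nonneg _)).trans h1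
  calc |D'.ψ j x| = 2 * Λ * (Λ⁻¹ / 2 * |D'.ψ j x|) := by field_simp
    _ ≤ _ := mul_le_mul_of_nonneg_left h2 (by positivity)

end Deterministic


/-! ### Closing the leave-one-out loop: entrywise bound for the truncations -/

section TruncationBound

variable {X : Type*} [Fintype X] [DecidableEq X] {ν : X → ℝ} {Λ η γ : ℝ} {k : ℕ}

/-- If the perturbation `Q' - Q` is small in operator norm and its rows are almost orthogonal to
the leave-one-out singular vectors, then the truncated decompositions are close entrywise. -/
theorem abs_trunc_sub_mulVec_le {n : ℝ} (hn : 0 < n) (hΛ : 1 ≤ Λ) (hη : 0 ≤ η) (hγ0 : 0 ≤ γ)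
    (hγ1 : γ ≤ 1) (hν : IsFullProb ν) (hlo : ∀ x, 1 ≤ Λ * (n * ν x)) (hhi : ∀ x, n * ν x ≤ Λ)
    {Q Q' : Matrix X X ℝ} {Qx : X → Matrix X X ℝ} (hQ : Tame γ k Λ Q) (hQ' : Tame γ k Λ Q')
    (hQxdef : ∀ x, Qx x = Q'.updateRow x (Q x)) (hQx : ∀ x, Tame γ k Λ (Qx x))
    (hE : ∀ f, e2 ((Q' - Q) *ᵥ f) ≤ η * e2 f)
    (D : NuSVD ν (shifted γ Q k)) (D' : NuSVD ν (shifted γ Q' k))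
    (Dx : ∀ x, NuSVD ν (shifted γ (Qx x) k))
    {r : ℕ} (hr1 : 1 ≤ r) (hrn : r < Fintype.card X) (hrΛ : (r : ℝ) ≤ Λ)
    (hloo : ∀ x, ∀ m ≤ k, ∀ j ∈ lead X r, ∀ b : ℝ,
      (∀ y, |(shifted γ (Qx x) m *ᵥ (Dx x).φ j) y| ≤ b) →
      |((Q' - Q) *ᵥ (shifted γ (Qx x) m *ᵥ (Dx x).φ j)) x| ≤ η * b)
    (hξ : D.recoverability ≤ Λ) (hgap : D.σ ⟨r, hrn⟩ + Λ⁻¹ ≤ D.σ ⟨r - 1, by omega⟩)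
    (ha : 24 * ((k + 1) * η) * Λ ^ 9 ≤ 1) (f : X → ℝ) (x : X) :
    |((D'.trunc r - D.trunc r) *ᵥ f) x| ≤ 15 * ((k + 1) * η) * Λ ^ 11 * l2Norm ν f := by
  have hΛ0 : 0 < Λ := by linarith
  have hν0 : ∀ x, 0 ≤ ν x := fun x => (hν.pos x).le
  set a : ℝ := (k + 1) * η with hadef
  have ha0 : 0 ≤ a := by positivity
  have hpow : ∀ i ≤ 9, a * Λ ^ i ≤ 1 / 24 := by
    intro i hi
    have := mul_le_mul_of_nonneg_left (pow_le_pow_right₀ hΛ hi) ha0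
    linarith
  have hop : ∀ S S' : Matrix X X ℝ, Tame γ k Λ S → Tame γ k Λ S' →
      (∀ f, e2 ((S' - S) *ᵥ f) ≤ η * e2 f) → ∀ f,
      l2Norm ν ((shifted γ S' k - shifted γ S k) *ᵥ f) ≤ a * Λ ^ 4 * l2Norm ν f := by
    intro S S' hS hS' hSE f
    refine (l2Norm_mulVec_le_of_e2 hn hΛ hν0 hlo hhi (by positivity)
      (e2_shifted_sub_le hΛ hη hγ0 hγ1 hS hS' hSE f)).trans (le_of_eq ?_)
    rw [hadef]; ring
  have hneg : ∀ (M M' : Matrix X X ℝ) (f : X → ℝ),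
      l2Norm ν ((M - M') *ᵥ f) = l2Norm ν ((M' - M) *ᵥ f) := by
    intro M M' f
    rw [← neg_sub, Matrix.neg_mulVec, l2Norm_neg]
  have hdQ' := hop Q Q' hQ hQ' hE
  have hdQx : ∀ x, ∀ f, l2Norm ν ((shifted γ (Qx x) k - shifted γ Q k) *ᵥ f)
      ≤ a * Λ ^ 4 * l2Norm ν f := fun x => hop Q (Qx x) hQ (hQx x) fun f => by
    rw [hQxdef]; exact e2_updateRow_sub_le hE hη x f
  have hdG : 4 * (a * Λ ^ 4) ≤ Λ⁻¹ := by
    rw [← one_div, le_div_iff₀ hΛ0]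
    have := hpow 5 (by norm_num)
    calc 4 * (a * Λ ^ 4) * Λ = 4 * (a * Λ ^ 5) := by ring
      _ ≤ 1 := by linarith
  have hd0 : ∀ f, l2Norm ν ((shifted γ Q k - shifted γ Q k) *ᵥ f) ≤ a * Λ ^ 4 * l2Norm ν f := by
    intro f
    rw [sub_self, Matrix.zero_mulVec, l2Norm_zero]
    have := l2Norm_nonneg (ν := ν) f
    positivity
  have hdQ'' : ∀ f, l2Norm ν ((shifted γ Q k - shifted γ Q' k) *ᵥ f) ≤ a * Λ ^ 4 * l2Norm ν f :=
    fun f => by rw [hneg]; exact hdQ' f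
  have hgapx : ∀ x, ∀ j ∈ lead X r, ∀ i ∈ (lead X r)ᶜ, (Dx x).σ i + Λ⁻¹ / 2 ≤ D'.σ j := by
    intro x j hj i hi
    exact σ_gap D D' (Dx x) hν0 hr1 hrn hgap hdQ'' (hdQx x) hdG (mem_lead.1 hj)
      (by simpa [mem_lead] using hi)
  have hgapD : ∀ j ∈ lead X r, ∀ i ∈ (lead X r)ᶜ, D'.σ i + Λ⁻¹ / 2 ≤ D.σ j := by
    intro j hj i hi
    exact σ_gap D D D' hν0 hr1 hrn hgap hd0 hdQ' hdG (mem_lead.1 hj)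
      (by simpa [mem_lead] using hi)
  have hσ' : ∀ j ∈ lead X r, Λ⁻¹ / 2 ≤ D'.σ j := by
    intro j hj
    have := hgapx x j hj ⟨r, hrn⟩ (by simp [mem_lead])
    have h2 := (Dx x).σ_nonneg ⟨r, hrn⟩
    linarith
  have hne : (lead X r).Nonempty := ⟨⟨0, by omega⟩, mem_lead.2 (by simp; omega)⟩
  have hXne : (Finset.univ : Finset X).Nonempty := ⟨x, Finset.mem_univ x⟩
  -- The maximum χ is attained at some row x₁. The leave-one-out argument is run at this row, so
  -- that χ appears on both sides of one inequality.
  obtain ⟨⟨x₁, m₁, j₁⟩, hmem₁, hmax₁⟩ := (((Finset.univ : Finset X) ×ˢ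
    (Finset.range (k + 1) ×ˢ lead X r))).exists_max_image
    (fun t => |((Q' - Q) *ᵥ (shifted γ Q' t.2.1 *ᵥ D'.φ t.2.2)) t.1|)
    (hXne.product ((Finset.nonempty_range_iff.2 (by omega)).product hne))
  simp only [Finset.mem_product, Finset.mem_univ, true_and, Finset.mem_range] at hmem₁ hmax₁
  set χ := |((Q' - Q) *ᵥ (shifted γ Q' m₁ *ᵥ D'.φ j₁)) x₁| with hχdef
  have hχ : ∀ x, ∀ m ≤ k, ∀ j ∈ lead X r,
      |((Q' - Q) *ᵥ (shifted γ Q' m *ᵥ D'.φ j)) x| ≤ χ :=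
    fun x m hm j hj => hmax₁ (x, m, j) ⟨Nat.lt_succ_of_le hm, hj⟩
  have hχ0 : 0 ≤ χ := abs_nonneg _
  obtain ⟨⟨x₂, j₂⟩, hmem₂, hmax₂⟩ := ((Finset.univ : Finset X) ×ˢ lead X r).exists_max_image
    (fun t => |D'.ψ t.2 t.1|) (hXne.product hne)
  simp only [Finset.mem_product, Finset.mem_univ, true_and] at hmem₂ hmax₂
  set B := |D'.ψ j₂ x₂| with hBdef
  have hB : ∀ j ∈ lead X r, ∀ y, |D'.ψ j y| ≤ B := fun j hj y => hmax₂ (y, j) hj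
  have hB0 : 0 ≤ B := abs_nonneg _
  have hBφ : ∀ j ∈ lead X r, ∀ y, |D'.φ j y| ≤ 2 * Λ ^ 4 * B := fun j hj y =>
    abs_right_le hn hΛ hν.pos hlo hhi (hQ'.res k le_rfl) D' (hσ' j hj) hB0 (hB j hj) y
  have hdiff : ∀ j ∈ lead X r, ∀ x,
      |((shifted γ Q' k - shifted γ Q k) *ᵥ D'.φ j) x| ≤ (k + 1) * (Λ * χ) := fun j hj x =>
    abs_shifted_sub_mulVec_le hΛ hγ0 hγ1 hQ hQ' hχ0 (fun m hm x => hχ x m hm j hj) x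
  -- Self-bounding: with every a Λ^i at most 1/24, the coefficient of χ on the right is at most 5/24
  -- and is absorbed.
  have hχle : χ ≤ 3 * η * Λ ^ 7 * B := by
    have hW := sqrt_offSq_updateRow_le hn hΛ hη hγ0 hγ1 hν0 hlo hhi hQ' (hQxdef x₁) (hQx x₁) hE D'
      (Dx x₁) hrΛ (hgapx x₁) hχ0 hB0 (hχ x₁) hB
    have h1 := abs_row_mulVec_le hn hΛ hη hγ0 hγ1 hν0 hlo hQ' (hQxdef x₁) (hQx x₁) hE D'
      (Dx x₁) hrΛ (hloo x₁) hχ0 (by positivity) (by positivity) (hχ x₁) hBφ hW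
      (show m₁ ≤ k by omega) hmem₁.2
    rw [← hχdef] at h1
    have e : (k + 1) * η * Λ * χ + 2 * η * Λ ^ 3 * (2 * Λ ^ 6 * ((k + 1) * χ + (k + 1) * η * B))
        + η * Λ ^ 3 * (2 * Λ ^ 4 * B)
        = a * Λ ^ 1 * χ + 4 * (a * Λ ^ 9) * χ + 4 * (a * Λ ^ 9) * (η * B)
          + 2 * (η * Λ ^ 7 * B) := by
      rw [hadef]; ring
    rw [e] at h1
    have hηB : 0 ≤ η * B := by positivity
    have h2 := mul_le_mul_of_nonneg_right (hpow 1 (by norm_num)) hχ0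
    have h3 := mul_le_mul_of_nonneg_right (hpow 9 le_rfl) hχ0
    have h4 := mul_le_mul_of_nonneg_right (hpow 9 le_rfl) hηB
    have h5 : η * B ≤ η * Λ ^ 7 * B := by
      have : η * B * 1 ≤ η * B * Λ ^ 7 := mul_le_mul_of_nonneg_left (one_le_pow₀ hΛ) hηB
      linarith
    linarith
  -- The second absorption: the perturbation term is at most B/4, and what remains is the a priori
  -- size 2Λ² given by the recoverability.
  have hBle : B ≤ 3 * Λ ^ 2 := by
    have h1 := abs_left_le hν D D' hΛ hξ (hσ' j₂ hmem₂) (hdiff j₂ hmem₂ x₂)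
    rw [← hBdef] at h1
    have h2 : (k + 1) * (Λ * χ) ≤ (k + 1) * (Λ * (3 * η * Λ ^ 7 * B)) := by gcongr
    have h3 : 2 * Λ * (Λ + (k + 1) * (Λ * (3 * η * Λ ^ 7 * B)))
        = 2 * Λ ^ 2 + 6 * (a * Λ ^ 9) * B := by rw [hadef]; ring
    have h4 : B ≤ 2 * Λ ^ 2 + 6 * (a * Λ ^ 9) * B := by
      rw [← h3]; exact h1.trans (by gcongr)
    have h5 := mul_le_mul_of_nonneg_right (hpow 9 le_rfl) hB0
    linarith [sq_nonneg Λ]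
  have hχle' : χ ≤ 9 * η * Λ ^ 9 := by
    calc χ ≤ 3 * η * Λ ^ 7 * B := hχle
      _ ≤ 3 * η * Λ ^ 7 * (3 * Λ ^ 2) := by gcongr
      _ = _ := by ring
  have hf0 := l2Norm_nonneg (ν := ν) f
  have hcard : ((lead X r).card : ℝ) ≤ Λ := le_trans (by exact_mod_cast card_lead_le r) hrΛ
  have hfirst : |((shifted γ Q' k - shifted γ Q k) *ᵥ proj ν (lead X r) D'.φ f) x|
      ≤ 9 * a * Λ ^ 11 * l2Norm ν f := by
    rw [proj, Matrix.mulVec_sum, Finset.sum_apply]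
    calc _ ≤ ∑ j ∈ lead X r, |((shifted γ Q' k - shifted γ Q k) *ᵥ
          (ip ν (D'.φ j) f • D'.φ j)) x| := Finset.abs_sum_le_sum_abs _ _
      _ ≤ ∑ j ∈ lead X r, l2Norm ν f * ((k + 1) * (Λ * (9 * η * Λ ^ 9))) := by
          refine Finset.sum_le_sum fun j hj => ?_
          rw [Matrix.mulVec_smul, Pi.smul_apply, smul_eq_mul, abs_mul]
          refine mul_le_mul (D'.onb_right.abs_ip_le hν0 j f) ((hdiff j hj x).trans ?_)
            (abs_nonneg _) hf0
          gcongr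
      _ ≤ Λ * (l2Norm ν f * ((k + 1) * (Λ * (9 * η * Λ ^ 9)))) := by
          rw [Finset.sum_const, nsmul_eq_mul]; gcongr
      _ = _ := by rw [hadef]; ring
  have hoff : Real.sqrt (offSq ν (lead X r) D.φ D'.φ) ≤ 3 * a * Λ ^ 6 := by
    have h1 := D.offSq_le D' hν0 (lead X r) (G := Λ⁻¹ / 2) (p := a * Λ ^ 4) (q := a * Λ ^ 4)
      (by positivity) hgapD
      (fun j _ => by
        have := hdQ' (D.φ j)
        rwa [D.onb_right.l2Norm_eq_one hν0, mul_one] at this)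
      (fun j _ h => by
        refine (abs_ip_le hν0 _ _).trans ?_
        rw [D.onb_left.l2Norm_eq_one hν0, one_mul]
        exact hdQ' h)
    refine Real.sqrt_le_iff.2 ⟨by positivity, h1.trans ?_⟩
    have e : ((lead X r).card : ℝ) * ((a * Λ ^ 4) ^ 2 + (a * Λ ^ 4) ^ 2) / (Λ⁻¹ / 2) ^ 2
        = ((lead X r).card : ℝ) * (8 * a ^ 2 * Λ ^ 10) := by
      field_simp; norm_num; ring
    rw [e]
    calc _ ≤ Λ * (8 * a ^ 2 * Λ ^ 10) := by gcongr
      _ = 8 * a ^ 2 * Λ ^ 11 := by ring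
      _ ≤ 9 * a ^ 2 * Λ ^ 12 := by
          have : Λ ^ 11 ≤ Λ ^ 12 := pow_le_pow_right₀ hΛ (by norm_num)
          gcongr
          norm_num
      _ = _ := by ring
  have hsecond : |(shifted γ Q k *ᵥ (proj ν (lead X r) D'.φ f - proj ν (lead X r) D.φ f)) x|
      ≤ 6 * a * Λ ^ 11 * l2Norm ν f := by
    refine (D.abs_mulVec_le hν hξ _ x).trans ?_
    calc Λ * _ ≤ Λ * (2 * Real.sqrt (offSq ν (lead X r) D.φ D'.φ) * l2Norm ν f) :=
          mul_le_mul_of_nonneg_left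
            (l2Norm_proj_sub_proj_le D.onb_right D'.onb_right hν0 _ f) hΛ0.le
      _ ≤ Λ * (2 * (3 * a * Λ ^ 6) * l2Norm ν f) := by gcongr
      _ = 6 * a * Λ ^ 7 * l2Norm ν f := by ring
      _ ≤ _ := by
          have : Λ ^ 7 ≤ Λ ^ 11 := pow_le_pow_right₀ hΛ (by norm_num)
          gcongr
  have hsplit : (D'.trunc r - D.trunc r) *ᵥ f
      = (shifted γ Q' k - shifted γ Q k) *ᵥ proj ν (lead X r) D'.φ f
        + shifted γ Q k *ᵥ (proj ν (lead X r) D'.φ f - proj ν (lead X r) D.φ f) := by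
    rw [Matrix.sub_mulVec, D'.trunc_mulVec, D.trunc_mulVec, Matrix.sub_mulVec, Matrix.mulVec_sub]
    simp only [lead]
    abel
  rw [hsplit, Pi.add_apply]
  refine (abs_add_le _ _).trans ((add_le_add hfirst hsecond).trans (le_of_eq (by ring)))

theorem supNorm_le {f : X → ℝ} {b : ℝ} (hb : 0 ≤ b) (h : ∀ x, |f x| ≤ b) : supNorm f ≤ b :=
  Real.iSup_le h hb

theorem twoInftyNorm_le {A : Matrix X X ℝ} {C : ℝ} (hC : 0 ≤ C)
    (h : ∀ f x, |(A *ᵥ f) x| ≤ C * l2Norm ν f) : twoInftyNorm ν A ≤ C := by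
  refine Real.iSup_le (fun f => ?_) hC
  refine div_le_of_le_mul₀ (l2Norm_nonneg _) hC ?_
  exact supNorm_le (mul_nonneg hC (l2Norm_nonneg _)) (h f.1)

end TruncationBound


/-! ### Finite product probability spaces -/

section Product

variable {I S : Type*} [Fintype I] [DecidableEq I] [Fintype S]

/-- A family of probability vectors. -/
structure IsLaw (p : I → S → ℝ) : Prop where
  nonneg : ∀ i s, 0 ≤ p i s
  sum_eq_one : ∀ i, ∑ s, p i s = 1

/-- Expectation with respect to the product of the laws `p i`. -/
noncomputable def Ex (p : I → S → ℝ) (f : (I → S) → ℝ) : ℝ := ∑ τ, (∏ i, p i (τ i)) * f τ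

/-- Probability with respect to the product of the laws `p i`. -/
noncomputable def pr (p : I → S → ℝ) (A : (I → S) → Prop) : ℝ :=
  open Classical in Ex p fun τ => if A τ then 1 else 0

variable {p : I → S → ℝ}

theorem Ex_add (f g : (I → S) → ℝ) : Ex p (fun τ => f τ + g τ) = Ex p f + Ex p g := by
  simp only [Ex, mul_add, Finset.sum_add_distrib]

theorem Ex_sub (f g : (I → S) → ℝ) : Ex p (fun τ => f τ - g τ) = Ex p f - Ex p g := by
  simp only [Ex, mul_sub, Finset.sum_sub_distrib]

theorem Ex_const_mul (c : ℝ) (f : (I → S) → ℝ) : Ex p (fun τ => c * f τ) = c * Ex p f := by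
  simp only [Ex, Finset.mul_sum]
  exact Finset.sum_congr rfl fun _ _ => by ring

theorem Ex_sum {ι : Type*} (s : Finset ι) (f : ι → (I → S) → ℝ) :
    Ex p (fun τ => ∑ a ∈ s, f a τ) = ∑ a ∈ s, Ex p (f a) := by
  simp only [Ex, Finset.mul_sum]
  exact Finset.sum_comm

/-- Fubini for a finite product: expanding the product of sums gives one term for each
configuration. -/
theorem Ex_prod (g : I → S → ℝ) : Ex p (fun τ => ∏ i, g i (τ i)) = ∏ i, ∑ s, p i s * g i s := by
  rw [Finset.prod_univ_sum, Fintype.piFinset_univ]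
  simp only [Ex, Finset.prod_mul_distrib]

namespace IsLaw

theorem prod_nonneg (hp : IsLaw p) (τ : I → S) : 0 ≤ ∏ i, p i (τ i) :=
  Finset.prod_nonneg fun i _ => hp.nonneg i _

theorem mono (hp : IsLaw p) {f g : (I → S) → ℝ} (h : ∀ τ, f τ ≤ g τ) : Ex p f ≤ Ex p g :=
  Finset.sum_le_sum fun τ _ => mul_le_mul_of_nonneg_left (h τ) (hp.prod_nonneg τ)

theorem Ex_const (hp : IsLaw p) (c : ℝ) : Ex p (fun _ => c) = c := by
  have h : Ex p (fun _ => (1 : ℝ)) = 1 := by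
    have := Ex_prod (p := p) fun _ _ => 1
    simpa [hp.sum_eq_one] using this
  have := Ex_const_mul (p := p) c fun _ => 1
  simpa [h] using this

theorem pr_le_Ex (hp : IsLaw p) {A : (I → S) → Prop} {g : (I → S) → ℝ} (h0 : ∀ τ, 0 ≤ g τ)
    (h : ∀ τ, A τ → 1 ≤ g τ) : pr p A ≤ Ex p g := by
  classical
  refine hp.mono fun τ => ?_
  split_ifs with hA
  exacts [h τ hA, h0 τ]

theorem pr_mono (hp : IsLaw p) {A B : (I → S) → Prop} (h : ∀ τ, A τ → B τ) : pr p A ≤ pr p B := by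
  classical
  refine hp.pr_le_Ex (fun τ => ?_) fun τ hA => ?_
  · split_ifs <;> norm_num
  · simp [h τ hA]

theorem pr_or_le (hp : IsLaw p) (A B : (I → S) → Prop) : pr p (fun τ => A τ ∨ B τ) ≤ pr p A + pr p B := by
  classical
  rw [pr, pr, pr, ← Ex_add]
  refine hp.mono fun τ => ?_
  by_cases hA : A τ <;> by_cases hB : B τ <;> simp [hA, hB]

theorem pr_exists_le (hp : IsLaw p) {ι : Type*} (s : Finset ι) (A : ι → (I → S) → Prop) {b : ℝ}
    (h : ∀ a ∈ s, pr p (A a) ≤ b) : pr p (fun τ => ∃ a ∈ s, A a τ) ≤ s.card * b := by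
  classical
  have h1 : pr p (fun τ => ∃ a ∈ s, A a τ) ≤ Ex p (fun τ => ∑ a ∈ s, if A a τ then 1 else 0) := by
    refine hp.pr_le_Ex (fun τ => Finset.sum_nonneg fun a _ => ?_) fun τ ⟨a, ha, hA⟩ => ?_
    · split_ifs <;> norm_num
    · have h2 := Finset.single_le_sum (f := fun a => if A a τ then (1 : ℝ) else 0) (s := s)
        (fun a _ => by split_ifs <;> norm_num) ha
      simpa only [hA, if_true] using h2
  refine h1.trans ?_
  rw [Ex_sum, ← nsmul_eq_mul]
  exact Finset.sum_le_card_nsmul _ _ _ h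

end IsLaw

/-- Exchanging the coordinates in `J` of two independent copies. -/
theorem Ex_swap (J : Finset I) (G : (I → S) → (I → S) → ℝ) :
    Ex p (fun τ => Ex p (fun τ' => G (J.piecewise τ' τ) (J.piecewise τ τ')))
      = Ex p (fun τ => Ex p (fun τ' => G τ τ')) := by
  have e : ∀ H : (I → S) → (I → S) → ℝ, Ex p (fun τ => Ex p (fun τ' => H τ τ'))
      = ∑ t : (I → S) × (I → S), (∏ i, p i (t.1 i) * p i (t.2 i)) * H t.1 t.2 := by
    intro H
    rw [Fintype.sum_prod_type]
    simp only [Ex, Finset.mul_sum, Finset.prod_mul_distrib, mul_assoc]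
  rw [e, e]
  have hinv : Function.Involutive fun t : (I → S) × (I → S) =>
      (J.piecewise t.2 t.1, J.piecewise t.1 t.2) := by
    rintro ⟨a, b⟩
    ext i <;> by_cases hi : i ∈ J <;> simp [hi]
  refine Fintype.sum_equiv hinv.toPerm _ _ fun t => ?_
  congr 1
  refine Finset.prod_congr rfl fun i _ => ?_
  by_cases hi : i ∈ J <;> simp [hi, mul_comm]

/-- Conditioning on the coordinates outside `J`. -/
theorem IsLaw.pr_le_of_piecewise (hp : IsLaw p) (J : Finset I) {A : (I → S) → Prop} {b : ℝ}
    (h : ∀ τ, pr p (fun τ' => A (J.piecewise τ' τ)) ≤ b) : pr p A ≤ b := by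
  classical
  have h1 := Ex_swap (p := p) J fun τ _ => if A τ then (1 : ℝ) else 0
  simp only [hp.Ex_const] at h1
  rw [pr, ← h1, ← hp.Ex_const b]
  exact hp.mono h

/-- Bernstein's bound for the moment generating function of a sum of independent variables. -/
theorem IsLaw.Ex_exp_le (hp : IsLaw p) {f : I → S → ℝ} {h θ v m : ℝ} (hθ : 0 ≤ θ)
    (hf : ∀ i s, |f i s| ≤ h) (hθh : θ * h ≤ 1) (hv : ∑ i, ∑ s, p i s * f i s ^ 2 ≤ v)
    (hm : ∑ i, ∑ s, p i s * f i s = m) :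
    Ex p (fun τ => Real.exp (θ * ∑ i, f i (τ i))) ≤ Real.exp (θ * m + θ ^ 2 * v) := by
  simp only [Finset.mul_sum, Real.exp_sum]
  rw [Ex_prod (p := p) fun i s => Real.exp (θ * f i s)]
  calc ∏ i, ∑ s, p i s * Real.exp (θ * f i s)
      ≤ ∏ i, Real.exp (θ * (∑ s, p i s * f i s) + θ ^ 2 * ∑ s, p i s * f i s ^ 2) := by
        refine Finset.prod_le_prod (fun i _ => Finset.sum_nonneg fun s _ =>
          mul_nonneg (hp.nonneg i s) (Real.exp_nonneg _)) fun i _ => ?_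
        refine le_trans ?_ (Real.add_one_le_exp _)
        calc ∑ s, p i s * Real.exp (θ * f i s)
            ≤ ∑ s, p i s * (1 + θ * f i s + (θ * f i s) ^ 2) := by
              refine Finset.sum_le_sum fun s _ => mul_le_mul_of_nonneg_left ?_ (hp.nonneg i s)
              have h1 : |θ * f i s| ≤ 1 := by
                rw [abs_mul, abs_of_nonneg hθ]
                exact (mul_le_mul_of_nonneg_left (hf i s) hθ).trans hθh
              have h2 := (abs_le.1 (Real.abs_exp_sub_one_sub_id_le h1)).2
              linarith
          _ = _ := by
              have e : ∀ s, p i s * (1 + θ * f i s + (θ * f i s) ^ 2)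
                  = p i s + θ * (p i s * f i s) + θ ^ 2 * (p i s * f i s ^ 2) := fun s => by ring
              simp only [e, Finset.sum_add_distrib, hp.sum_eq_one, ← Finset.mul_sum]
              ring
    _ = Real.exp (θ * m + θ ^ 2 * ∑ i, ∑ s, p i s * f i s ^ 2) := by
        rw [← Real.exp_sum, Finset.sum_add_distrib, ← Finset.mul_sum, ← Finset.mul_sum, hm]
    _ ≤ _ := Real.exp_le_exp.2 (by gcongr)

/-- Bernstein's tail bound. -/
theorem IsLaw.pr_sum_gt_le (hp : IsLaw p) {f : I → S → ℝ} {h v m t : ℝ} (h0 : 0 < v) (ht : 0 ≤ t)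
    (hf : ∀ i s, |f i s| ≤ h) (hth : t * h ≤ 2 * v) (hv : ∑ i, ∑ s, p i s * f i s ^ 2 ≤ v)
    (hm : ∑ i, ∑ s, p i s * f i s = m) :
    pr p (fun τ => m + t < ∑ i, f i (τ i)) ≤ Real.exp (-(t ^ 2 / (4 * v))) := by
  -- The minimiser of -θt + θ²v. The hypothesis on `t * h` is exactly θh ≤ 1.
  set θ := t / (2 * v) with hθ
  have hθ0 : 0 ≤ θ := by positivity
  have hθh : θ * h ≤ 1 := by
    rw [hθ, div_mul_eq_mul_div, div_le_one (by positivity)]; exact hth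
  have h1 := hp.Ex_exp_le hθ0 hf hθh hv hm
  have h2 : pr p (fun τ => m + t < ∑ i, f i (τ i))
      ≤ Ex p (fun τ => Real.exp (-(θ * (m + t))) * Real.exp (θ * ∑ i, f i (τ i))) := by
    refine hp.pr_le_Ex (fun τ => by positivity) fun τ hτ => ?_
    rw [← Real.exp_add]
    refine Real.one_le_exp ?_
    have := mul_le_mul_of_nonneg_left hτ.le hθ0
    linarith
  rw [Ex_const_mul] at h2
  refine h2.trans ((mul_le_mul_of_nonneg_left h1 (Real.exp_nonneg _)).trans (le_of_eq ?_))
  rw [← Real.exp_add, hθ]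
  congr 1
  field_simp
  ring

end Product


/-! ### Trace inequalities for symmetric matrices -/

/-- The claim is (a^i - b^i)(a^j - b^j) ≥ 0. As i + j is even the exponents have the same parity,
and both factors have the sign of |a| - |b| if they are even, of a - b if they are odd, or vanish.
-/
theorem pow_mul_pow_add_le (a b : ℝ) {i j : ℕ} (h : Even (i + j)) :
    a ^ i * b ^ j + a ^ j * b ^ i ≤ a ^ (i + j) + b ^ (i + j) := by
  have key : 0 ≤ (a ^ i - b ^ i) * (a ^ j - b ^ j) := by
    rcases Nat.even_or_odd i with hi | hi
    · have hj : Even j := (Nat.even_add.1 h).1 hi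
      rw [← hi.pow_abs a, ← hi.pow_abs b, ← hj.pow_abs a, ← hj.pow_abs b]
      rcases le_total |a| |b| with hab | hab
      · exact mul_nonneg_of_nonpos_of_nonpos
          (sub_nonpos.2 (pow_le_pow_left₀ (abs_nonneg _) hab i))
          (sub_nonpos.2 (pow_le_pow_left₀ (abs_nonneg _) hab j))
      · exact mul_nonneg (sub_nonneg.2 (pow_le_pow_left₀ (abs_nonneg _) hab i))
          (sub_nonneg.2 (pow_le_pow_left₀ (abs_nonneg _) hab j))
    · have hj : Odd j := by
        rw [← Nat.not_even_iff_odd] at hi ⊢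
        exact fun hj => hi ((Nat.even_add.1 h).2 hj)
      rcases le_total a b with hab | hab
      · exact mul_nonneg_of_nonpos_of_nonpos
          (sub_nonpos.2 (hi.strictMono_pow.monotone hab))
          (sub_nonpos.2 (hj.strictMono_pow.monotone hab))
      · exact mul_nonneg (sub_nonneg.2 (hi.strictMono_pow.monotone hab))
          (sub_nonneg.2 (hj.strictMono_pow.monotone hab))
  rw [pow_add, pow_add]
  linarith

/-- Factor out (a - b)² and pair the geometric sum ∑ a^i b^(q-i) with its reversal; each pair is at
most a^q + b^q. This is the scalar form of the mean value trace inequality. -/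
theorem sub_mul_pow_sub_pow_le (a b : ℝ) {q : ℕ} (hq : Even q) :
    (a - b) * (a ^ (q + 1) - b ^ (q + 1))
      ≤ ((q + 1 : ℕ) : ℝ) / 2 * ((a - b) ^ 2 * (a ^ q + b ^ q)) := by
  have h1 : 2 * ∑ i ∈ Finset.range (q + 1), a ^ i * b ^ (q + 1 - 1 - i)
      ≤ ((q + 1 : ℕ) : ℝ) * (a ^ q + b ^ q) := by
    have h2 := Finset.sum_range_reflect (fun i => a ^ i * b ^ (q + 1 - 1 - i)) (q + 1)
    rw [two_mul]
    nth_rw 1 [← h2]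
    rw [← Finset.sum_add_distrib]
    calc _ ≤ ∑ i ∈ Finset.range (q + 1), (a ^ q + b ^ q) := by
          refine Finset.sum_le_sum fun i hi => ?_
          have hi' : i ≤ q := by have := Finset.mem_range.1 hi; omega
          have e1 : q - (q - i) = i := by omega
          have e2 : q - i + i = q := by omega
          have h3 := pow_mul_pow_add_le a b (i := q - i) (j := i) (by rwa [e2])
          rw [e2] at h3
          simpa only [Nat.add_sub_cancel, e1] using h3
      _ = _ := by rw [Finset.sum_const, Finset.card_range, nsmul_eq_mul]
  rw [← geom_sum₂_mul a b (q + 1)]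
  nlinarith [mul_le_mul_of_nonneg_right h1 (sq_nonneg (a - b))]

section Trace

variable {m : Type*} [Fintype m] [DecidableEq m]

theorem exists_diagonalization {A : Matrix m m ℝ} (hA : A.IsHermitian) :
    ∃ (U : Matrix m m ℝ) (l : m → ℝ), Uᵀ * U = 1 ∧ U * Uᵀ = 1 ∧
      ∀ a : ℕ, A ^ a = U * Matrix.diagonal (fun k => l k ^ a) * Uᵀ := by
  have e : (star (hA.eigenvectorUnitary : Matrix m m ℝ))
      = (hA.eigenvectorUnitary : Matrix m m ℝ)ᵀ := by
    rw [Matrix.star_eq_conjTranspose, Matrix.conjTranspose_eq_transpose_of_trivial]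
  refine ⟨hA.eigenvectorUnitary, hA.eigenvalues, ?_, ?_, fun a => ?_⟩
  · rw [← e]; exact Unitary.coe_star_mul_self _
  · rw [← e]; exact Unitary.coe_mul_star_self _
  · conv_lhs => rw [hA.spectral_theorem, ← map_pow, Matrix.diagonal_pow]
    rw [Unitary.conjStarAlgAut_apply, e]
    congr 2

/-- The weights (UᵀV)_ij² are non-negative and do not depend on the exponents. Inequalities for
traces of words in `A` and `B` thus follow from inequalities between pairs of eigenvalues, although
the matrices need not commute. -/
theorem trace_pow_mul_pow {A B U V : Matrix m m ℝ} {l k : m → ℝ} {a b : ℕ}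
    (hA : A ^ a = U * Matrix.diagonal (fun i => l i ^ a) * Uᵀ)
    (hB : B ^ b = V * Matrix.diagonal (fun i => k i ^ b) * Vᵀ) :
    (A ^ a * B ^ b).trace = ∑ i, ∑ j, (Uᵀ * V) i j ^ 2 * (l i ^ a * k j ^ b) := by
  have h1 : (A ^ a * B ^ b).trace = (Matrix.diagonal (fun i => l i ^ a) * (Uᵀ * V)
      * (Matrix.diagonal (fun i => k i ^ b) * (Uᵀ * V)ᵀ)).trace := by
    rw [hA, hB, Matrix.transpose_mul, Matrix.transpose_transpose, Matrix.mul_assoc, Matrix.mul_assoc,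
      Matrix.trace_mul_comm]
    simp only [Matrix.mul_assoc]
  rw [h1, Matrix.trace]
  refine Finset.sum_congr rfl fun i _ => ?_
  rw [Matrix.diag_apply, Matrix.mul_apply]
  refine Finset.sum_congr rfl fun j _ => ?_
  rw [Matrix.diagonal_mul, Matrix.diagonal_mul, Matrix.transpose_apply]
  ring

theorem trace_sq_mul_pow_nonneg {A B : Matrix m m ℝ} (hA : A.IsHermitian) (hB : B.IsHermitian)
    {q : ℕ} (hq : Even q) : 0 ≤ (A ^ 2 * B ^ q).trace := by
  obtain ⟨U, l, -, -, hU⟩ := exists_diagonalization hA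
  obtain ⟨V, k, -, -, hV⟩ := exists_diagonalization hB
  rw [trace_pow_mul_pow (hU 2) (hV q)]
  exact Finset.sum_nonneg fun i _ => Finset.sum_nonneg fun j _ =>
    mul_nonneg (sq_nonneg _) (mul_nonneg (sq_nonneg _) (hq.pow_nonneg _))

/-- The difference of the two sides is the trace of (A + B)² Y^q, which is non-negative. -/
theorem trace_sub_sq_mul_pow_le {A B Y : Matrix m m ℝ} (hA : A.IsHermitian) (hB : B.IsHermitian)
    (hY : Y.IsHermitian) {q : ℕ} (hq : Even q) :
    ((A - B) ^ 2 * Y ^ q).trace ≤ 2 * ((A ^ 2 + B ^ 2) * Y ^ q).trace := by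
  have h := trace_sq_mul_pow_nonneg (hA.add hB) hY hq
  have e : (A + B) ^ 2 * Y ^ q
      = (A ^ 2 + B ^ 2) * Y ^ q + (A ^ 2 + B ^ 2) * Y ^ q - (A - B) ^ 2 * Y ^ q := by
    noncomm_ring
  rw [e, Matrix.trace_sub, Matrix.trace_add] at h
  linarith

/-- The mean value trace inequality. -/
theorem trace_sub_mul_pow_sub_pow_le {A B : Matrix m m ℝ} (hA : A.IsHermitian)
    (hB : B.IsHermitian) {q : ℕ} (hq : Even q) :
    ((A - B) * (A ^ (q + 1) - B ^ (q + 1))).trace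
      ≤ ((q + 1 : ℕ) : ℝ) / 2 * ((A - B) ^ 2 * (A ^ q + B ^ q)).trace := by
  obtain ⟨U, l, -, -, hU⟩ := exists_diagonalization hA
  obtain ⟨V, k, -, -, hV⟩ := exists_diagonalization hB
  have T := fun a b => trace_pow_mul_pow (hU a) (hV b)
  have h1 : ((A - B) * (A ^ (q + 1) - B ^ (q + 1))).trace
      = ∑ i, ∑ j, (Uᵀ * V) i j ^ 2 * ((l i - k j) * (l i ^ (q + 1) - k j ^ (q + 1))) := by
    have e : (A - B) * (A ^ (q + 1) - B ^ (q + 1))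
        = A ^ (q + 2) * B ^ 0 - A ^ 1 * B ^ (q + 1) - B * A ^ (q + 1) + A ^ 0 * B ^ (q + 2) := by
      rw [pow_zero, pow_zero, mul_one, one_mul, pow_one, pow_succ' A (q + 1), pow_succ' B (q + 1)]
      noncomm_ring
    have c : (B * A ^ (q + 1)).trace = (A ^ (q + 1) * B ^ 1).trace := by
      rw [pow_one, Matrix.trace_mul_comm]
    rw [e, Matrix.trace_add, Matrix.trace_sub, Matrix.trace_sub, c, T, T, T, T]
    simp only [← Finset.sum_add_distrib, ← Finset.sum_sub_distrib]
    exact Finset.sum_congr rfl fun i _ => Finset.sum_congr rfl fun j _ => by ring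
  have h2 : ((A - B) ^ 2 * (A ^ q + B ^ q)).trace
      = ∑ i, ∑ j, (Uᵀ * V) i j ^ 2 * ((l i - k j) ^ 2 * (l i ^ q + k j ^ q)) := by
    have e : (A - B) ^ 2 * (A ^ q + B ^ q)
        = A ^ (q + 2) * B ^ 0 - A * (B * A ^ q) - B * A ^ (q + 1) + B ^ 2 * A ^ q
          + A ^ 2 * B ^ q - A ^ 1 * B ^ (q + 1) - B * (A * B ^ q) + A ^ 0 * B ^ (q + 2) := by
      rw [pow_zero, pow_zero, mul_one, one_mul, pow_one, pow_add A q 2, pow_add B q 2,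
        (Commute.pow_pow_self A q 2).eq, (Commute.pow_pow_self B q 2).eq, pow_succ' A q,
        pow_succ' B q]
      noncomm_ring
    have c1 : (A * (B * A ^ q)).trace = (A ^ (q + 1) * B ^ 1).trace := by
      rw [Matrix.trace_mul_comm, pow_one, Matrix.mul_assoc, ← pow_succ, Matrix.trace_mul_comm]
    have c2 : (B * A ^ (q + 1)).trace = (A ^ (q + 1) * B ^ 1).trace := by
      rw [pow_one, Matrix.trace_mul_comm]
    have c3 : (B ^ 2 * A ^ q).trace = (A ^ q * B ^ 2).trace := Matrix.trace_mul_comm _ _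
    have c4 : (B * (A * B ^ q)).trace = (A ^ 1 * B ^ (q + 1)).trace := by
      rw [Matrix.trace_mul_comm, pow_one, Matrix.mul_assoc, ← pow_succ]
    simp only [e, Matrix.trace_add, Matrix.trace_sub, c1, c2, c3, c4, T]
    simp only [← Finset.sum_add_distrib, ← Finset.sum_sub_distrib]
    exact Finset.sum_congr rfl fun i _ => Finset.sum_congr rfl fun j _ => by ring
  rw [h1, h2, Finset.mul_sum]
  refine Finset.sum_le_sum fun i _ => ?_
  rw [Finset.mul_sum]
  refine Finset.sum_le_sum fun j _ => ?_
  have := mul_le_mul_of_nonneg_left (sub_mul_pow_sub_pow_le (l i) (k j) hq)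
    (sq_nonneg ((Uᵀ * V) i j))
  linarith

theorem trace_pow_eq_sum {Y U : Matrix m m ℝ} {l : m → ℝ} (hU : Uᵀ * U = 1) {a : ℕ}
    (hY : Y ^ a = U * Matrix.diagonal (fun k => l k ^ a) * Uᵀ) : (Y ^ a).trace = ∑ k, l k ^ a := by
  rw [hY, Matrix.trace_mul_comm, ← Matrix.mul_assoc, hU, Matrix.one_mul, Matrix.trace_diagonal]

/-- In an eigenbasis of `Y` the diagonal of `V` is at most v, and 2cv · l^(2t) is at most the larger
of l^(2t+2) and (2cv)^(t+1). The factor 1/2 on the trace lets the moment inequality absorb it. -/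
theorem mul_trace_mul_pow_le {V Y : Matrix m m ℝ} (hY : Y.IsHermitian) {v : ℝ} (hv : 0 ≤ v)
    (hV : ∀ f : m → ℝ, f ⬝ᵥ (V *ᵥ f) ≤ v * (f ⬝ᵥ f)) {c : ℝ} (hc : 0 ≤ c) (t : ℕ) :
    c * (V * Y ^ (2 * t)).trace
      ≤ (Y ^ (2 * t + 2)).trace / 2 + Fintype.card m * (2 * c * v) ^ (t + 1) / 2 := by
  obtain ⟨U, l, hU, -, hl⟩ := exists_diagonalization hY
  have hcol : ∀ k, Uᵀ k ⬝ᵥ Uᵀ k = 1 := by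
    intro k
    have := congrFun (congrFun hU k) k
    rw [Matrix.one_apply_eq] at this
    rw [← this]; rfl
  have h1 : (V * Y ^ (2 * t)).trace = ∑ k, (Uᵀ k ⬝ᵥ (V *ᵥ Uᵀ k)) * l k ^ (2 * t) := by
    rw [hl, ← Matrix.mul_assoc, ← Matrix.mul_assoc, Matrix.trace_mul_comm, ← Matrix.mul_assoc,
      Matrix.trace]
    refine Finset.sum_congr rfl fun k _ => ?_
    rw [Matrix.diag_apply, Matrix.mul_diagonal]
    congr 1
  rw [h1, trace_pow_eq_sum hU (hl _), Finset.mul_sum]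
  have h2 : ∀ k, c * ((Uᵀ k ⬝ᵥ (V *ᵥ Uᵀ k)) * l k ^ (2 * t))
      ≤ l k ^ (2 * t + 2) / 2 + (2 * c * v) ^ (t + 1) / 2 := by
    intro k
    have h3 : (Uᵀ k ⬝ᵥ (V *ᵥ Uᵀ k)) ≤ v := by
      have := hV (Uᵀ k); rwa [hcol, mul_one] at this
    have h4 : (0 : ℝ) ≤ (l k ^ 2) ^ t := by positivity
    have h5 : 2 * c * v * (l k ^ 2) ^ t ≤ (l k ^ 2) ^ (t + 1) + (2 * c * v) ^ (t + 1) := by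
      have hw : 0 ≤ 2 * c * v := by positivity
      rcases le_total (2 * c * v) (l k ^ 2) with h | h
      · have : 2 * c * v * (l k ^ 2) ^ t ≤ (l k ^ 2) ^ (t + 1) := by
          rw [pow_succ' (l k ^ 2)]; exact mul_le_mul_of_nonneg_right h h4
        have := pow_nonneg hw (t + 1)
        linarith
      · have : 2 * c * v * (l k ^ 2) ^ t ≤ (2 * c * v) ^ (t + 1) := by
          rw [pow_succ' (2 * c * v)]
          exact mul_le_mul_of_nonneg_left (pow_le_pow_left₀ (sq_nonneg _) h t) hw
        have := pow_nonneg (sq_nonneg (l k)) (t + 1)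
        linarith
    have h6 : l k ^ (2 * t) = (l k ^ 2) ^ t := pow_mul _ _ _
    have h7 : l k ^ (2 * t + 2) = (l k ^ 2) ^ (t + 1) := by rw [← pow_mul]; ring_nf
    rw [h6, h7]
    have h8 := mul_le_mul_of_nonneg_left (mul_le_mul_of_nonneg_right h3 h4) hc
    linarith
  refine (Finset.sum_le_sum fun k _ => h2 k).trans (le_of_eq ?_)
  rw [Finset.sum_add_distrib, ← Finset.sum_div, Finset.sum_const, nsmul_eq_mul, Finset.card_univ,
    mul_div_assoc]

/-- An even moment is a sum of non-negative powers of eigenvalues, so it dominates the largest of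
them. -/
theorem e2_mulVec_le_of_trace_pow {Y : Matrix m m ℝ} (hY : Y.IsHermitian) {η : ℝ} (hη : 0 ≤ η)
    {t : ℕ} (h : (Y ^ (2 * t + 2)).trace ≤ η ^ (2 * t + 2)) (f : m → ℝ) :
    e2 (Y *ᵥ f) ≤ η * e2 f := by
  obtain ⟨U, l, hU, hU', hl⟩ := exists_diagonalization hY
  have hiso : ∀ W : Matrix m m ℝ, Wᵀ * W = 1 → ∀ g, ∑ x, (W *ᵥ g) x ^ 2 = ∑ x, g x ^ 2 := by
    intro W hW g
    have h1 : (W *ᵥ g) ⬝ᵥ (W *ᵥ g) = g ⬝ᵥ g := by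
      rw [Matrix.dotProduct_mulVec, ← Matrix.mulVec_transpose, Matrix.mulVec_mulVec, hW,
        Matrix.one_mulVec]
    simpa only [dotProduct, ← sq] using h1
  have hev : Even (2 * t + 2) := ⟨t + 1, by ring⟩
  have hlη : ∀ k, l k ^ 2 ≤ η ^ 2 := by
    intro k
    rw [trace_pow_eq_sum hU (hl _)] at h
    have h1 := (Finset.single_le_sum (f := fun k => l k ^ (2 * t + 2))
      (fun i _ => hev.pow_nonneg _) (Finset.mem_univ k)).trans h
    have h2 : (l k ^ 2) ^ (t + 1) ≤ (η ^ 2) ^ (t + 1) := by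
      rw [← pow_mul, ← pow_mul]; exact h1
    exact le_of_pow_le_pow_left₀ (by omega) (sq_nonneg _) h2
  refine e2_le_of_sq_le (mul_nonneg hη (e2_nonneg f)) ?_
  have h1 := hl 1
  rw [pow_one] at h1
  rw [h1, ← Matrix.mulVec_mulVec, ← Matrix.mulVec_mulVec, hiso U hU, mul_pow, e2_sq,
    ← hiso Uᵀ (by rwa [Matrix.transpose_transpose]) f, Finset.mul_sum]
  refine Finset.sum_le_sum fun k _ => ?_
  rw [Matrix.mulVec_diagonal, pow_one, mul_pow]
  exact mul_le_mul_of_nonneg_right (hlη k) (sq_nonneg _)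

end Trace


/-! ### Trace moments of sums of independent symmetric matrices -/

section Moment

variable {I S m : Type*} [Fintype I] [DecidableEq I] [Fintype S] [Fintype m] [DecidableEq m]
  {p : I → S → ℝ}

theorem Ex_coord (hp : IsLaw p) (i : I) (g : S → ℝ) :
    Ex p (fun τ => g (τ i)) = ∑ s, p i s * g s := by
  have h := Ex_prod (p := p) fun j s => if j = i then g s else 1
  simpa [hp.sum_eq_one] using h

theorem Ex_trace_coord (hp : IsLaw p) (i : I) (F : S → Matrix m m ℝ) (B : Matrix m m ℝ) :
    Ex p (fun τ => (F (τ i) * B).trace) = ((∑ s, p i s • F s) * B).trace := by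
  rw [Ex_coord hp i fun s => (F s * B).trace, Finset.sum_mul, Matrix.trace_sum]
  simp only [Matrix.smul_mul, Matrix.trace_smul, smul_eq_mul]

/-- A form of the exchangeable pairs method for the trace moments of a random matrix. -/
theorem Ex_trace_mul_pow_le (hp : IsLaw p) {F : I → S → Matrix m m ℝ}
    (hF : ∀ i s, (F i s).IsHermitian) (h0 : ∀ i, ∑ s, p i s • F i s = 0) {q : ℕ} (hq : Even q)
    (i : I) :
    Ex p (fun τ => (F i (τ i) * (∑ j, F j (τ j)) ^ (q + 1)).trace)
      ≤ ((q + 1 : ℕ) : ℝ) * Ex p (fun τ =>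
        ((F i (τ i) ^ 2 + ∑ s, p i s • F i s ^ 2) * (∑ j, F j (τ j)) ^ q).trace) := by
  set Y : (I → S) → Matrix m m ℝ := fun τ => ∑ j, F j (τ j) with hYdef
  have hY : ∀ τ, (Y τ).IsHermitian := fun τ => by
    refine Matrix.IsHermitian.ext_iff.2 fun a b => ?_
    simp only [hYdef, Matrix.sum_apply, star_sum]
    exact Finset.sum_congr rfl fun j _ => (hF j (τ j)).apply a b
  have hdiff : ∀ τ τ' : I → S,
      Y τ - Y (({i} : Finset I).piecewise τ' τ) = F i (τ i) - F i (τ' i) := by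
    intro τ τ'
    simp only [hYdef, ← Finset.sum_sub_distrib]
    rw [Finset.sum_eq_single i]
    · simp
    · intro j _ hj; simp [hj]
    · simp
  set EE : ((I → S) → (I → S) → ℝ) → ℝ := fun G => Ex p fun τ => Ex p fun τ' => G τ τ' with hEE
  have hmono : ∀ G H : (I → S) → (I → S) → ℝ, (∀ τ τ', G τ τ' ≤ H τ τ') → EE G ≤ EE H :=
    fun G H h => hp.mono fun τ => hp.mono fun τ' => h τ τ'
  have hadd : ∀ G H : (I → S) → (I → S) → ℝ, EE (fun τ τ' => G τ τ' + H τ τ') = EE G + EE H := by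
    intro G H; simp only [hEE, Ex_add]
  have hmul : ∀ (c : ℝ) (G : (I → S) → (I → S) → ℝ), EE (fun τ τ' => c * G τ τ') = c * EE G := by
    intro c G; simp only [hEE, Ex_const_mul]
  -- Exchanging coordinate i between the sample and an independent copy preserves the joint law.
  -- Averaging G with `sw G` turns Y^(q+1) into a difference, to which the mean value trace
  -- inequality applies.
  let sw : ((I → S) → (I → S) → ℝ) → (I → S) → (I → S) → ℝ := fun G τ τ' =>
    G (({i} : Finset I).piecewise τ' τ) (({i} : Finset I).piecewise τ τ')
  have hsw : ∀ G, EE (sw G) = EE G := fun G => Ex_swap {i} G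
  let G : (I → S) → (I → S) → ℝ := fun τ τ' => ((F i (τ i) - F i (τ' i)) * Y τ ^ (q + 1)).trace
  let H : (I → S) → (I → S) → ℝ := fun τ τ' => ((F i (τ i) - F i (τ' i)) ^ 2 * Y τ ^ q).trace
  -- The subtracted copy is centred and independent of Y, so it contributes nothing.
  have e1 : EE G = Ex p (fun τ => (F i (τ i) * Y τ ^ (q + 1)).trace) := by
    simp only [hEE, G, Matrix.sub_mul, Matrix.trace_sub, Ex_sub, hp.Ex_const]
    have : ∀ τ, Ex p (fun τ' => (F i (τ' i) * Y τ ^ (q + 1)).trace) = 0 := by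
      intro τ
      rw [Ex_trace_coord hp i (F i), h0]; simp
    simp only [this, hp.Ex_const, sub_zero]
  have e2 : ∀ τ τ', G τ τ' + sw G τ τ' ≤ ((q + 1 : ℕ) : ℝ) / 2 * (H τ τ' + sw H τ τ') := by
    intro τ τ'
    have h1 := trace_sub_mul_pow_sub_pow_le (hY τ)
      (hY (({i} : Finset I).piecewise τ' τ)) hq
    rw [hdiff] at h1
    have e3 : G τ τ' + sw G τ τ' = ((F i (τ i) - F i (τ' i))
        * (Y τ ^ (q + 1) - Y (({i} : Finset I).piecewise τ' τ) ^ (q + 1))).trace := by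
      simp only [G, sw, Finset.piecewise_singleton, Function.update_self]
      rw [← Matrix.trace_add]
      congr 1
      noncomm_ring
    have e4 : H τ τ' + sw H τ τ' = ((F i (τ i) - F i (τ' i)) ^ 2
        * (Y τ ^ q + Y (({i} : Finset I).piecewise τ' τ) ^ q)).trace := by
      simp only [H, sw, Finset.piecewise_singleton, Function.update_self]
      rw [← Matrix.trace_add]
      congr 1
      noncomm_ring
    rwa [e3, e4]
  have h2 := hmono _ _ e2
  rw [hadd, hmul, hadd] at h2
  change EE G + EE (sw G) ≤ ((q + 1 : ℕ) : ℝ) / 2 * (EE H + EE (sw H)) at h2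
  rw [hsw G, hsw H] at h2
  have h3 : EE H ≤ 2 * Ex p (fun τ =>
      ((F i (τ i) ^ 2 + ∑ s, p i s • F i s ^ 2) * Y τ ^ q).trace) := by
    refine (hmono _ _ fun τ τ' => trace_sub_sq_mul_pow_le (hF i (τ i)) (hF i (τ' i)) (hY τ) hq).trans
      (le_of_eq ?_)
    rw [hmul]
    simp only [hEE, Matrix.add_mul, Matrix.trace_add, Ex_add, hp.Ex_const,
      Ex_trace_coord hp i fun s => F i s ^ 2]
  rw [← e1]
  have h4 : (0 : ℝ) ≤ ((q + 1 : ℕ) : ℝ) := Nat.cast_nonneg _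
  nlinarith [mul_le_mul_of_nonneg_left h3 h4]

theorem dotProduct_sq_mulVec {A : Matrix m m ℝ} (hA : A.IsHermitian) (f : m → ℝ) :
    f ⬝ᵥ (A ^ 2 *ᵥ f) = ∑ x, (A *ᵥ f) x ^ 2 := by
  have h : Aᵀ = A := by
    rw [← Matrix.conjTranspose_eq_transpose_of_trivial]; exact hA
  rw [sq, ← Matrix.mulVec_mulVec, Matrix.dotProduct_mulVec, ← Matrix.mulVec_transpose, h]
  simp only [dotProduct, sq]

/-- A moment inequality for sums of independent centred symmetric matrices. -/
theorem Ex_trace_pow_le (hp : IsLaw p) {F : I → S → Matrix m m ℝ}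
    (hF : ∀ i s, (F i s).IsHermitian) (h0 : ∀ i, ∑ s, p i s • F i s = 0) {v : (I → S) → ℝ}
    (hv0 : ∀ τ, 0 ≤ v τ)
    (hv : ∀ τ, ∀ f : m → ℝ, ∑ i, (∑ x, (F i (τ i) *ᵥ f) x ^ 2
      + ∑ s, p i s * ∑ x, (F i s *ᵥ f) x ^ 2) ≤ v τ * ∑ x, f x ^ 2) (t : ℕ) :
    Ex p (fun τ => ((∑ i, F i (τ i)) ^ (2 * t + 2)).trace)
      ≤ Fintype.card m * Ex p (fun τ => (2 * (2 * t + 1) * v τ) ^ (t + 1)) := by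
  set Y : (I → S) → Matrix m m ℝ := fun τ => ∑ j, F j (τ j) with hYdef
  have hY : ∀ τ, (Y τ).IsHermitian := fun τ => by
    refine Matrix.IsHermitian.ext_iff.2 fun a b => ?_
    simp only [hYdef, Matrix.sum_apply, star_sum]
    exact Finset.sum_congr rfl fun j _ => (hF j (τ j)).apply a b
  have h1 : Ex p (fun τ => (Y τ ^ (2 * t + 2)).trace)
      = ∑ i, Ex p (fun τ => (F i (τ i) * Y τ ^ (2 * t + 1)).trace) := by
    rw [← Ex_sum]
    congr 1
    ext τ
    rw [← Matrix.trace_sum, ← Finset.sum_mul, pow_succ' _ (2 * t + 1)]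
  have hq : Even (2 * t) := even_two_mul t
  let V : (I → S) → Matrix m m ℝ := fun τ => ∑ i, (F i (τ i) ^ 2 + ∑ s, p i s • F i s ^ 2)
  have hV : ∀ τ f, f ⬝ᵥ (V τ *ᵥ f) ≤ v τ * (f ⬝ᵥ f) := by
    intro τ f
    have e : f ⬝ᵥ (V τ *ᵥ f) = ∑ i, (∑ x, (F i (τ i) *ᵥ f) x ^ 2
      + ∑ s, p i s * ∑ x, (F i s *ᵥ f) x ^ 2) := by
      simp only [V, Matrix.sum_mulVec, dotProduct_sum, Matrix.add_mulVec, dotProduct_add,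
        dotProduct_sq_mulVec (hF _ _), Matrix.smul_mulVec, dotProduct_smul, smul_eq_mul]
    have e2 : f ⬝ᵥ f = ∑ x, f x ^ 2 := by simp only [dotProduct, sq]
    rw [e, e2]; exact hv τ f
  have h2 : Ex p (fun τ => (Y τ ^ (2 * t + 2)).trace)
      ≤ Ex p (fun τ => ((2 * t + 1 : ℕ) : ℝ) * (V τ * Y τ ^ (2 * t)).trace) := by
    rw [h1, Ex_const_mul]
    refine (Finset.sum_le_sum fun i _ => Ex_trace_mul_pow_le hp hF h0 hq i).trans (le_of_eq ?_)
    rw [← Finset.mul_sum, ← Ex_sum]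
    simp only [V, Finset.sum_mul, Matrix.trace_sum, hYdef]
  -- Half of the trace moment reappears on the right with constant c = 2t + 1, and is moved to the
  -- left at the end. The variance bound `v` may depend on the sample, which is essential here
  -- because the column sums of the empirical kernel are random.
  have h3 := h2.trans (hp.mono fun τ => mul_trace_mul_pow_le (hY τ) (hv0 τ) (hV τ)
    (Nat.cast_nonneg (2 * t + 1)) t)
  have e : ∀ τ, (Y τ ^ (2 * t + 2)).trace / 2
      + Fintype.card m * (2 * ((2 * t + 1 : ℕ) : ℝ) * v τ) ^ (t + 1) / 2
      = (1 / 2) * (Y τ ^ (2 * t + 2)).trace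
        + (Fintype.card m / 2) * (2 * (2 * t + 1) * v τ) ^ (t + 1) := by
    intro τ; push_cast; ring
  simp only [e] at h3
  rw [Ex_add, Ex_const_mul, Ex_const_mul] at h3
  linarith

end Moment


/-! ### The operator norm of an empirical kernel -/

section Empirical

variable {X S : Type*} [Fintype X] [DecidableEq X] [Fintype S] {a : S → X → ℝ} {P : X → S → ℝ}
  {Z : X → ℕ}

/-- A family of probability vectors on `X`. -/
structure IsKernel {S X : Type*} [Fintype X] (a : S → X → ℝ) : Prop where
  nonneg : ∀ s y, 0 ≤ a s y
  sum_eq_one : ∀ s, ∑ y, a s y = 1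

/-- The composition of the kernels `P` and `a`. -/
def compKernel (P : X → S → ℝ) (a : S → X → ℝ) : Matrix X X ℝ :=
  Matrix.of fun x y => ∑ s, P x s * a s y

/-- The empirical version of `compKernel`. -/
noncomputable def empKernel (a : S → X → ℝ) (τ : (Σ x, Fin (Z x)) → S) : Matrix X X ℝ :=
  Matrix.of fun x y => (∑ j, a (τ ⟨x, j⟩) y) / Z x

theorem IsKernel.le_one (ha : IsKernel a) (s : S) (y : X) : a s y ≤ 1 := by
  rw [← ha.sum_eq_one s]
  exact Finset.single_le_sum (fun y _ => ha.nonneg s y) (Finset.mem_univ y)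

theorem IsKernel.sq_dot_le (ha : IsKernel a) (s : S) (g : X → ℝ) :
    (∑ y, a s y * g y) ^ 2 ≤ ∑ y, a s y * g y ^ 2 := by
  have h1 := Finset.sum_sq_le_sum_mul_sum_of_sq_le_mul Finset.univ (r := fun y => a s y * g y)
    (f := fun y => a s y) (g := fun y => a s y * g y ^ 2) (fun y _ => ha.nonneg s y)
    (fun y _ => mul_nonneg (ha.nonneg s y) (sq_nonneg _))
    (fun y _ => by rw [mul_pow]; exact le_of_eq (by ring))
  rwa [ha.sum_eq_one, one_mul] at h1

theorem IsKernel.law {S X : Type*} [Fintype S] {P : X → S → ℝ} (hP : IsKernel P) {Z : X → ℕ} :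
    IsLaw fun (i : Σ x, Fin (Z x)) s => P i.1 s :=
  ⟨fun i => hP.nonneg i.1, fun i => hP.sum_eq_one i.1⟩

theorem compKernel_isKernel (hP : IsKernel P) (ha : IsKernel a) : IsKernel (compKernel P a) := by
  refine ⟨fun x y => Finset.sum_nonneg fun s _ => mul_nonneg (hP.nonneg x s) (ha.nonneg s y),
    fun x => ?_⟩
  simp only [compKernel, Matrix.of_apply]
  rw [Finset.sum_comm]
  simp only [← Finset.mul_sum, ha.sum_eq_one, mul_one, hP.sum_eq_one]

theorem empKernel_isKernel (ha : IsKernel a) (hZ : ∀ x, 0 < Z x) (τ : (Σ x, Fin (Z x)) → S) :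
    IsKernel (empKernel a τ) := by
  refine ⟨fun x y => div_nonneg (Finset.sum_nonneg fun s _ => ha.nonneg _ y) (Nat.cast_nonneg _),
    fun x => ?_⟩
  simp only [empKernel, Matrix.of_apply]
  rw [← Finset.sum_div, Finset.sum_comm]
  simp only [ha.sum_eq_one]
  have : (Z x : ℝ) ≠ 0 := by exact_mod_cast (hZ x).ne'
  simp [this]

theorem sum_sub_sq_le {b c : X → ℝ} (hb : ∀ y, 0 ≤ b y) (hb1 : ∀ y, b y ≤ 1) (hc : ∀ y, 0 ≤ c y)
    (hc1 : ∀ y, c y ≤ 1) (hbs : ∑ y, b y = 1) (hcs : ∑ y, c y = 1) :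
    ∑ y, (b y - c y) ^ 2 ≤ 2 := by
  calc ∑ y, (b y - c y) ^ 2 ≤ ∑ y, (b y + c y) := Finset.sum_le_sum fun y _ => by
        nlinarith [hb y, hb1 y, hc y, hc1 y, mul_nonneg (hb y) (hc y),
          mul_nonneg (hb y) (sub_nonneg.2 (hb1 y)), mul_nonneg (hc y) (sub_nonneg.2 (hc1 y))]
    _ = 2 := by rw [Finset.sum_add_distrib, hbs, hcs]; norm_num

/-- The centred contribution of one observation. -/
noncomputable def contrib (P : X → S → ℝ) (a : S → X → ℝ) (i : Σ x, Fin (Z x)) (s : S) : X → ℝ :=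
  fun y => (a s y - compKernel P a i.1 y) / Z i.1

/-- The Hermitian dilation of the centred contribution of one observation. -/
noncomputable def dilation (P : X → S → ℝ) (a : S → X → ℝ) (i : Σ x, Fin (Z x)) (s : S) :
    Matrix (X ⊕ X) (X ⊕ X) ℝ :=
  Matrix.fromBlocks 0 (Matrix.vecMulVec (Pi.single i.1 1) (contrib P a i s))
    (Matrix.vecMulVec (contrib P a i s) (Pi.single i.1 1)) 0

theorem dilation_isHermitian (i : Σ x, Fin (Z x)) (s : S) : (dilation P a i s).IsHermitian := by
  refine Matrix.IsHermitian.ext fun x y => ?_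
  rcases x with x | x <;> rcases y with y | y <;> simp [dilation, Matrix.vecMulVec, mul_comm]

theorem sum_contrib (hP : IsKernel P) (i : Σ x, Fin (Z x)) (y : X) :
    ∑ s, P i.1 s * contrib P a i s y = 0 := by
  have h : ∀ s, P i.1 s * contrib P a i s y
      = (P i.1 s * a s y) / Z i.1 - P i.1 s * (compKernel P a i.1 y / Z i.1) := fun s => by
    rw [contrib]; ring
  simp only [h, Finset.sum_sub_distrib, ← Finset.sum_div, ← Finset.sum_mul, hP.sum_eq_one]
  simp [compKernel]

theorem sum_dilation_zero (hP : IsKernel P) (i : Σ x, Fin (Z x)) :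
    ∑ s, P i.1 s • dilation P a i s = 0 := by
  have h := sum_contrib (a := a) hP i
  ext x y
  simp only [Matrix.sum_apply, Matrix.smul_apply, smul_eq_mul, Matrix.zero_apply]
  rcases x with x | x <;> rcases y with y | y
  · simp [dilation]
  · simp only [dilation, Matrix.fromBlocks_apply₁₂, Matrix.vecMulVec_apply, mul_left_comm (P i.1 _),
      ← Finset.mul_sum, h, mul_zero]
  · simp only [dilation, Matrix.fromBlocks_apply₂₁, Matrix.vecMulVec_apply, ← mul_assoc,
      ← Finset.sum_mul, h, zero_mul]
  · simp [dilation]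

theorem sum_sigma_single (Z : X → ℕ) (g : (Σ x, Fin (Z x)) → ℝ) (x : X) :
    ∑ i : Σ x, Fin (Z x), (Pi.single i.1 1 : X → ℝ) x * g i = ∑ j, g ⟨x, j⟩ := by
  rw [Fintype.sum_sigma, Finset.sum_eq_single x]
  · simp
  · intro y _ hy; simp [hy.symm]
  · simp

theorem sum_contrib_eq (hZ : ∀ x, 0 < Z x) (τ : (Σ x, Fin (Z x)) → S) (x y : X) :
    ∑ j, contrib P a ⟨x, j⟩ (τ ⟨x, j⟩) y = (empKernel a τ - compKernel P a) x y := by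
  have : (Z x : ℝ) ≠ 0 := by exact_mod_cast (hZ x).ne'
  simp only [contrib, sub_div, Finset.sum_sub_distrib, Matrix.sub_apply, empKernel, Matrix.of_apply,
    Finset.sum_div]
  simp
  field_simp

theorem sum_dilation_eq (hZ : ∀ x, 0 < Z x) (τ : (Σ x, Fin (Z x)) → S) :
    ∑ i, dilation P a i (τ i) = Matrix.fromBlocks 0 (empKernel a τ - compKernel P a)
      (empKernel a τ - compKernel P a)ᵀ 0 := by
  ext x y
  rw [Matrix.sum_apply]
  rcases x with x | x <;> rcases y with y | y
  · simp [dilation]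
  · simp only [dilation, Matrix.fromBlocks_apply₁₂, Matrix.vecMulVec_apply]
    rw [sum_sigma_single Z (fun i => contrib P a i (τ i) y), sum_contrib_eq hZ]
  · simp only [dilation, Matrix.fromBlocks_apply₂₁, Matrix.vecMulVec_apply, mul_comm (contrib P a _ _ x)]
    rw [sum_sigma_single Z (fun i => contrib P a i (τ i) x), sum_contrib_eq hZ,
      Matrix.transpose_apply]
  · simp [dilation]

/-- The dilation has rank at most two, so the norm splits into a pairing with the contribution and
its squared length. Jensen's inequality bounds the pairing by averages of f² under the kernels, so
that summing over observations yields column sums and no dimension. -/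
theorem sum_dilation_mulVec_sq_le (hP : IsKernel P) (ha : IsKernel a) (i : Σ x, Fin (Z x)) (s : S)
    (f : X ⊕ X → ℝ) :
    ∑ x, (dilation P a i s *ᵥ f) x ^ 2 ≤ 2 / (Z i.1 : ℝ) ^ 2 *
      (∑ y, (a s y + compKernel P a i.1 y) * f (Sum.inr y) ^ 2 + f (Sum.inl i.1) ^ 2) := by
  have hQ := compKernel_isKernel hP ha
  set c := contrib P a i s with hc
  have e : ∑ x, (dilation P a i s *ᵥ f) x ^ 2
      = (∑ y, c y * f (Sum.inr y)) ^ 2 + f (Sum.inl i.1) ^ 2 * ∑ y, c y ^ 2 := by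
    rw [dilation, Matrix.fromBlocks_mulVec, Fintype.sum_sum_type]
    simp only [Sum.elim_inl, Sum.elim_inr, Matrix.zero_mulVec, zero_add, add_zero,
      Matrix.vecMulVec_mulVec]
    congr 1
    · rw [Finset.sum_eq_single i.1]
      · simp [dotProduct, hc]
      · intro y _ hy; simp [hy]
      · simp
    · rw [Finset.mul_sum]
      refine Finset.sum_congr rfl fun y _ => ?_
      simp [hc]
      ring
  rw [e]
  have h1 : (∑ y, c y * f (Sum.inr y)) ^ 2 ≤ 2 / (Z i.1 : ℝ) ^ 2 *
      ∑ y, (a s y + compKernel P a i.1 y) * f (Sum.inr y) ^ 2 := by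
    have e2 : ∑ y, c y * f (Sum.inr y) = (∑ y, a s y * f (Sum.inr y)
        - ∑ y, compKernel P a i.1 y * f (Sum.inr y)) / Z i.1 := by
      rw [← Finset.sum_sub_distrib, Finset.sum_div]
      exact Finset.sum_congr rfl fun y _ => by rw [hc, contrib]; ring
    have h2 := ha.sq_dot_le s fun y => f (Sum.inr y)
    have h3 := hQ.sq_dot_le i.1 fun y => f (Sum.inr y)
    rw [e2, div_pow, div_mul_eq_mul_div]
    refine div_le_div_of_nonneg_right ?_ (sq_nonneg _)
    simp only [add_mul, Finset.sum_add_distrib]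
    nlinarith [sq_nonneg (∑ y, a s y * f (Sum.inr y) + ∑ y, compKernel P a i.1 y * f (Sum.inr y))]
  have h2 : ∑ y, c y ^ 2 ≤ 2 / (Z i.1 : ℝ) ^ 2 := by
    have e2 : ∑ y, c y ^ 2 = (∑ y, (a s y - compKernel P a i.1 y) ^ 2) / (Z i.1 : ℝ) ^ 2 := by
      rw [Finset.sum_div]
      exact Finset.sum_congr rfl fun y _ => by rw [hc, contrib, div_pow]
    rw [e2]
    exact div_le_div_of_nonneg_right (sum_sub_sq_le (ha.nonneg s) (ha.le_one s) (hQ.nonneg i.1)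
      (hQ.le_one i.1) (ha.sum_eq_one s) (hQ.sum_eq_one i.1)) (sq_nonneg _)
  have h3 := mul_le_mul_of_nonneg_left h2 (sq_nonneg (f (Sum.inl i.1)))
  linarith

/-- The matrix variance of the empirical kernel. -/
theorem sum_variance_le (hP : IsKernel P) (ha : IsKernel a) {N κ c : ℝ} (hN : 0 < N)
    (hZN : ∀ x, N ≤ Z x) (hκ : 1 ≤ κ) (hcol : ∀ y, ∑ x, compKernel P a x y ≤ κ)
    (τ : (Σ x, Fin (Z x)) → S) (hc0 : 0 ≤ c) (hc : ∀ y, ∑ x, empKernel a τ x y ≤ c)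
    (f : X ⊕ X → ℝ) :
    ∑ i, (∑ x, (dilation P a i (τ i) *ᵥ f) x ^ 2
      + ∑ s, P i.1 s * ∑ x, (dilation P a i s *ᵥ f) x ^ 2)
      ≤ 2 / N * (5 * κ + c) * ∑ x, f x ^ 2 := by
  have hZ0 : ∀ x, (0 : ℝ) < Z x := fun x => hN.trans_le (hZN x)
  set Q := compKernel P a with hQdef
  have hQ : IsKernel Q := compKernel_isKernel hP ha
  have hE : IsKernel (empKernel a τ) :=
    empKernel_isKernel ha (fun x => by exact_mod_cast hZ0 x) τ
  set A : X → ℝ := fun x => ∑ y, (empKernel a τ x y + 3 * Q x y) * f (Sum.inr y) ^ 2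
    + 2 * f (Sum.inl x) ^ 2 with hA
  have h1 : ∀ i : Σ x, Fin (Z x), ∑ x, (dilation P a i (τ i) *ᵥ f) x ^ 2
      + ∑ s, P i.1 s * ∑ x, (dilation P a i s *ᵥ f) x ^ 2
      ≤ 2 / (Z i.1 : ℝ) ^ 2 * (∑ y, (a (τ i) y + 3 * Q i.1 y) * f (Sum.inr y) ^ 2
        + 2 * f (Sum.inl i.1) ^ 2) := by
    intro i
    have h2 := sum_dilation_mulVec_sq_le hP ha i (τ i) f
    have h3 : ∑ s, P i.1 s * ∑ x, (dilation P a i s *ᵥ f) x ^ 2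
        ≤ 2 / (Z i.1 : ℝ) ^ 2 * (∑ y, (2 * Q i.1 y) * f (Sum.inr y) ^ 2 + f (Sum.inl i.1) ^ 2) := by
      refine (Finset.sum_le_sum fun s _ => mul_le_mul_of_nonneg_left
        (sum_dilation_mulVec_sq_le hP ha i s f) (hP.nonneg i.1 s)).trans (le_of_eq ?_)
      simp only [mul_left_comm (P i.1 _), ← Finset.mul_sum, mul_add, Finset.sum_add_distrib,
        ← Finset.sum_mul, hP.sum_eq_one, one_mul]
      congr 2
      simp only [Finset.mul_sum]
      rw [Finset.sum_comm]
      refine Finset.sum_congr rfl fun y _ => ?_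
      simp only [add_mul, mul_add, Finset.sum_add_distrib, ← mul_assoc, ← Finset.sum_mul,
        hP.sum_eq_one, one_mul]
      have e3 : ∑ s, P i.1 s * a s y = Q i.1 y := rfl
      rw [e3]
      ring
    refine (add_le_add h2 h3).trans (le_of_eq ?_)
    rw [← mul_add]
    congr 1
    simp only [add_mul, Finset.sum_add_distrib, mul_assoc, ← Finset.mul_sum]
    ring
  have h2 : ∑ i : Σ x, Fin (Z x), 2 / (Z i.1 : ℝ) ^ 2 *
      (∑ y, (a (τ i) y + 3 * Q i.1 y) * f (Sum.inr y) ^ 2 + 2 * f (Sum.inl i.1) ^ 2)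
      = ∑ x, 2 / (Z x : ℝ) * A x := by
    rw [Fintype.sum_sigma]
    refine Finset.sum_congr rfl fun x _ => ?_
    have hz := (hZ0 x).ne'
    simp only [hA, ← Finset.mul_sum, Finset.sum_add_distrib, add_mul, Finset.sum_const,
      Finset.card_univ, Fintype.card_fin, nsmul_eq_mul]
    rw [Finset.sum_comm]
    have e3 : ∑ y, ∑ j, a (τ ⟨x, j⟩) y * f (Sum.inr y) ^ 2
        = Z x * ∑ y, empKernel a τ x y * f (Sum.inr y) ^ 2 := by
      rw [Finset.mul_sum]
      refine Finset.sum_congr rfl fun y _ => ?_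
      rw [← Finset.sum_mul, empKernel, Matrix.of_apply]
      field_simp
    rw [e3]
    field_simp
  have hA0 : ∀ x, 0 ≤ A x := fun x => add_nonneg (Finset.sum_nonneg fun y _ => mul_nonneg
    (add_nonneg (hE.nonneg x y) (mul_nonneg (by norm_num) (hQ.nonneg x y))) (sq_nonneg _))
    (mul_nonneg (by norm_num) (sq_nonneg _))
  have h3 : ∑ x, 2 / (Z x : ℝ) * A x ≤ 2 / N * ∑ x, A x := by
    rw [Finset.mul_sum]
    refine Finset.sum_le_sum fun x _ => mul_le_mul_of_nonneg_right ?_ (hA0 x)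
    exact div_le_div_of_nonneg_left (by norm_num) hN (hZN x)
  have h4 : ∑ x, A x ≤ (5 * κ + c) * ∑ x, f x ^ 2 := by
    rw [Fintype.sum_sum_type, hA, Finset.sum_add_distrib, Finset.sum_comm, mul_add,
      Finset.mul_sum, Finset.mul_sum, add_comm]
    refine add_le_add (Finset.sum_le_sum fun x _ => ?_) (Finset.sum_le_sum fun y _ => ?_)
    · exact mul_le_mul_of_nonneg_right (by linarith) (sq_nonneg _)
    · rw [← Finset.sum_mul]
      refine mul_le_mul_of_nonneg_right ?_ (sq_nonneg _)
      rw [Finset.sum_add_distrib, ← Finset.mul_sum]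
      linarith [hc y, hcol y]
  calc _ ≤ _ := Finset.sum_le_sum fun i _ => h1 i
    _ = _ := h2
    _ ≤ 2 / N * ∑ x, A x := h3
    _ ≤ 2 / N * ((5 * κ + c) * ∑ x, f x ^ 2) := mul_le_mul_of_nonneg_left h4 (by positivity)
    _ = _ := by ring

theorem col_empKernel (τ : (Σ x, Fin (Z x)) → S) (b : X → ℝ) (y : X) :
    ∑ x, b x * empKernel a τ x y = ∑ i : Σ x, Fin (Z x), b i.1 * (a (τ i) y / Z i.1) := by
  rw [Fintype.sum_sigma]
  refine Finset.sum_congr rfl fun x _ => ?_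
  rw [empKernel, Matrix.of_apply, Finset.sum_div, Finset.mul_sum]

theorem sum_sum_col (hZ : ∀ x, 0 < Z x) (b : X → ℝ) (y : X) :
    ∑ i : Σ x, Fin (Z x), ∑ s, P i.1 s * (b i.1 * (a s y / Z i.1))
      = ∑ x, b x * compKernel P a x y := by
  rw [Fintype.sum_sigma]
  refine Finset.sum_congr rfl fun x _ => ?_
  have : (Z x : ℝ) ≠ 0 := by exact_mod_cast (hZ x).ne'
  change ∑ _j : Fin (Z x), ∑ s, P x s * (b x * (a s y / Z x)) = _
  rw [Finset.sum_const, Finset.card_univ, Fintype.card_fin, nsmul_eq_mul, compKernel,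
    Matrix.of_apply, Finset.mul_sum, Finset.mul_sum]
  refine Finset.sum_congr rfl fun s _ => ?_
  field_simp

/-- The empirical kernel is close to the kernel in operator norm. -/
theorem pr_not_e2_le [Nonempty X] (hP : IsKernel P) (ha : IsKernel a) {N κ η : ℝ} (hN : 0 < N)
    (hZN : ∀ x, N ≤ Z x) (hκ : 1 ≤ κ) (hcol : ∀ y, ∑ x, compKernel P a x y ≤ κ) (hη : 0 < η)
    (t : ℕ) (ht : (t : ℝ) + 1 ≤ N) :
    pr (fun (i : Σ x, Fin (Z x)) s => P i.1 s)
      (fun τ => ¬ ∀ f, e2 ((empKernel a τ - compKernel P a) *ᵥ f) ≤ η * e2 f)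
      ≤ 2 * (Fintype.card X : ℝ) ^ 2
        * (40 * κ * Real.exp (2 * κ) * (t + 1) / (N * η ^ 2)) ^ (t + 1) := by
  classical
  have hp : IsLaw fun (i : Σ x, Fin (Z x)) s => P i.1 s := hP.law
  have hZ0 : ∀ x, 0 < Z x := fun x => by exact_mod_cast hN.trans_le (hZN x)
  have hκ0 : 0 < κ := by linarith
  have ht0 : (0 : ℝ) < (t : ℝ) + 1 := by positivity
  let col : ((Σ x, Fin (Z x)) → S) → X → ℝ := fun τ y => ∑ x, empKernel a τ x y
  let c : ((Σ x, Fin (Z x)) → S) → ℝ := fun τ => ⨆ y, col τ y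
  have hcolc : ∀ τ y, col τ y ≤ c τ := fun τ y => le_ciSup (Set.finite_range _).bddAbove y
  have hcol0 : ∀ τ y, 0 ≤ col τ y := fun τ y =>
    Finset.sum_nonneg fun x _ => (empKernel_isKernel ha hZ0 τ).nonneg x y
  have hc0 : ∀ τ, 0 ≤ c τ := fun τ =>
    (hcol0 τ (Classical.arbitrary X)).trans (hcolc τ (Classical.arbitrary X))
  have hmom := Ex_trace_pow_le hp (F := dilation P a) dilation_isHermitian
    (fun i => sum_dilation_zero hP i) (v := fun τ => 2 / N * (5 * κ + c τ))
    (fun τ => mul_nonneg (by positivity) (add_nonneg (by positivity) (hc0 τ)))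
    (fun τ f => sum_variance_le hP ha hN hZN hκ hcol τ (hc0 τ) (hcolc τ) f) t
  -- A column sum adds independent terms in [0, 1/N] with mean at most κ and second moments at most
  -- κ/N. The condition t + 1 ≤ N allows the exponent t + 1 in Bernstein's bound, giving (t+1)κ +
  -- (t+1)²κ/N ≤ 2κ(t+1).
  have hexp : ∀ y, Ex (fun (i : Σ x, Fin (Z x)) s => P i.1 s)
      (fun τ => Real.exp ((t + 1) * col τ y)) ≤ Real.exp (2 * κ) ^ (t + 1) := by
    intro y
    have hf : ∀ (i : Σ x, Fin (Z x)) (s : S), |(1 : ℝ) * (a s y / Z i.1)| ≤ 1 / N := by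
      intro i s
      rw [one_mul, abs_of_nonneg (div_nonneg (ha.nonneg s y) (Nat.cast_nonneg _))]
      exact div_le_div₀ zero_le_one (ha.le_one s y) hN (hZN _)
    have hm := sum_sum_col (a := a) (P := P) hZ0 (fun _ => 1) y
    simp only [one_mul] at hm hf
    have hmκ := hcol y
    have hv : ∑ i : Σ x, Fin (Z x), ∑ s, P i.1 s * (a s y / Z i.1) ^ 2
        ≤ 1 / N * ∑ x, compKernel P a x y := by
      rw [← hm, Finset.mul_sum]
      refine Finset.sum_le_sum fun i _ => ?_
      rw [Finset.mul_sum]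
      refine Finset.sum_le_sum fun s _ => ?_
      have h0 : 0 ≤ a s y / Z i.1 := div_nonneg (ha.nonneg s y) (Nat.cast_nonneg _)
      have h1 := (le_abs_self _).trans (hf i s)
      rw [sq]
      nlinarith [mul_le_mul_of_nonneg_left (mul_le_mul_of_nonneg_right h1 h0) (hP.nonneg i.1 s)]
    have h1 := hp.Ex_exp_le (f := fun i s => a s y / Z i.1) (h := 1 / N) ht0.le hf
      (by rw [mul_one_div, div_le_one hN]; exact ht) hv hm
    have e : ∀ τ : (Σ x, Fin (Z x)) → S, col τ y = ∑ i, a (τ i) y / Z i.1 := by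
      intro τ
      have := col_empKernel (a := a) τ (fun _ => 1) y
      simpa only [one_mul] using this
    simp only [e]
    refine h1.trans ?_
    rw [← Real.exp_nat_mul]
    refine Real.exp_le_exp.2 ?_
    push_cast
    set M := ∑ x, compKernel P a x y
    have hM0 : 0 ≤ M := Finset.sum_nonneg fun x _ => (compKernel_isKernel hP ha).nonneg x y
    have h2 : ((t : ℝ) + 1) ^ 2 * (1 / N * M) ≤ ((t : ℝ) + 1) * M := by
      have h3 : ((t : ℝ) + 1) * (1 / N) ≤ 1 := by rw [mul_one_div, div_le_one hN]; exact ht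
      nlinarith [mul_le_mul_of_nonneg_right h3 (mul_nonneg ht0.le hM0)]
    nlinarith
  set B : ℝ := 40 * κ * (t + 1) / N with hB
  have hB0 : 0 ≤ B := by positivity
  -- The random variance is linear in the largest column sum c, and 5κ + c ≤ 5κ eᶜ turns its power
  -- into an exponential moment. The maximum over columns is replaced by a sum, which costs one
  -- factor n; the other factor 2n is the size of the dilation.
  have hpt : ∀ τ, (2 * (2 * t + 1) * (2 / N * (5 * κ + c τ))) ^ (t + 1)
      ≤ B ^ (t + 1) * ∑ y, Real.exp ((t + 1) * col τ y) := by
    intro τ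
    have h1 : 2 * (2 * t + 1) * (2 / N * (5 * κ + c τ)) ≤ B * Real.exp (c τ) := by
      have h2 : 5 * κ + c τ ≤ 5 * κ * Real.exp (c τ) := by
        have h3 := Real.add_one_le_exp (c τ)
        nlinarith [hc0 τ]
      have h4 : 0 ≤ 5 * κ + c τ := add_nonneg (by positivity) (hc0 τ)
      calc 2 * (2 * t + 1) * (2 / N * (5 * κ + c τ))
          ≤ 2 * (2 * (t + 1)) * (2 / N * (5 * κ * Real.exp (c τ))) := by
            gcongr
            linarith
        _ = B * Real.exp (c τ) := by rw [hB]; ring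
    obtain ⟨y, hy⟩ := exists_eq_ciSup_of_finite (f := col τ)
    calc _ ≤ (B * Real.exp (c τ)) ^ (t + 1) :=
          pow_le_pow_left₀ (mul_nonneg (by positivity) (mul_nonneg (by positivity)
            (add_nonneg (by positivity) (hc0 τ)))) h1 _
      _ = B ^ (t + 1) * Real.exp ((t + 1) * col τ y) := by
          rw [mul_pow, ← Real.exp_nat_mul, hy]; push_cast; rfl
      _ ≤ _ := mul_le_mul_of_nonneg_left (Finset.single_le_sum
          (f := fun y => Real.exp ((t + 1) * col τ y)) (fun _ _ => Real.exp_nonneg _)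
          (Finset.mem_univ y)) (pow_nonneg hB0 _)
  have hmom2 := hmom.trans (mul_le_mul_of_nonneg_left (hp.mono hpt) (Nat.cast_nonneg _))
  rw [Ex_const_mul, Ex_sum] at hmom2
  have hmom3 : Ex (fun (i : Σ x, Fin (Z x)) s => P i.1 s)
      (fun τ => ((∑ i, dilation P a i (τ i)) ^ (2 * t + 2)).trace)
      ≤ 2 * (Fintype.card X : ℝ) ^ 2 * (B * Real.exp (2 * κ)) ^ (t + 1) := by
    refine hmom2.trans ?_
    have h1 : ∑ y : X, Ex (fun (i : Σ x, Fin (Z x)) s => P i.1 s)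
        (fun τ => Real.exp ((t + 1) * col τ y)) ≤ Fintype.card X * Real.exp (2 * κ) ^ (t + 1) := by
      refine (Finset.sum_le_sum fun y _ => hexp y).trans (le_of_eq ?_)
      simp
    rw [Fintype.card_sum]
    push_cast
    calc _ ≤ ((Fintype.card X : ℝ) + Fintype.card X)
          * (B ^ (t + 1) * (Fintype.card X * Real.exp (2 * κ) ^ (t + 1))) := by gcongr
      _ = _ := by rw [mul_pow]; ring
  have hherm : ∀ τ : (Σ x, Fin (Z x)) → S, (∑ i, dilation P a i (τ i)).IsHermitian := fun τ => by
    rw [Matrix.IsHermitian, Matrix.conjTranspose_sum]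
    exact Finset.sum_congr rfl fun i _ => dilation_isHermitian i (τ i)
  have hev : Even (2 * t + 2) := ⟨t + 1, by ring⟩
  have hbad : pr (fun (i : Σ x, Fin (Z x)) s => P i.1 s)
      (fun τ => ¬ ∀ f, e2 ((empKernel a τ - compKernel P a) *ᵥ f) ≤ η * e2 f)
      ≤ Ex (fun (i : Σ x, Fin (Z x)) s => P i.1 s) (fun τ => (η ^ (2 * t + 2))⁻¹ *
        ((∑ i, dilation P a i (τ i)) ^ (2 * t + 2)).trace) := by
    refine hp.pr_le_Ex (fun τ => ?_) fun τ hτ => ?_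
    · obtain ⟨U, l, hU, -, hl⟩ := exists_diagonalization (hherm τ)
      rw [trace_pow_eq_sum hU (hl _)]
      exact mul_nonneg (by positivity) (Finset.sum_nonneg fun k _ => hev.pow_nonneg _)
    -- Markov's inequality in contrapositive form: a small trace bounds the dilation, and vectors
    -- supported on the second summand recover the norm of the off-diagonal block.
    · by_contra hlt
      rw [not_le, inv_mul_lt_iff₀ (by positivity), mul_one] at hlt
      refine hτ fun f => ?_
      have h1 := e2_mulVec_le_of_trace_pow (hherm τ) hη.le hlt.le (Sum.elim 0 f)
      rw [sum_dilation_eq hZ0, Matrix.fromBlocks_mulVec] at h1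
      have e1 : ∀ u w : X → ℝ, e2 (Sum.elim u w) ^ 2 = e2 u ^ 2 + e2 w ^ 2 := by
        intro u w; simp only [e2_sq, Fintype.sum_sum_type, Sum.elim_inl, Sum.elim_inr]
      have e3 : ∀ u : X → ℝ, e2 (Sum.elim u (0 : X → ℝ)) = e2 u := by
        intro u
        have := e1 u 0
        rw [e2_zero] at this
        exact (sq_eq_sq₀ (e2_nonneg _) (e2_nonneg _)).1 (by simpa using this)
      have e4 : ∀ u : X → ℝ, e2 (Sum.elim (0 : X → ℝ) u) = e2 u := by
        intro u
        have := e1 0 u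
        rw [e2_zero] at this
        exact (sq_eq_sq₀ (e2_nonneg _) (e2_nonneg _)).1 (by simpa using this)
      simpa [e3, e4] using h1
  refine hbad.trans ?_
  rw [Ex_const_mul]
  refine (mul_le_mul_of_nonneg_left hmom3 (by positivity)).trans (le_of_eq ?_)
  have e : 40 * κ * Real.exp (2 * κ) * (t + 1) / (N * η ^ 2) = B * Real.exp (2 * κ) / η ^ 2 := by
    rw [hB]; field_simp
  rw [e, div_pow, ← pow_mul]
  have e2 : 2 * (t + 1) = 2 * t + 2 := by ring
  rw [e2]
  field_simp

end Empirical


/-! ### Concentration of rows and weighted column sums -/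

section RowsColumns

variable {X S : Type*} [Fintype X] [DecidableEq X] [Fintype S] {a : S → X → ℝ} {P : X → S → ℝ}
  {Z : X → ℕ}

/-- After division by ρ(y) this is a sum of non-negative independent terms bounded by K²/N, and
invariance makes its mean 1. For such terms the second moment is at most the bound times the mean,
so the variance parameter is also K²/N. -/
theorem pr_col_gt_le (hP : IsKernel P) (ha : IsKernel a) {N n K t : ℝ} (hN : 0 < N)
    (hZN : ∀ x, N ≤ Z x) (hn : 0 < n) (hK : 1 ≤ K) {ρ : X → ℝ}
    (hlo : ∀ x, 1 ≤ K * (n * ρ x)) (hhi : ∀ x, n * ρ x ≤ K) (hinv : ρ ᵥ* compKernel P a = ρ)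
    (ht0 : 0 ≤ t) (ht : t ≤ 2) (y : X) :
    pr (fun (i : Σ x, Fin (Z x)) s => P i.1 s)
      (fun τ => (1 + t) * ρ y < (ρ ᵥ* empKernel a τ) y) ≤ Real.exp (-(t ^ 2 * N / (4 * K ^ 2))) := by
  have hp : IsLaw fun (i : Σ x, Fin (Z x)) s => P i.1 s := hP.law
  have hZ0 : ∀ x, 0 < Z x := fun x => by exact_mod_cast hN.trans_le (hZN x)
  have hK0 : 0 < K := by linarith
  have hρ : ∀ x, 0 < ρ x := fun x => by
    by_contra h
    have h1 := hlo x
    have : K * (n * ρ x) ≤ 0 :=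
      mul_nonpos_of_nonneg_of_nonpos hK0.le (mul_nonpos_of_nonneg_of_nonpos hn.le (not_lt.1 h))
    linarith
  have hb : ∀ x, ρ x / ρ y ≤ K ^ 2 := by
    intro x
    rw [div_le_iff₀ (hρ y)]
    have h1 : n * ρ x ≤ n * (K ^ 2 * ρ y) := by nlinarith [hhi x, hlo y]
    exact le_of_mul_le_mul_left h1 hn
  have hb0 : ∀ x, 0 ≤ ρ x / ρ y := fun x => (div_pos (hρ x) (hρ y)).le
  let f : (Σ x, Fin (Z x)) → S → ℝ := fun i s => ρ i.1 / ρ y * (a s y / Z i.1)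
  have hf0 : ∀ i s, 0 ≤ f i s := fun i s =>
    mul_nonneg (hb0 _) (div_nonneg (ha.nonneg s y) (Nat.cast_nonneg _))
  have hf : ∀ i s, f i s ≤ K ^ 2 / N := by
    intro i s
    calc f i s ≤ K ^ 2 * (1 / N) := mul_le_mul (hb _)
          (div_le_div₀ zero_le_one (ha.le_one s y) hN (hZN _))
          (div_nonneg (ha.nonneg s y) (Nat.cast_nonneg _)) (by positivity)
      _ = _ := by ring
  have hm : ∑ i, ∑ s, P i.1 s * f i s = 1 := by
    rw [sum_sum_col hZ0 (fun x => ρ x / ρ y) y]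
    have h1 : (ρ ᵥ* compKernel P a) y = ρ y := by rw [hinv]
    have h2 : ∑ x, ρ x / ρ y * compKernel P a x y = (ρ ᵥ* compKernel P a) y / ρ y := by
      rw [Matrix.vecMul, dotProduct, Finset.sum_div]
      exact Finset.sum_congr rfl fun x _ => by ring
    rw [h2, h1, div_self (hρ y).ne']
  have hv : ∑ i, ∑ s, P i.1 s * f i s ^ 2 ≤ K ^ 2 / N := by
    rw [← mul_one (K ^ 2 / N), ← hm, Finset.mul_sum]
    refine Finset.sum_le_sum fun i _ => ?_
    rw [Finset.mul_sum]
    refine Finset.sum_le_sum fun s _ => ?_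
    have h1 := mul_le_mul_of_nonneg_left (mul_le_mul_of_nonneg_right (hf i s) (hf0 i s))
      (hP.nonneg i.1 s)
    rw [sq]; linarith
  have h1 := hp.pr_sum_gt_le (f := f) (h := K ^ 2 / N) (by positivity) ht0
    (fun i s => by rw [abs_of_nonneg (hf0 i s)]; exact hf i s)
    (mul_le_mul_of_nonneg_right ht (by positivity)) hv hm
  refine (hp.pr_mono fun τ hτ => ?_).trans (h1.trans (le_of_eq ?_))
  · have h2 := col_empKernel (a := a) τ (fun x => ρ x / ρ y) y
    have h3 : ∑ x, ρ x / ρ y * empKernel a τ x y = (ρ ᵥ* empKernel a τ) y / ρ y := by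
      rw [Matrix.vecMul, dotProduct, Finset.sum_div]
      exact Finset.sum_congr rfl fun x _ => by ring
    change 1 + t < ∑ i : Σ x, Fin (Z x), ρ i.1 / ρ y * (a (τ i) y / Z i.1)
    rw [← h2, h3, lt_div_iff₀ (hρ y)]
    exact hτ
  · congr 1; field_simp

/-- Row x involves only the observations from x, so the summands carry the indicator of x. The total
of their second moments is then 1/Z(x) at most, not multiplied by n. -/
theorem pr_row_gt_le (hP : IsKernel P) (ha : IsKernel a) {N η : ℝ} (hN : 0 < N)
    (hZN : ∀ x, N ≤ Z x) (hη0 : 0 ≤ η) (hη : η ≤ 2) {u : X → ℝ} (hu : ∀ y, |u y| ≤ 1) (x : X) :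
    pr (fun (i : Σ x, Fin (Z x)) s => P i.1 s)
      (fun τ => η < ((empKernel a τ - compKernel P a) *ᵥ u) x) ≤ Real.exp (-(η ^ 2 * N / 4)) := by
  have hp : IsLaw fun (i : Σ x, Fin (Z x)) s => P i.1 s := hP.law
  have hZ0 : ∀ x, (0 : ℝ) < Z x := fun x => hN.trans_le (hZN x)
  let g : S → ℝ := fun s => ∑ y, a s y * u y
  have hg : ∀ s, |g s| ≤ 1 := by
    intro s
    calc |g s| ≤ ∑ y, |a s y * u y| := Finset.abs_sum_le_sum_abs _ _
      _ ≤ ∑ y, a s y := Finset.sum_le_sum fun y _ => by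
          rw [abs_mul, abs_of_nonneg (ha.nonneg s y)]
          exact mul_le_of_le_one_right (ha.nonneg s y) (hu y)
      _ = 1 := ha.sum_eq_one s
  let f : (Σ x, Fin (Z x)) → S → ℝ := fun i s => (Pi.single i.1 1 : X → ℝ) x * (g s / Z i.1)
  have hf : ∀ i s, |f i s| ≤ 1 / N := by
    intro i s
    rw [abs_mul, abs_div, abs_of_pos (hZ0 i.1)]
    have h1 : |(Pi.single i.1 1 : X → ℝ) x| ≤ 1 := by
      by_cases h : x = i.1
      · rw [h]; simp
      · simp [h]
    calc _ ≤ 1 * (1 / N) := mul_le_mul h1 (div_le_div₀ zero_le_one (hg s) hN (hZN _))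
          (div_nonneg (abs_nonneg _) (Nat.cast_nonneg _)) zero_le_one
      _ = _ := one_mul _
  have hgQ : ∑ s, P x s * g s = (compKernel P a *ᵥ u) x := by
    simp only [g, Matrix.mulVec, dotProduct, compKernel, Matrix.of_apply, Finset.mul_sum,
      Finset.sum_mul]
    rw [Finset.sum_comm]
    exact Finset.sum_congr rfl fun y _ => Finset.sum_congr rfl fun s _ => by ring
  have hm : ∑ i, ∑ s, P i.1 s * f i s = (compKernel P a *ᵥ u) x := by
    simp only [f, mul_left_comm (P _ _), ← Finset.mul_sum]
    rw [sum_sigma_single Z (fun i => ∑ s, P i.1 s * (g s / Z i.1)), ← hgQ]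
    change ∑ _j : Fin (Z x), ∑ s, P x s * (g s / Z x) = _
    rw [Finset.sum_const, Finset.card_univ, Fintype.card_fin, nsmul_eq_mul, Finset.mul_sum]
    refine Finset.sum_congr rfl fun s _ => ?_
    have := (hZ0 x).ne'
    field_simp
  have hv : ∑ i, ∑ s, P i.1 s * f i s ^ 2 ≤ 1 / N := by
    have h1 : ∀ i : Σ x, Fin (Z x), ∑ s, P i.1 s * f i s ^ 2
        ≤ (Pi.single i.1 1 : X → ℝ) x * (1 / (Z i.1 : ℝ) ^ 2) := by
      intro i
      have h2 : (Pi.single i.1 1 : X → ℝ) x ^ 2 = (Pi.single i.1 1 : X → ℝ) x := by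
        by_cases h : x = i.1
        · rw [h]; simp
        · simp [h]
      have h3 : (0 : ℝ) ≤ (Pi.single i.1 1 : X → ℝ) x := by rw [← h2]; exact sq_nonneg _
      calc ∑ s, P i.1 s * f i s ^ 2
          ≤ ∑ s, P i.1 s * ((Pi.single i.1 1 : X → ℝ) x * (1 / (Z i.1 : ℝ) ^ 2)) := by
            refine Finset.sum_le_sum fun s _ => mul_le_mul_of_nonneg_left ?_ (hP.nonneg i.1 s)
            rw [mul_pow, h2, div_pow]
            refine mul_le_mul_of_nonneg_left (div_le_div_of_nonneg_right ?_ (sq_nonneg _)) h3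
            rw [← sq_abs]; exact pow_le_one₀ (abs_nonneg _) (hg s)
        _ = _ := by rw [← Finset.sum_mul, hP.sum_eq_one, one_mul]
    refine (Finset.sum_le_sum fun i _ => h1 i).trans ?_
    rw [sum_sigma_single Z (fun i => 1 / (Z i.1 : ℝ) ^ 2)]
    change ∑ _j : Fin (Z x), 1 / (Z x : ℝ) ^ 2 ≤ _
    rw [Finset.sum_const, Finset.card_univ, Fintype.card_fin, nsmul_eq_mul]
    have h2 : (Z x : ℝ) * (1 / (Z x : ℝ) ^ 2) = 1 / Z x := by
      have := (hZ0 x).ne'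
      field_simp
    rw [h2]
    exact one_div_le_one_div_of_le hN (hZN x)
  have h1 := hp.pr_sum_gt_le (f := f) (h := 1 / N) (by positivity) hη0 hf
    (mul_le_mul_of_nonneg_right hη (by positivity)) hv hm
  refine (hp.pr_mono fun τ hτ => ?_).trans (h1.trans (le_of_eq ?_))
  · change _ < ∑ i : Σ x, Fin (Z x), (Pi.single i.1 1 : X → ℝ) x * (g (τ i) / Z i.1)
    rw [sum_sigma_single Z (fun i => g (τ i) / Z i.1)]
    have h2 : ∑ j, g (τ ⟨x, j⟩) / Z x = (empKernel a τ *ᵥ u) x := by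
      simp only [g, Matrix.mulVec, dotProduct, empKernel, Matrix.of_apply, Finset.sum_div,
        Finset.sum_mul]
      rw [Finset.sum_comm]
      exact Finset.sum_congr rfl fun y _ => Finset.sum_congr rfl fun s _ => by ring
    change _ < ∑ j, g (τ ⟨x, j⟩) / Z x
    rw [h2]
    rw [Matrix.sub_mulVec, Pi.sub_apply] at hτ
    linarith
  · congr 1; field_simp

theorem pr_abs_row_gt_le (hP : IsKernel P) (ha : IsKernel a) {N η : ℝ} (hN : 0 < N)
    (hZN : ∀ x, N ≤ Z x) (hη0 : 0 ≤ η) (hη : η ≤ 2) (g : X → ℝ) (x : X) :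
    pr (fun (i : Σ x, Fin (Z x)) s => P i.1 s)
      (fun τ => η * ‖g‖ < |((empKernel a τ - compKernel P a) *ᵥ g) x|)
      ≤ 2 * Real.exp (-(η ^ 2 * N / 4)) := by
  have hp : IsLaw fun (i : Σ x, Fin (Z x)) s => P i.1 s := hP.law
  have hu : ∀ y, |(‖g‖⁻¹ • g) y| ≤ 1 := by
    intro y
    have h1 : ‖g y‖ ≤ ‖g‖ := norm_le_pi_norm g y
    rw [Pi.smul_apply, smul_eq_mul, abs_mul, abs_inv, abs_norm, ← Real.norm_eq_abs]
    exact inv_mul_le_one_of_le₀ h1 (norm_nonneg g)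
  have hu' : ∀ y, |(-(‖g‖⁻¹ • g)) y| ≤ 1 := fun y => by rw [Pi.neg_apply, abs_neg]; exact hu y
  have h1 := pr_row_gt_le (Z := Z) hP ha hN hZN hη0 hη hu x
  have h2 := pr_row_gt_le (Z := Z) hP ha hN hZN hη0 hη hu' x
  refine (hp.pr_mono (B := fun τ => η < ((empKernel a τ - compKernel P a) *ᵥ (‖g‖⁻¹ • g)) x
    ∨ η < ((empKernel a τ - compKernel P a) *ᵥ (-(‖g‖⁻¹ • g))) x) fun τ hτ => ?_).trans
    ((hp.pr_or_le _ _).trans (by linarith))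
  rw [Matrix.mulVec_neg, Pi.neg_apply, ← lt_abs, Matrix.mulVec_smul, Pi.smul_apply, smul_eq_mul,
    abs_mul, abs_inv, abs_norm]
  have hg : 0 < ‖g‖ := by
    rcases (norm_nonneg g).eq_or_lt with h | h
    · rw [norm_eq_zero.1 h.symm] at hτ; simp at hτ
    · exact h
  rw [inv_mul_eq_div, lt_div_iff₀ hg]
  exact hτ

/-- Conditionally on the observations from all pairs other than x the vector `g` is fixed, while row
x keeps its law. The bound for a fixed vector applies under each conditioning. -/
theorem pr_abs_row_loo_le (hP : IsKernel P) (ha : IsKernel a) {N η : ℝ} (hN : 0 < N)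
    (hZN : ∀ x, N ≤ Z x) (hη0 : 0 ≤ η) (hη : η ≤ 2) (x : X)
    (g : ((Σ x, Fin (Z x)) → S) → X → ℝ)
    (hg : ∀ τ τ', (∀ i : Σ x, Fin (Z x), i.1 ≠ x → τ i = τ' i) → g τ = g τ') :
    pr (fun (i : Σ x, Fin (Z x)) s => P i.1 s)
      (fun τ => η * ‖g τ‖ < |((empKernel a τ - compKernel P a) *ᵥ g τ) x|)
      ≤ 2 * Real.exp (-(η ^ 2 * N / 4)) := by
  classical
  have hp : IsLaw fun (i : Σ x, Fin (Z x)) s => P i.1 s := hP.law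
  refine hp.pr_le_of_piecewise (Finset.univ.filter fun i => i.1 = x) fun τ => ?_
  refine (hp.pr_mono fun τ' hτ => ?_).trans
    (pr_abs_row_gt_le (Z := Z) hP ha hN hZN hη0 hη (g τ) x)
  have e1 : g ((Finset.univ.filter fun i : Σ x, Fin (Z x) => i.1 = x).piecewise τ' τ) = g τ :=
    hg _ _ fun i hi => by simp [hi]
  have e2 : ∀ y, empKernel a
      ((Finset.univ.filter fun i : Σ x, Fin (Z x) => i.1 = x).piecewise τ' τ) x y
      = empKernel a τ' x y := by
    intro y; simp [empKernel]
  rw [e1] at hτ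
  have e3 : ((empKernel a ((Finset.univ.filter fun i : Σ x, Fin (Z x) => i.1 = x).piecewise τ' τ)
      - compKernel P a) *ᵥ g τ) x = ((empKernel a τ' - compKernel P a) *ᵥ g τ) x := by
    simp only [Matrix.mulVec, dotProduct, Matrix.sub_apply, e2]
  rwa [e3] at hτ

end RowsColumns


/-! ### Tameness of the empirical matrix and of its leave-one-out versions -/

section Leave

variable {X : Type*} [Fintype X] [DecidableEq X]

theorem IsStochastic.updateRow {Q Q' : Matrix X X ℝ} (hQ : IsStochastic Q) (hQ' : IsStochastic Q')
    (x : X) : IsStochastic (Q'.updateRow x (Q x)) := by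
  refine ⟨fun z y => ?_, fun z => ?_⟩ <;> by_cases h : z = x
  · subst h; simpa using hQ.nonneg z y
  · simpa [h] using hQ'.nonneg z y
  · subst h; simpa using hQ.row z
  · simpa [h] using hQ'.row z

/-- A small perturbation of a stochastic matrix, and its leave-one-out versions, are tame. -/
theorem tame_of_small {Q Q' : Matrix X X ℝ} (hQ : IsStochastic Q) (hQ' : IsStochastic Q')
    {γ n K G c η : ℝ} {k : ℕ} (hγ0 : 0 ≤ γ) (hγ1 : γ < 1) (hn : 0 < n) (hK : 1 ≤ K) {ρ : X → ℝ}
    (hlo : ∀ x, 1 ≤ K * (n * ρ x)) (hhi : ∀ x, n * ρ x ≤ K) (hinv : ρ ᵥ* Q = ρ)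
    (hG1 : 1 ≤ G) (hG : (1 - γ)⁻¹ ≤ G) (hc : 6 * K ^ 2 * G ≤ c) (hη : 0 ≤ η)
    (hsmall : 4 * K ^ 2 * ((k + 1) * η) * G ≤ 1)
    (hE : ∀ f, e2 ((Q' - Q) *ᵥ f) ≤ η * e2 f) (hcol : ∀ y, (ρ ᵥ* Q') y ≤ (1 + η) * ρ y) :
    Tame γ k c Q ∧ Tame γ k c Q' ∧ ∀ x, Tame γ k c (Q'.updateRow x (Q x)) := by
  have hK0 : 0 < K := by linarith
  have hKK : 1 ≤ K ^ 2 := one_le_pow₀ hK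
  have hg : 0 < 1 - γ := by linarith
  have hρ : ∀ x, 0 < ρ x := fun x => by
    by_contra h
    have h1 := hlo x
    have : K * (n * ρ x) ≤ 0 :=
      mul_nonpos_of_nonneg_of_nonpos hK0.le (mul_nonpos_of_nonneg_of_nonpos hn.le (not_lt.1 h))
    linarith
  have hb : ∀ x y, ρ x ≤ K ^ 2 * ρ y := by
    intro x y
    have h1 : n * ρ x ≤ n * (K ^ 2 * ρ y) := by nlinarith [hhi x, hlo y]
    exact le_of_mul_le_mul_left h1 hn
  -- One β serves all three matrices. Resetting row x can add at most ρ(x)η ≤ K²ηρ(y) to the mass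
  -- arriving at y, on top of the factor 1 + η for Q', and 1 + η + K²η ≤ β.
  set β : ℝ := 1 + 2 * K ^ 2 * η with hβ
  have hKη : 0 ≤ K ^ 2 * η := by positivity
  have hβ1 : 1 ≤ β := by linarith
  have hk0 : (0 : ℝ) ≤ k := Nat.cast_nonneg k
  have hs1 : 4 * K ^ 2 * ((k + 1) * η) ≤ 1 := by
    have : 0 ≤ 4 * K ^ 2 * ((k + 1) * η) := by positivity
    nlinarith
  have hβk : β ^ k ≤ 3 := by
    calc β ^ k ≤ Real.exp (2 * K ^ 2 * η) ^ k :=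
          pow_le_pow_left₀ (by linarith) (by rw [hβ, add_comm]; exact Real.add_one_le_exp _) k
      _ = Real.exp (k * (2 * K ^ 2 * η)) := (Real.exp_nat_mul _ _).symm
      _ ≤ Real.exp 1 := Real.exp_le_exp.2 (by nlinarith)
      _ ≤ 3 := by have := Real.exp_one_lt_d9; linarith
  have hγβ : (1 - γ) / 2 ≤ 1 - γ * β := by
    have h1 : 4 * K ^ 2 * η * G ≤ 1 := by
      have : 0 ≤ 4 * K ^ 2 * η * G * k := by positivity
      nlinarith
    have h2 : 4 * K ^ 2 * η ≤ 1 - γ := by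
      have h3 : 1 ≤ G * (1 - γ) := by
        have := mul_le_mul_of_nonneg_right hG hg.le
        rwa [inv_mul_cancel₀ hg.ne'] at this
      have h4 : 4 * K ^ 2 * η * 1 ≤ 4 * K ^ 2 * η * (G * (1 - γ)) :=
        mul_le_mul_of_nonneg_left h3 (by positivity)
      have h5 := mul_le_mul_of_nonneg_right h1 hg.le
      linarith
    have h3 : γ * (K ^ 2 * η) ≤ K ^ 2 * η := mul_le_of_le_one_left hKη hγ1.le
    rw [hβ]; linarith
  have hc' : 6 * K ^ 2 * (1 - γ)⁻¹ ≤ c :=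
    (mul_le_mul_of_nonneg_left hG (by positivity)).trans hc
  have hηβ : 1 + η ≤ β := by nlinarith
  refine ⟨hQ.tame hγ0 hγ1 hn hK hlo hhi hβ1 hβk hγβ (fun y => ?_) hc',
    hQ'.tame hγ0 hγ1 hn hK hlo hhi hβ1 hβk hγβ (fun y => ?_) hc', fun x =>
    (hQ.updateRow hQ' x).tame hγ0 hγ1 hn hK hlo hhi hβ1 hβk hγβ (fun y => ?_) hc'⟩
  · rw [hinv]; nlinarith [hρ y]
  · exact (hcol y).trans (mul_le_mul_of_nonneg_right hηβ (hρ y).le)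
  · have e : (ρ ᵥ* Q'.updateRow x (Q x)) y = (ρ ᵥ* Q') y - ρ x * (Q' - Q) x y := by
      simp only [Matrix.vecMul, dotProduct]
      rw [← Finset.add_sum_erase _ (fun z => ρ z * Q'.updateRow x (Q x) z y) (Finset.mem_univ x),
        ← Finset.add_sum_erase _ (fun z => ρ z * Q' z y) (Finset.mem_univ x)]
      have h1 : ∑ z ∈ Finset.univ.erase x, ρ z * Q'.updateRow x (Q x) z y
          = ∑ z ∈ Finset.univ.erase x, ρ z * Q' z y :=
        Finset.sum_congr rfl fun z hz => by rw [Matrix.updateRow_ne (Finset.ne_of_mem_erase hz)]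
      rw [h1]
      simp
      ring
    -- A single entry is bounded by the operator norm, tested on a unit vector.
    have h1 : |(Q' - Q) x y| ≤ η := by
      have h2 := (abs_le_e2 ((Q' - Q) *ᵥ Pi.single y 1) x).trans (hE _)
      rw [e2_single, mul_one] at h2
      simpa using h2
    have h2 : -(ρ x * (Q' - Q) x y) ≤ K ^ 2 * ρ y * η := by
      have h3 : -((Q' - Q) x y) ≤ η := (neg_le_abs _).trans h1
      calc -(ρ x * (Q' - Q) x y) = ρ x * (-((Q' - Q) x y)) := by ring
        _ ≤ ρ x * η := mul_le_mul_of_nonneg_left h3 (hρ x).le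
        _ ≤ K ^ 2 * ρ y * η := mul_le_mul_of_nonneg_right (hb x y) hη
    have h3 := hcol y
    have h4 : η * ρ y ≤ K ^ 2 * η * ρ y := by
      refine mul_le_mul_of_nonneg_right ?_ (hρ y).le
      nlinarith
    rw [e, hβ]
    linarith

end Leave

/-! ### From the finite product space to the given probability space -/

section MeasureTransfer

variable {I S Ω : Type*} [Fintype I] [DecidableEq I] [Fintype S] [MeasurableSpace S]
  [MeasurableSingletonClass S] [MeasurableSpace Ω]

theorem pr_not {p : I → S → ℝ} (hp : IsLaw p) (A : (I → S) → Prop) :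
    pr p (fun τ => ¬ A τ) = 1 - pr p A := by
  classical
  have h := hp.Ex_const 1
  rw [pr, pr]
  nth_rewrite 2 [← h]
  rw [← Ex_sub]
  congr 1
  ext τ
  by_cases h : A τ <;> simp [h]

/-- There are finitely many sample configurations and independence gives each its product weight.
Every predicate of the sample is therefore measurable, and no measurability of singular vectors is
needed. -/
theorem measure_eq_pr {μ : Measure Ω} {p : I → S → ℝ} (hp : IsLaw p) {T : I → Ω → S}
    (hT : ∀ i, Measurable (T i)) (hlaw : ∀ i s, μ {ω | T i ω = s} = ENNReal.ofReal (p i s))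
    (hind : iIndepFun T μ) (A : (I → S) → Prop) :
    μ {ω | A fun i => T i ω} = ENNReal.ofReal (pr p A) := by
  classical
  have hpt : ∀ τ : I → S, {ω | (fun i => T i ω) = τ} = ⋂ i ∈ Finset.univ, T i ⁻¹' {τ i} := by
    intro τ; ext ω; simp [funext_iff]
  have hμ : ∀ τ : I → S, μ {ω | (fun i => T i ω) = τ} = ENNReal.ofReal (∏ i, p i (τ i)) := by
    intro τ
    rw [hpt, hind.measure_inter_preimage_eq_mul Finset.univ
      (fun i _ => measurableSet_singleton (τ i)), ENNReal.ofReal_prod_of_nonneg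
      fun i _ => hp.nonneg i _]
    exact Finset.prod_congr rfl fun i _ => hlaw i (τ i)
  have e : {ω | A fun i => T i ω} = ⋃ τ ∈ Finset.univ.filter A, {ω | (fun i => T i ω) = τ} := by
    ext ω; simp
  rw [e, measure_biUnion_finset]
  · simp only [hμ, pr, Ex]
    rw [← ENNReal.ofReal_sum_of_nonneg fun τ _ => hp.prod_nonneg τ, Finset.sum_filter]
    simp
  · intro τ _ τ' _ hne
    refine Set.disjoint_left.2 fun ω h h' => hne ?_
    exact h.symm.trans h'
  · intro τ _
    rw [hpt]
    exact Finset.measurableSet_biInter _ fun i _ => hT i (measurableSet_singleton _)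

end MeasureTransfer

/-! ### Constants -/

/-- Two probability vectors cannot satisfy ν < ρ everywhere, so both suprema are at least 1. Each is
then bounded by their product. -/
theorem le_of_discrepancy_le {X : Type*} [Fintype X] [Nonempty X] {ν ρ : X → ℝ}
    (hν : IsFullProb ν) (hρ : IsFullProb ρ) {K : ℝ} (h : discrepancy ν ρ ≤ K) :
    1 ≤ K ∧ ∀ x, ν x ≤ K * ρ x ∧ ρ x ≤ K * ν x := by
  have key : ∀ {a b : X → ℝ}, IsFullProb a → IsFullProb b → 1 ≤ ⨆ x, a x / b x := by
    intro a b ha hb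
    by_contra hlt
    rw [not_le] at hlt
    have h1 : ∀ x, a x < b x := fun x => by
      have := (le_ciSup (f := fun x => a x / b x) (Set.finite_range _).bddAbove x).trans_lt hlt
      rwa [div_lt_one (hb.pos x)] at this
    have h2 := Finset.sum_lt_sum_of_nonempty (Finset.univ_nonempty (α := X)) fun x _ => h1 x
    rw [ha.sum_eq_one, hb.sum_eq_one] at h2
    exact lt_irrefl _ h2
  have h1 := key hν hρ
  have h2 := key hρ hν
  rw [discrepancy] at h
  refine ⟨by nlinarith, fun x => ⟨?_, ?_⟩⟩
  · rw [← div_le_iff₀ (hρ.pos x)]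
    refine (le_ciSup (f := fun x => ν x / ρ x) (Set.finite_range _).bddAbove x).trans ?_
    nlinarith
  · rw [← div_le_iff₀ (hν.pos x)]
    refine (le_ciSup (f := fun x => ρ x / ν x) (Set.finite_range _).bddAbove x).trans ?_
    nlinarith

theorem card_mul_bounds {X : Type*} [Fintype X] {ν : X → ℝ} (hν : IsFullProb ν) {K : ℝ}
    (h : ∀ x x', ν x / ν x' ≤ K) (x : X) :
    1 ≤ K * (Fintype.card X * ν x) ∧ Fintype.card X * ν x ≤ K := by
  have h1 : ∀ x x', ν x ≤ K * ν x' := fun x x' => (div_le_iff₀ (hν.pos x')).1 (h x x')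
  constructor
  · calc 1 = ∑ z, ν z := hν.sum_eq_one.symm
      _ ≤ ∑ _z : X, K * ν x := Finset.sum_le_sum fun z _ => h1 z x
      _ = _ := by simp; ring
  · calc Fintype.card X * ν x = ∑ _z : X, ν x := by simp
      _ ≤ ∑ z, K * ν z := Finset.sum_le_sum fun z _ => h1 x z
      _ = K := by rw [← Finset.mul_sum, hν.sum_eq_one, mul_one]

/-- The constant function has ℓ²(ν) norm 1 and is multiplied by (1 - γ)⁻¹. Bounded recoverability
thus already keeps γ away from 1. -/
theorem NuSVD.inv_one_sub_le {X : Type*} [Fintype X] [DecidableEq X] [Nonempty X] {ν : X → ℝ}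
    (hν : IsFullProb ν) {Q : Matrix X X ℝ} (hQ : IsStochastic Q) {γ : ℝ} (h0 : 0 ≤ γ) (h1 : γ < 1)
    {k : ℕ} (D : NuSVD ν (shifted γ Q k)) {K : ℝ} (hK : D.recoverability ≤ K) :
    (1 - γ)⁻¹ ≤ K := by
  have h2 := D.abs_mulVec_le hν hK 1 (Classical.arbitrary X)
  have h3 : l2Norm ν (1 : X → ℝ) = 1 := by simp [l2Norm, hν.sum_eq_one]
  rw [hQ.shifted_mulVec_one h0 h1, h3, mul_one] at h2
  have h4 : (0 : ℝ) < (1 - γ)⁻¹ := inv_pos.2 (by linarith)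
  simpa [abs_of_pos h4] using (le_abs_self _).trans h2

/-- The first j + 1 singular values are all at least σ_j and their sum is at most the
recoverability. Together with the gap this bounds the rank r. -/
theorem NuSVD.mul_σ_le {X : Type*} [Fintype X] {ν : X → ℝ} (hν : IsFullProb ν) {M : Matrix X X ℝ}
    (D : NuSVD ν M) {K : ℝ} (hK : D.recoverability ≤ K) (j : Fin (Fintype.card X)) :
    ((j : ℕ) + 1 : ℝ) * D.σ j ≤ K := by
  refine le_trans ?_ (D.sum_σ_le hν hK)
  have hcard : (Finset.Iic j).card = (j : ℕ) + 1 := by simp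
  calc ((j : ℕ) + 1 : ℝ) * D.σ j = ∑ _i ∈ Finset.Iic j, D.σ j := by
        rw [Finset.sum_const, hcard, nsmul_eq_mul]; push_cast; rfl
    _ ≤ ∑ i ∈ Finset.Iic j, D.σ i := Finset.sum_le_sum fun i hi =>
        D.σ_antitone (Finset.mem_Iic.1 hi)
    _ ≤ ∑ i, D.σ i := Finset.sum_le_sum_of_subset_of_nonneg (Finset.subset_univ _)
        fun i _ _ => D.σ_nonneg i

/-! ### Markov decision processes as kernels -/

section Policy

variable {St : Type*} {Act : St → Type*}

/-- The kernel from states to state-action pairs defined by a policy. -/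
noncomputable def policyKernel [DecidableEq St] (π : ∀ s, Act s → ℝ) (s : St) (y : Σ s, Act s) : ℝ :=
  if s = y.1 then π y.1 y.2 else 0

variable [Fintype St] [DecidableEq St] [∀ s, Fintype (Act s)]

theorem policyKernel_isKernel {π : ∀ s, Act s → ℝ} (hπ : IsPolicy π) :
    IsKernel (policyKernel π) := by
  refine ⟨fun s y => ?_, fun s => ?_⟩
  · rw [policyKernel]; split_ifs; exacts [hπ.nonneg _ _, le_rfl]
  · rw [Fintype.sum_sigma, Finset.sum_eq_single s]
    · simp [policyKernel, hπ.sum_eq_one]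
    · intro t _ ht; simp [policyKernel, ht.symm]
    · simp

theorem policyMatrix_eq (P : (Σ s, Act s) → St → ℝ) (π : ∀ s, Act s → ℝ) :
    policyMatrix P π = compKernel P (policyKernel π) := by
  ext x y; simp [policyMatrix, compKernel, policyKernel]

theorem policyMatrix_empirical_eq {Ω : Type*} {Z : (Σ s, Act s) → ℕ}
    (T : (Σ x : (Σ s, Act s), Fin (Z x)) → Ω → St) (ω : Ω) (π : ∀ s, Act s → ℝ) :
    policyMatrix (empirical T ω) π = empKernel (policyKernel π) fun i => T i ω := by
  ext x y
  simp only [policyMatrix, empirical, empKernel, policyKernel, Matrix.of_apply]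
  rw [← Finset.sum_filter, Finset.sum_const, nsmul_eq_mul]
  ring

end Policy


/-! ### The good event and its probability -/

section Good

variable {X : Type*} [Fintype X] [DecidableEq X]

/-- `Q'` is `η`-close to `Q`: in `ℓ²`, in the mass it transports to each point under `ρ`, and,
row by row, on vectors built from the leave-one-out versions of `Q'`. -/
structure IsClose (v : Matrix X X ℝ → ℕ → Fin (Fintype.card X) → X → ℝ) (ρ : X → ℝ) (η : ℝ)
    (k r : ℕ) (Q Q' : Matrix X X ℝ) : Prop where
  e2_le : ∀ f, e2 ((Q' - Q) *ᵥ f) ≤ η * e2 f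
  col_le : ∀ y, (ρ ᵥ* Q') y ≤ (1 + η) * ρ y
  row_le : ∀ x, ∀ m ≤ k, ∀ j ∈ lead X r,
    |((Q' - Q) *ᵥ v (Q'.updateRow x (Q x)) m j) x| ≤ η * ‖v (Q'.updateRow x (Q x)) m j‖

variable {S : Type*} [Fintype S] [DecidableEq S] {P : X → S → ℝ} {a : S → X → ℝ} {Z : X → ℕ}

/-- A union bound over the operator norm event, the n weighted columns and the n(k+1)r leave-one-out
tests. Since `v` is a function of the matrix with row x reset, its values do not depend on the
observations from x. -/
theorem pr_not_isClose_le [Nonempty X] (hP : IsKernel P) (ha : IsKernel a) {N η n K : ℝ}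
    (hN : 0 < N) (hZN : ∀ x, N ≤ Z x) (hη0 : 0 < η) (hη : η ≤ 2) (hn : 0 < n) (hK : 1 ≤ K)
    {ρ : X → ℝ} (hlo : ∀ x, 1 ≤ K * (n * ρ x)) (hhi : ∀ x, n * ρ x ≤ K)
    (hinv : ρ ᵥ* compKernel P a = ρ) (t : ℕ) (ht : (t : ℝ) + 1 ≤ N)
    (v : Matrix X X ℝ → ℕ → Fin (Fintype.card X) → X → ℝ) (k r : ℕ) :
    pr (fun (i : Σ x, Fin (Z x)) s => P i.1 s)
      (fun τ => ¬ IsClose v ρ η k r (compKernel P a) (empKernel a τ))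
      ≤ 2 * (Fintype.card X : ℝ) ^ 2
          * (40 * K ^ 2 * Real.exp (2 * K ^ 2) * (t + 1) / (N * η ^ 2)) ^ (t + 1)
        + Fintype.card X * Real.exp (-(η ^ 2 * N / (4 * K ^ 2)))
        + Fintype.card X * (k + 1) * r * (2 * Real.exp (-(η ^ 2 * N / 4))) := by
  have hp : IsLaw (fun (i : Σ x, Fin (Z x)) s => P i.1 s) := hP.law
  have hQ := compKernel_isKernel hP ha
  have hρ : ∀ y, 0 ≤ ρ y := fun y => by
    by_contra h
    have : K * (n * ρ y) ≤ 0 := mul_nonpos_of_nonneg_of_nonpos (by linarith)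
      (mul_nonpos_of_nonneg_of_nonpos hn.le (not_le.1 h).le)
    linarith [hlo y]
  have hcol : ∀ y, ∑ x, compKernel P a x y ≤ K ^ 2 := fun y => by
    have := col_sum_le hn hK hlo hhi hQ.nonneg zero_le_one
      (fun y => by rw [hinv, one_mul]) y
    rwa [mul_one] at this
  have h1 := pr_not_e2_le hP ha hN hZN (one_le_pow₀ hK) hcol hη0 t ht
  have h2 := hp.pr_exists_le Finset.univ
    (fun y (τ : (Σ x, Fin (Z x)) → S) => (1 + η) * ρ y < (ρ ᵥ* empKernel a τ) y)
    (fun y _ => pr_col_gt_le hP ha hN hZN hn hK hlo hhi hinv hη0.le hη y)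
  let g : X × ℕ × Fin (Fintype.card X) → ((Σ x, Fin (Z x)) → S) → X → ℝ := fun q τ =>
    v ((empKernel a τ).updateRow q.1 (compKernel P a q.1)) q.2.1 q.2.2
  have h3 := hp.pr_exists_le (Finset.univ ×ˢ Finset.range (k + 1) ×ˢ lead X r)
    (fun q τ => η * ‖g q τ‖ < |((empKernel a τ - compKernel P a) *ᵥ g q τ) q.1|)
    (fun q _ => pr_abs_row_loo_le hP ha hN hZN hη0.le hη q.1 (g q) fun τ τ' h => by
      have : (empKernel a τ).updateRow q.1 (compKernel P a q.1)
          = (empKernel a τ').updateRow q.1 (compKernel P a q.1) := by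
        ext z y
        by_cases hz : z = q.1
        · subst hz; simp
        · have hh : ∀ j, τ ⟨z, j⟩ = τ' ⟨z, j⟩ := fun j => h _ hz
          simp [Matrix.updateRow_ne hz, empKernel, hh]
      simp only [g, this])
  have hcard : ((Finset.univ ×ˢ Finset.range (k + 1) ×ˢ lead X r :
      Finset (X × ℕ × Fin (Fintype.card X))).card : ℝ) ≤ Fintype.card X * (k + 1) * r := by
    rw [Finset.card_product, Finset.card_product, Finset.card_univ, Finset.card_range, ← mul_assoc]
    push_cast
    exact mul_le_mul_of_nonneg_left (by exact_mod_cast card_lead_le r) (by positivity)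
  rw [Finset.card_univ] at h2
  have h4 := mul_le_mul_of_nonneg_right hcard
    (by positivity : (0 : ℝ) ≤ 2 * Real.exp (-(η ^ 2 * N / 4)))
  refine (hp.pr_mono (B := fun τ => ((¬ ∀ f, e2 ((empKernel a τ - compKernel P a) *ᵥ f) ≤ η * e2 f) ∨
      ∃ y ∈ (Finset.univ : Finset X), (1 + η) * ρ y < (ρ ᵥ* empKernel a τ) y) ∨
      ∃ q ∈ (Finset.univ ×ˢ Finset.range (k + 1) ×ˢ lead X r :
        Finset (X × ℕ × Fin (Fintype.card X))),
        η * ‖g q τ‖ < |((empKernel a τ - compKernel P a) *ᵥ g q τ) q.1|) fun τ h => ?_).trans ?_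
  · by_contra hcon
    simp only [not_or, not_exists, not_and, not_lt, not_not] at hcon
    refine h ⟨hcon.1.1, fun y => hcon.1.2 y (Finset.mem_univ y), fun x m hm j hj => ?_⟩
    exact hcon.2 (x, m, j) (by simp [hj]; omega)
  · refine (hp.pr_or_le _ _).trans (add_le_add ((hp.pr_or_le _ _).trans (add_le_add h1 h2)) ?_)
    exact h3.trans h4

/-- The shifted successor measures of `Q` applied to a right singular vector of the `k`-th one. -/
noncomputable def rightVec (ν : X → ℝ) (hν : ∀ x, 0 < ν x) (γ : ℝ) (k : ℕ) (Q : Matrix X X ℝ)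
    (m : ℕ) (j : Fin (Fintype.card X)) : X → ℝ :=
  shifted γ Q m *ᵥ (Classical.choice (nonempty_nuSVD ν hν (shifted γ Q k))).φ j

/-- The leave-one-out decompositions are the fixed choices made in `rightVec`, to which the row
bounds refer. The decomposition `D'` stays arbitrary, and so one good event serves every SVD of the
empirical matrix. -/
theorem IsClose.abs_trunc_sub_mulVec_le {Q Q' : Matrix X X ℝ} (hQ : IsStochastic Q)
    (hQ' : IsStochastic Q') {γ n K G Λ η : ℝ} {k r : ℕ} (hγ0 : 0 ≤ γ) (hγ1 : γ < 1) (hn : 0 < n)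
    (hK : 1 ≤ K) {ρ ν : X → ℝ} (hlo : ∀ x, 1 ≤ K * (n * ρ x)) (hhi : ∀ x, n * ρ x ≤ K)
    (hinv : ρ ᵥ* Q = ρ) (hG1 : 1 ≤ G) (hG : (1 - γ)⁻¹ ≤ G) (hc : 6 * K ^ 2 * G ≤ Λ) (hη : 0 ≤ η)
    (hν : IsFullProb ν) (hνlo : ∀ x, 1 ≤ Λ * (n * ν x)) (hνhi : ∀ x, n * ν x ≤ Λ)
    (h : IsClose (rightVec ν hν.pos γ k) ρ η k r Q Q')
    (D : NuSVD ν (shifted γ Q k)) (D' : NuSVD ν (shifted γ Q' k))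
    (hr1 : 1 ≤ r) (hrn : r < Fintype.card X) (hrΛ : (r : ℝ) ≤ Λ) (hξ : D.recoverability ≤ Λ)
    (hgap : D.σ ⟨r, hrn⟩ + Λ⁻¹ ≤ D.σ ⟨r - 1, by omega⟩)
    (ha : 24 * ((k + 1) * η) * Λ ^ 9 ≤ 1) (f : X → ℝ) (x : X) :
    |((D'.trunc r - D.trunc r) *ᵥ f) x| ≤ 15 * ((k + 1) * η) * Λ ^ 11 * l2Norm ν f := by
  have hKG : 1 ≤ K ^ 2 * G := one_le_mul_of_one_le_of_one_le (one_le_pow₀ hK) hG1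
  have hΛ : 1 ≤ Λ := by linarith
  have hsmall : 4 * K ^ 2 * ((k + 1) * η) * G ≤ 1 := by
    have h1 : Λ ≤ Λ ^ 9 := le_self_pow₀ hΛ (by norm_num)
    have h2 : 0 ≤ (k + 1) * η := by positivity
    have h3 : (k + 1) * η * (4 * (K ^ 2 * G)) ≤ (k + 1) * η * (24 * Λ ^ 9) :=
      mul_le_mul_of_nonneg_left (by linarith) h2
    linarith
  obtain ⟨t1, t2, t3⟩ := tame_of_small hQ hQ' hγ0 hγ1 hn hK hlo hhi hinv hG1 hG hc hη hsmall
    h.e2_le h.col_le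
  refine ShiftedSuccessor.abs_trunc_sub_mulVec_le hn hΛ hη hγ0 hγ1.le hν hνlo hνhi t1 t2
    (fun _ => rfl) t3 h.e2_le D D'
    (fun x => Classical.choice (nonempty_nuSVD ν hν.pos _)) hr1 hrn hrΛ ?_ hξ hgap ha f x
  intro x m hm j hj b hb
  refine (h.row_le x m hm j hj).trans (mul_le_mul_of_nonneg_left ?_ hη)
  exact (pi_norm_le_iff_of_nonneg ((abs_nonneg _).trans (hb x))).2 hb

end Good

/-- The numerical estimate that turns a sample size of order `log (n r / δ)` into a failure
probability of at most `δ`. -/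
theorem failure_le {n r δ L K K₁ k W : ℝ} {t : ℕ} (hn : 2 ≤ n) (hr : 1 ≤ r) (hδ0 : 0 < δ)
    (hδ1 : δ < 1) (hL : L = Real.log (n * r / δ)) (hK : 1 ≤ K) (hK₁ : 1 ≤ K₁)
    (hk : k + 1 ≤ 2 * K₁) (hW : 1320 * K ^ 2 * Real.exp (2 * K ^ 2) * (K₁ ^ 2 * L) ≤ W)
    (ht : 8 * L ≤ t) (ht' : (t : ℝ) + 1 ≤ 11 * L) :
    2 * n ^ 2 * (40 * K ^ 2 * Real.exp (2 * K ^ 2) * (t + 1) / W) ^ (t + 1)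
        + n * Real.exp (-(W / (4 * K ^ 2))) + n * (k + 1) * r * (2 * Real.exp (-(W / 4))) ≤ δ := by
  have hK2 : 1 ≤ K ^ 2 := one_le_pow₀ hK
  have hK12 : 1 ≤ K₁ ^ 2 := one_le_pow₀ hK₁
  have hnr : 2 ≤ n * r := by nlinarith
  have hL0 : 0.69 ≤ L := by
    have h2 : (2 : ℝ) ≤ n * r / δ := by rw [le_div_iff₀ hδ0]; nlinarith
    have := Real.log_le_log (by norm_num) h2
    have := Real.log_two_gt_d9
    linarith
  set e := Real.exp (2 * K ^ 2)
  have he : 1 ≤ e := Real.one_le_exp (by positivity)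
  have hKe : 1 ≤ K ^ 2 * e := one_le_mul_of_one_le_of_one_le hK2 he
  have hKL : L ≤ K₁ ^ 2 * L := le_mul_of_one_le_left (by linarith) hK12
  have hKL0 : 0 < K₁ ^ 2 * L := by linarith
  have hW1 : 1320 * (K ^ 2 * e) * L ≤ W := by
    refine le_trans ?_ hW
    have := mul_le_mul_of_nonneg_left hKL (by positivity : 0 ≤ 1320 * (K ^ 2 * e))
    linarith
  have hW2 : 1320 * K ^ 2 * L ≤ W := by
    refine le_trans ?_ hW1
    have : K ^ 2 * L ≤ K ^ 2 * L * e := le_mul_of_one_le_right (by nlinarith) he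
    linarith
  have hW3 : 1320 * (K₁ ^ 2 * L) ≤ W := by
    refine le_trans ?_ hW
    have := le_mul_of_one_le_left hKL0.le hKe
    linarith
  have hW0 : 0 < W := by linarith
  -- With q = δ/(nr), each exponential is shown to be at most q⁸. The prefactors sum to at most
  -- (nr)⁴, and (nr)⁴q⁸ = δ⁴q⁴ ≤ δ.
  have hq : Real.exp (-L) = δ / (n * r) := by
    rw [hL, ← Real.log_inv, Real.exp_log (by positivity), inv_div]
  set q := δ / (n * r)
  have hq0 : 0 < q := by positivity
  have hqn : q * (n * r) = δ := div_mul_cancel₀ _ (by positivity)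
  have hq1 : q ≤ 1 := by nlinarith
  have hd : Real.exp (-(8 * L)) = q ^ 8 := by
    rw [← hq, ← Real.exp_nat_mul]; congr 1; push_cast; ring
  have b1 : (40 * K ^ 2 * e * (t + 1) / W) ^ (t + 1) ≤ q ^ 8 := by
    have h1 : 40 * K ^ 2 * e * (t + 1) / W ≤ Real.exp (-1) := by
      -- Here 40 · 11 = 440 is a third of 1320. The base is thus at most 1/3 < 1/e, and the exponent
      -- t + 1 > 8L does the rest.
      have h2 : 40 * K ^ 2 * e * (t + 1) / W ≤ 1 / 3 := by
        rw [div_le_iff₀ hW0]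
        have := mul_le_mul_of_nonneg_left ht' (by positivity : 0 ≤ 40 * (K ^ 2 * e))
        linarith
      have h3 : (1 : ℝ) / 3 ≤ Real.exp (-1) := by
        have := Real.exp_neg_one_gt_d9; linarith
      exact h2.trans h3
    calc _ ≤ Real.exp (-1) ^ (t + 1) := pow_le_pow_left₀ (by positivity) h1 _
      _ = Real.exp (-(t + 1)) := by rw [← Real.exp_nat_mul]; congr 1; push_cast; ring
      _ ≤ Real.exp (-(8 * L)) := Real.exp_le_exp.2 (by linarith)
      _ = q ^ 8 := hd
  have b2 : Real.exp (-(W / (4 * K ^ 2))) ≤ q ^ 8 := by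
    rw [← hd]
    refine Real.exp_le_exp.2 (neg_le_neg ?_)
    rw [le_div_iff₀ (by positivity)]
    nlinarith
  -- The number k + 1 of shifts is not under the logarithm. It is absorbed by the exponential
  -- through the extra factor K₁² in the sample size.
  have b3 : (k + 1) * (2 * Real.exp (-(W / 4))) ≤ q ^ 8 := by
    have h1 : 4 * K₁ ≤ Real.exp (4 * K₁) := by linarith [Real.add_one_le_exp (4 * K₁)]
    have h2 : (k + 1) * (2 * Real.exp (-(W / 4))) ≤ Real.exp (4 * K₁) * Real.exp (-(W / 4)) := by
      have := Real.exp_pos (-(W / 4))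
      nlinarith
    refine h2.trans ?_
    rw [← hd, ← Real.exp_add]
    refine Real.exp_le_exp.2 ?_
    have h3 : K₁ * 0.69 ≤ K₁ ^ 2 * L := by
      have : K₁ ≤ K₁ ^ 2 := le_self_pow₀ hK₁ (by norm_num)
      exact mul_le_mul this hL0 (by norm_num) (by positivity)
    linarith
  have b4 : n * (k + 1) * r * (2 * Real.exp (-(W / 4))) ≤ n * r * q ^ 8 := by
    have := mul_le_mul_of_nonneg_left b3 (by positivity : 0 ≤ n * r)
    linarith
  have b5 : 2 * n ^ 2 + n + n * r ≤ (n * r) ^ 4 := by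
    have h1 : n ≤ n * r := le_mul_of_one_le_right (by linarith) hr
    have h2 : n ^ 2 ≤ (n * r) ^ 2 := pow_le_pow_left₀ (by linarith) h1 2
    have h3 : 4 ≤ (n * r) ^ 2 := by nlinarith
    nlinarith
  have b6 : (n * r) ^ 4 * q ^ 8 ≤ δ := by
    have h1 : (n * r) ^ 4 * q ^ 8 = δ ^ 4 * q ^ 4 := by rw [← hqn]; ring
    rw [h1]
    calc δ ^ 4 * q ^ 4 ≤ δ ^ 4 * 1 :=
          mul_le_mul_of_nonneg_left (pow_le_one₀ hq0.le hq1) (by positivity)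
      _ ≤ δ := by rw [mul_one]; exact pow_le_of_le_one hδ0.le hδ1.le (by norm_num)
  have b7 := mul_le_mul_of_nonneg_right b5 (by positivity : 0 ≤ q ^ 8)
  have b8 := mul_le_mul_of_nonneg_left b1 (by positivity : 0 ≤ 2 * n ^ 2)
  have b9 := mul_le_mul_of_nonneg_left b2 (by linarith : 0 ≤ n)
  linarith


/-- The constant that dominates all the parameters of the problem. -/
noncomputable def masterConst (K G g : ℝ) : ℝ := 6 * K ^ 2 * G * (1 + 1 / g)

/-- The constant of the sample size. -/
noncomputable def sampleConst (K G g : ℝ) : ℝ :=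
  4 * (24 * masterConst K G g ^ 9) ^ 2 * (1320 * K ^ 2 * Real.exp (2 * K ^ 2))

theorem one_le_masterConst {K G g : ℝ} (hK : 1 ≤ K) (hG : 1 ≤ G) (hg : 0 < g) :
    1 ≤ masterConst K G g := by
  have h1 : 1 ≤ K ^ 2 * G := one_le_mul_of_one_le_of_one_le (one_le_pow₀ hK) hG
  have h2 : 0 ≤ K ^ 2 * G * (1 / g) := by positivity
  rw [masterConst]; linarith

theorem le_sampleConst {K G g : ℝ} (hK : 1 ≤ K) (hG : 1 ≤ G) (hg : 0 < g) :
    11 ≤ sampleConst K G g := by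
  have h1 : 1 ≤ masterConst K G g ^ 9 := one_le_pow₀ (one_le_masterConst hK hG hg)
  have h2 : 1 ≤ K ^ 2 := one_le_pow₀ hK
  have h3 : 1 ≤ Real.exp (2 * K ^ 2) := Real.one_le_exp (by positivity)
  have h4 := one_le_mul_of_one_le_of_one_le h2 h3
  have h5 : 1 ≤ (24 * masterConst K G g ^ 9) ^ 2 := one_le_pow₀ (by linarith)
  have h6 := one_le_mul_of_one_le_of_one_le h5 h4
  rw [sampleConst]; linarith

/-! ### Choice of parameters and the bound on the failure probability -/

section Combine

variable {X S : Type*} [Fintype X] [DecidableEq X] [Fintype S] [DecidableEq S]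

theorem pr_not_twoInftyNorm_le [Nonempty X] {P : X → S → ℝ} {a : S → X → ℝ} {Z : X → ℕ}
    (hP : IsKernel P) (ha : IsKernel a) {γ K G g δ ε : ℝ} {k r : ℕ} (hγ0 : 0 ≤ γ) (hγ1 : γ < 1)
    (hK : 1 ≤ K) (hG1 : 1 ≤ G) (hg : 0 < g) {ρ ν : X → ℝ} (hν : IsFullProb ν)
    (hlo : ∀ x, 1 ≤ K * (Fintype.card X * ρ x)) (hhi : ∀ x, Fintype.card X * ρ x ≤ K)
    (hinv : ρ ᵥ* compKernel P a = ρ)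
    (hνlo : ∀ x, 1 ≤ K * (Fintype.card X * ν x)) (hνhi : ∀ x, Fintype.card X * ν x ≤ K)
    (D : NuSVD ν (shifted γ (compKernel P a) k)) (hr1 : 1 ≤ r) (hrn : r < Fintype.card X)
    (hξ : D.recoverability ≤ G) (hgap : D.σ ⟨r, hrn⟩ + g ≤ D.σ ⟨r - 1, by omega⟩)
    (hδ0 : 0 < δ) (hδ1 : δ < 1) (hε0 : 0 < ε) (hε1 : ε ≤ 1)
    (hZ : ∀ x, sampleConst K G g * max (k : ℝ) (1 - γ)⁻¹ ^ 4 *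
      (Real.log (Fintype.card X * r / δ) / ε ^ 2) ≤ Z x) :
    pr (fun (i : Σ x, Fin (Z x)) s => P i.1 s)
      (fun τ => ¬ ∀ D' : NuSVD ν (shifted γ (empKernel a τ) k),
        twoInftyNorm ν (D'.trunc r - D.trunc r) ≤ masterConst K G g ^ 2 * ε) ≤ δ := by
  have hQk := compKernel_isKernel hP ha
  have hQ : IsStochastic (compKernel P a) := ⟨hQk.nonneg, hQk.sum_eq_one⟩
  have hΛ1 := one_le_masterConst hK hG1 hg
  have hc11 := le_sampleConst hK hG1 hg
  set Λ := masterConst K G g with hΛ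
  set n : ℝ := (Fintype.card X : ℝ) with hn_def
  have hn2 : 2 ≤ n := by
    have : 2 ≤ Fintype.card X := by omega
    rw [hn_def]; exact_mod_cast this
  have hr1' : (1 : ℝ) ≤ r := by exact_mod_cast hr1
  set L := Real.log (n * r / δ) with hL
  set K₁ := max (k : ℝ) (1 - γ)⁻¹ with hK₁
  have hK₁1 : 1 ≤ K₁ := (one_le_inv₀ (by linarith)).2 (by linarith) |>.trans (le_max_right _ _)
  have hk1 : (k : ℝ) + 1 ≤ 2 * K₁ := by
    have : (k : ℝ) ≤ K₁ := le_max_left _ _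
    linarith
  have hL0 : 0.69 ≤ L := by
    have h2 : (2 : ℝ) ≤ n * r / δ := by rw [le_div_iff₀ hδ0]; nlinarith
    have := Real.log_le_log (by norm_num) h2
    have := Real.log_two_gt_d9
    linarith
  have hKG : 1 ≤ K ^ 2 * G := one_le_mul_of_one_le_of_one_le (one_le_pow₀ hK) hG1
  have hΛ6 : 6 * K ^ 2 * G ≤ Λ := by
    have : 0 ≤ K ^ 2 * G * (1 / g) := by positivity
    rw [hΛ, masterConst]; linarith
  have hGΛ : G ≤ Λ := by
    have : G ≤ K ^ 2 * G := le_mul_of_one_le_left (by linarith) (one_le_pow₀ hK)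
    linarith
  have hKΛ : K ≤ Λ := by
    have h1 : K ≤ K ^ 2 := le_self_pow₀ hK (by norm_num)
    have h2 : K ^ 2 ≤ K ^ 2 * G := le_mul_of_one_le_right (by positivity) hG1
    linarith
  have hGg : G / g ≤ Λ := by
    have h1 : G / g ≤ K ^ 2 * (G / g) := le_mul_of_one_le_left (by positivity) (one_le_pow₀ hK)
    have h2 : Λ = 6 * (K ^ 2 * G) + 6 * (K ^ 2 * (G / g)) := by rw [hΛ, masterConst]; ring
    have h3 : 0 ≤ G / g := by positivity
    linarith
  -- The gap gives σ_r ≥ g, and r σ_r ≤ G by `NuSVD.mul_σ_le`. The zero-based index of σ_r is r - 1.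
  have hrΛ : (r : ℝ) ≤ Λ := by
    refine le_trans ?_ hGg
    rw [le_div_iff₀ hg]
    have h1 := D.mul_σ_le hν hξ ⟨r - 1, by omega⟩
    have h2 : ((r - 1 : ℕ) : ℝ) + 1 = r := by push_cast [Nat.cast_sub hr1]; ring
    rw [h2] at h1
    have h3 := D.σ_nonneg ⟨r, hrn⟩
    exact (mul_le_mul_of_nonneg_left (by linarith) (by positivity)).trans h1
  have hgΛ : Λ⁻¹ ≤ g := by
    rw [inv_le_comm₀ (by linarith) hg, ← one_div]
    exact (div_le_div_of_nonneg_right hG1 hg.le).trans hGg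
  have hG : (1 - γ)⁻¹ ≤ G := NuSVD.inv_one_sub_le hν hQ hγ0 hγ1 D hξ
  set A := 24 * Λ ^ 9 with hA
  have hA0 : 24 ≤ A := by have := one_le_pow₀ hΛ1 (n := 9); linarith
  have hk0 : (0 : ℝ) < k + 1 := by positivity
  -- This makes 24(k+1)ηΛ⁹ equal to ε ≤ 1, the smallness needed in the deterministic bound, whose
  -- error becomes (15/24)Λ²ε.
  set η := ε / (A * (k + 1)) with hη
  have hη0 : 0 < η := by positivity
  have hkη : (k + 1) * η * A = ε := by rw [hη]; field_simp
  have hη1 : η ≤ 2 := by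
    have : 1 ≤ A * (k + 1) := by
      have : (0 : ℝ) ≤ k := Nat.cast_nonneg k
      nlinarith
    exact ((div_le_self hε0.le this).trans hε1).trans (by norm_num)
  set N := sampleConst K G g * K₁ ^ 4 * (L / ε ^ 2) with hN
  have hNL : 11 * L ≤ N := by
    have h1 : L ≤ L / ε ^ 2 := by
      rw [le_div_iff₀ (by positivity)]
      exact mul_le_of_le_one_right (by linarith) (pow_le_one₀ hε0.le hε1)
    have h2 : 11 ≤ sampleConst K G g * K₁ ^ 4 :=
      hc11.trans (le_mul_of_one_le_right (by linarith) (one_le_pow₀ hK₁1))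
    exact mul_le_mul h2 h1 (by linarith) (by linarith)
  have hN0 : 0 < N := by linarith
  have hW : 1320 * K ^ 2 * Real.exp (2 * K ^ 2) * (K₁ ^ 2 * L) ≤ N * η ^ 2 := by
    set c₀ := 1320 * K ^ 2 * Real.exp (2 * K ^ 2) with hc₀
    -- Of the fourth power of K₁, two factors offset the (k+1)² in η², through k + 1 ≤ 2K₁, and two
    -- remain for the union bound over shifts. The 4 in `sampleConst` is the square of this 2.
    have e : N * η ^ 2 = c₀ * (K₁ ^ 2 * L) * ((2 * K₁) ^ 2 / (k + 1) ^ 2) := by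
      rw [hN, hη, sampleConst, ← hΛ, ← hA, ← hc₀]
      field_simp
      ring
    rw [e]
    refine le_mul_of_one_le_right (by positivity) ?_
    rw [one_le_div (by positivity)]
    exact pow_le_pow_left₀ hk0.le hk1 2
  -- The moment order is of logarithmic size. Since nr/δ ≥ 2 gives L ≥ 0.69 > 2/3, rounding up still
  -- leaves t + 1 ≤ 8L + 2 ≤ 11L.
  set t := ⌈8 * L⌉₊ with ht
  have ht1 : 8 * L ≤ t := Nat.le_ceil _
  have ht2 : (t : ℝ) + 1 ≤ 11 * L := by
    have := Nat.ceil_lt_add_one (by linarith : 0 ≤ 8 * L)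
    linarith
  have hZ0 : ∀ x, 0 < Z x := fun x => by exact_mod_cast hN0.trans_le (hZ x)
  have hfail := pr_not_isClose_le hP ha hN0 hZ hη0 hη1 (by linarith : 0 < n) hK hlo hhi hinv t
    (ht2.trans hNL) (rightVec ν hν.pos γ k) k r
  refine (hP.law.pr_mono fun τ hτ hclose => hτ fun D' => ?_).trans (hfail.trans ?_)
  · have := failure_le (t := t) hn2 hr1' hδ0 hδ1 hL hK hK₁1 hk1 hW ht1 ht2
    rwa [mul_comm (η ^ 2) N]
  · have hQ'k := empKernel_isKernel ha hZ0 τ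
    refine twoInftyNorm_le (by positivity) fun f x => ?_
    refine (hclose.abs_trunc_sub_mulVec_le hQ ⟨hQ'k.nonneg, hQ'k.sum_eq_one⟩ hγ0 hγ1
      (by linarith : 0 < n) hK hlo hhi hinv hG1 hG hΛ6 hη0.le hν
      (fun x => (hνlo x).trans (mul_le_mul_of_nonneg_right hKΛ ?_))
      (fun x => (hνhi x).trans hKΛ) D D' hr1 hrn hrΛ (hξ.trans hGΛ)
      (by linarith) ?_ f x).trans ?_
    · exact mul_nonneg (by linarith) (hν.pos x).le
    · have : 24 * ((k + 1) * η) * Λ ^ 9 = (k + 1) * η * A := by rw [hA]; ring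
      rw [this, hkη]; exact hε1
    · refine mul_le_mul_of_nonneg_right ?_ (Real.sqrt_nonneg _)
      have h1 : (k + 1) * η * Λ ^ 11 * 24 = Λ ^ 2 * ε := by rw [← hkη, hA]; ring
      have h2 : 0 ≤ (k + 1) * η * Λ ^ 11 := by positivity
      linarith

end Combine

end ShiftedSuccessor
-- The main theorem
theorem mainTheorem2 (Kξ Kσ Kν Kd g : ℝ) (hg : 0 < g) :
    ∃ c > (0 : ℝ), ∃ C > (0 : ℝ),
      ∀ (St : Type u) [Fintype St] [DecidableEq St]
        [MeasurableSpace St] [MeasurableSingletonClass St]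
        (Act : St → Type v) [∀ s, Fintype (Act s)] [∀ s, DecidableEq (Act s)]
        (P : (Σ s, Act s) → St → ℝ) (hP : ShiftedSuccessor.IsTransition P)
        (π : ∀ s, Act s → ℝ) (hπ : ShiftedSuccessor.IsPolicy π)
        (γ : ℝ) (hγ0 : 0 < γ) (hγ1 : γ < 1) (k : ℕ)
        (ν : (Σ s, Act s) → ℝ) (hν : ShiftedSuccessor.IsFullProb ν)
        (νinv : (Σ s, Act s) → ℝ)
        (hνinv : ShiftedSuccessor.IsInvariant (ShiftedSuccessor.policyMatrix P π) νinv)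
        (D : ShiftedSuccessor.NuSVD ν (ShiftedSuccessor.successor P π γ k))
        (r : ℕ) (hr1 : 1 ≤ r) (hrn : r < Fintype.card (Σ s, Act s))
        (hξ : D.recoverability ≤ Kξ)
        (hσ : D.singularValue 1 / D.singularValue r ≤ Kσ)
        (hratio : ∀ x x', ν x / ν x' ≤ Kν)
        (hd : ShiftedSuccessor.discrepancy ν νinv ≤ Kd)
        (hgap : g ≤ D.singularValue r - D.singularValue (r + 1))
        (δ : ℝ) (hδ0 : 0 < δ) (hδ1 : δ < 1) (ε : ℝ) (hε0 : 0 < ε) (hε1 : ε ≤ 1)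
        (Z : (Σ s, Act s) → ℕ)
        (hZ : ∀ x, c * max (k : ℝ) (1 - γ)⁻¹ ^ 4 *
          (Real.log (Fintype.card (Σ s, Act s) * r / δ) / ε ^ 2) ≤ Z x)
        (Ω : Type w) [MeasurableSpace Ω] (μ : Measure Ω) [IsProbabilityMeasure μ]
        (T : (Σ x : (Σ s, Act s), Fin (Z x)) → Ω → St)
        (hT : ShiftedSuccessor.IsTransitionSample μ P Z T),
        ENNReal.ofReal (1 - δ) ≤
          μ {ω | ∀ D' : ShiftedSuccessor.NuSVD ν
              (ShiftedSuccessor.successor (ShiftedSuccessor.empirical T ω) π γ k),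
            ShiftedSuccessor.twoInftyNorm ν (D'.trunc r - D.trunc r) ≤ C * ε} := by
  -- The invariant measure is within a factor Kd of ν, which is within Kν of uniform, so the product
  -- serves for both. The maxima with 1 make the constants legitimate for arbitrary real inputs.
  set K := max Kν 1 * max Kd 1 with hKdef
  set G := max Kξ 1 with hGdef
  have hK : 1 ≤ K := one_le_mul_of_one_le_of_one_le (le_max_right _ _) (le_max_right _ _)
  have hG : 1 ≤ G := le_max_right _ _
  have hΛ := ShiftedSuccessor.one_le_masterConst hK hG hg
  have hc := ShiftedSuccessor.le_sampleConst hK hG hg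
  refine ⟨ShiftedSuccessor.sampleConst K G g, by linarith,
    ShiftedSuccessor.masterConst K G g ^ 2, by positivity, ?_⟩
  intro St _ _ _ _ Act _ _ P hP π hπ γ hγ0 hγ1 k ν hν νinv hνinv D r hr1 hrn hξ _ hratio hd
    hgap δ hδ0 hδ1 ε hε0 hε1 Z hZ Ω _ μ _ T hT
  have : Nonempty (Σ s, Act s) := Fintype.card_pos_iff.1 (by omega)
  have hPk : ShiftedSuccessor.IsKernel P := ⟨hP.nonneg, hP.sum_eq_one⟩
  have ha := ShiftedSuccessor.policyKernel_isKernel hπ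
  have hQ := ShiftedSuccessor.policyMatrix_eq P π
  have hKν : Kν ≤ K := (le_max_left _ _).trans
    (le_mul_of_one_le_right (zero_le_one.trans (le_max_right _ _)) (le_max_right _ _))
  have hνb := ShiftedSuccessor.card_mul_bounds hν fun x x' => (hratio x x').trans (le_max_left Kν 1)
  have hνb' := ShiftedSuccessor.card_mul_bounds hν fun x x' => (hratio x x').trans hKν
  obtain ⟨hKd1, hdis⟩ := ShiftedSuccessor.le_of_discrepancy_le hν hνinv.toIsFullProb
    (hd.trans (le_max_left Kd 1))
  have hcard : (0 : ℝ) ≤ Fintype.card (Σ s, Act s) := Nat.cast_nonneg _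
  have hlo : ∀ x, 1 ≤ K * (Fintype.card (Σ s, Act s) * νinv x) := fun x => by
    have h1 := mul_le_mul_of_nonneg_left (hdis x).1
      (mul_nonneg (zero_le_one.trans (le_max_right Kν 1)) hcard)
    have h2 := (hνb x).1
    rw [hKdef]; linarith
  have hhi : ∀ x, Fintype.card (Σ s, Act s) * νinv x ≤ K := fun x => by
    have h1 := mul_le_mul_of_nonneg_left (hdis x).2 hcard
    have h2 := mul_le_mul_of_nonneg_left (hνb x).2 (zero_le_one.trans hKd1)
    rw [hKdef]; linarith
  have hs1 : D.singularValue r = D.σ ⟨r - 1, by omega⟩ := dif_pos ⟨hr1, hrn.le⟩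
  have hs2 : D.singularValue (r + 1) = D.σ ⟨r, hrn⟩ := dif_pos ⟨by omega, hrn⟩
  rw [hs1, hs2] at hgap
  have hinv := hνinv.invariant
  -- The type of `D` mentions the matrix. The matrix is generalised so that its identification with
  -- a composed kernel can be substituted; `transfer` below does the same for the empirical matrix.
  have main : ∀ (Q : Matrix (Σ s, Act s) (Σ s, Act s) ℝ),
      Q = ShiftedSuccessor.compKernel P (ShiftedSuccessor.policyKernel π) → νinv ᵥ* Q = νinv →
      ∀ D : ShiftedSuccessor.NuSVD ν (ShiftedSuccessor.shifted γ Q k),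
        D.recoverability ≤ Kξ → g ≤ D.σ ⟨r - 1, by omega⟩ - D.σ ⟨r, hrn⟩ →
        ShiftedSuccessor.pr (fun (i : Σ x, Fin (Z x)) s => P i.1 s)
          (fun τ => ¬ ∀ D' : ShiftedSuccessor.NuSVD ν (ShiftedSuccessor.shifted γ
            (ShiftedSuccessor.empKernel (ShiftedSuccessor.policyKernel π) τ) k),
            ShiftedSuccessor.twoInftyNorm ν (D'.trunc r - D.trunc r) ≤
              ShiftedSuccessor.masterConst K G g ^ 2 * ε) ≤ δ := by
    rintro Q rfl hinv D hξ hgap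
    exact ShiftedSuccessor.pr_not_twoInftyNorm_le hPk ha hγ0.le hγ1 hK hG hg hν hlo hhi hinv
      (fun x => (hνb' x).1) (fun x => (hνb' x).2) D hr1 hrn (hξ.trans (le_max_left _ _))
      (by linarith) hδ0 hδ1 hε0 hε1 hZ
  have hbad := main _ hQ hinv D hξ hgap
  have hlaw : ShiftedSuccessor.IsLaw (fun (i : Σ x, Fin (Z x)) s => P i.1 s) := hPk.law
  rw [ShiftedSuccessor.pr_not hlaw] at hbad
  refine (ENNReal.ofReal_le_ofReal (by linarith : 1 - δ ≤ _)).trans ?_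
  rw [← ShiftedSuccessor.measure_eq_pr hlaw hT.measurable hT.law hT.indep]
  refine measure_mono fun ω hω => ?_
  rw [Set.mem_ofPred_eq] at hω
  have transfer : ∀ Q, ShiftedSuccessor.policyMatrix (ShiftedSuccessor.empirical T ω) π = Q →
      (∀ D' : ShiftedSuccessor.NuSVD ν (ShiftedSuccessor.shifted γ Q k),
        ShiftedSuccessor.twoInftyNorm ν (D'.trunc r - D.trunc r) ≤
          ShiftedSuccessor.masterConst K G g ^ 2 * ε) →
      ∀ D' : ShiftedSuccessor.NuSVD ν
          (ShiftedSuccessor.successor (ShiftedSuccessor.empirical T ω) π γ k),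
        ShiftedSuccessor.twoInftyNorm ν (D'.trunc r - D.trunc r) ≤
          ShiftedSuccessor.masterConst K G g ^ 2 * ε := by
    rintro _ rfl h
    exact h
  exact transfer _ (ShiftedSuccessor.policyMatrix_empirical_eq T ω π) hω
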